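/- Consider the greedy server on $\mathbb{R}$. At time $0$ the server is at $x=0$ and the waiting customers form a Poisson point process on $\mathbb{R}$ with unit intensity; further customers arrive as a Poisson point process on the space-time half-plane $\mathbb{R}\times\mathbb{R}_+$ with intensity $\lambda>0$. Whenever the server is not travelling or serving, it chooses the waiting customer nearest to its current position and travels to it at speed $v\in(0,\infty]$ (instantaneously if $v=\infty$), ignoring new arrivals on the way, and then serves it; at the end of the service the customer leaves the system and the server chooses its next customer. The service times are i.i.d. copies of a random variable $T\ge 0$ with $\mathbb{E}T=1$, and the initial customers, the later arrivals and the service times are independent. Let $S_t$ be the position of the server at time $t$. Assume that $\mathbb{E}e^{\alpha T}<\infty$ for some $\alpha>0$. Then, for every $v\in(0,\infty]$ and every $\lambda>0$, the server is transient, that is, $|S_t|\to\infty$ almost surely as $t\to\infty$. Moreover, almost surely $\frac{S_t}{\lambda^{-1}\log t}$ converges as $t\to\infty$ to $+1$ or to $-1$, and each of the two limits has probability $1/2$. -/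

import Mathlib

open MeasureTheory ProbabilityTheory Filter Topology
open scoped ENNReal

noncomputable section

namespace GreedyServer

/-! ### Poisson point processes -/

section PointProcess

variable {Ω E : Type*} [MeasurableSpace Ω] [MeasurableSpace E]

/-- The number of points of the random set `ξ` in `B`, as an element of `ℕ ∪ {∞}`. -/
def count (ξ : Ω → Set E) (B : Set E) (ω : Ω) : ℕ∞ := (ξ ω ∩ B).encard

/-- The random set `ξ` is a Poisson point process with intensity measure `ν`: the number of points
in a set of finite intensity is Poisson distributed, and the numbers of points in pairwise disjoint
sets are independent. (For an atomless `ν`, as is used below, a Poisson process has almost surely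
no multiple points, so that it is a random set.) -/
structure IsPoissonProcess (μ : Measure Ω) (ν : Measure E) (ξ : Ω → Set E) : Prop where
  measurable_count : ∀ B : Set E, MeasurableSet B → Measurable (count ξ B)
  map_count : ∀ B : Set E, MeasurableSet B → ν B ≠ ∞ →
    μ.map (count ξ B) = (poissonMeasure (ν B).toNNReal).map (Nat.cast : ℕ → ℕ∞)
  indep_count : ∀ (n : ℕ) (B : Fin n → Set E), (∀ i, MeasurableSet (B i)) →
    Pairwise (fun i j => Disjoint (B i) (B j)) → iIndepFun (fun i => count ξ (B i)) μ

/-- The σ-algebra generated by the point process `ξ`. -/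
abbrev sigmaPoints (ξ : Ω → Set E) : MeasurableSpace Ω :=
  ⨆ (B : Set E) (_ : MeasurableSet B), MeasurableSpace.comap (count ξ B) inferInstance

/-- The σ-algebra generated by the whole sequence `T`. -/
abbrev sigmaSeq (T : ℕ → Ω → ℝ) : MeasurableSpace Ω :=
  MeasurableSpace.comap (fun ω n => T n ω) MeasurableSpace.pi

end PointProcess

/-! ### The motion of the greedy server

A customer is a pair `(x, a)`: its position `x` and its arrival time `a`. Everything in this
section is deterministic: it depends on the set `C` of all customers, past and future, on the speed
`v ∈ (0, ∞]` and on the successive service times `T 0, T 1, …`. -/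

/-- The set of all customers: those with positions in `A`, present initially (arrival time `0`),
and those of the set `B` of later arrivals. -/
def customers (A : Set ℝ) (B : Set (ℝ × ℝ)) : Set (ℝ × ℝ) := (fun x => (x, (0 : ℝ))) '' A ∪ B

/-- The state of the system at a decision time, when the server is free to choose a customer:
its position, the current time, and the set of the customers already served. -/
structure State where
  pos : ℝ
  time : ℝ
  served : Set (ℝ × ℝ)

/-- The customers that have arrived and have not been served. -/
def waiting (C : Set (ℝ × ℝ)) (s : State) : Set (ℝ × ℝ) :=
  {c | c ∈ C ∧ c.2 ≤ s.time ∧ c ∉ s.served}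

/-- `c` is a waiting customer at minimal distance from the server. -/
def IsNearest (C : Set (ℝ × ℝ)) (s : State) (c : ℝ × ℝ) : Prop :=
  c ∈ waiting C s ∧ ∀ c' ∈ waiting C s, |c.1 - s.pos| ≤ |c'.1 - s.pos|

open Classical in
/-- The customer that the server chooses: a nearest waiting one. For Poisson arrivals it exists and
is unique almost surely at every decision time; otherwise ties are broken arbitrarily, and if there
is no nearest customer the server stays where it is for the next service period. -/
def nextCustomer (C : Set (ℝ × ℝ)) (s : State) : ℝ × ℝ :=
  if h : ∃ c, IsNearest C s c then h.choose else (s.pos, s.time)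

/-- The time needed to travel from `x` to `y` at speed `v`; it is `0` for `v = ∞`. -/
def travelTime (v : ℝ≥0∞) (x y : ℝ) : ℝ := (ENNReal.ofReal |y - x| / v).toReal

/-- One cycle: choose the next customer, travel to it at speed `v`, serve it for time `T`. -/
def step (C : Set (ℝ × ℝ)) (v : ℝ≥0∞) (T : ℝ) (s : State) : State where
  pos := (nextCustomer C s).1
  time := s.time + travelTime v s.pos (nextCustomer C s).1 + T
  served := insert (nextCustomer C s) s.served

/-- The state at the decision time after `n` services; the server starts at `0` at time `0`. -/
def state (C : Set (ℝ × ℝ)) (v : ℝ≥0∞) (T : ℕ → ℝ) : ℕ → State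
  | 0 => ⟨0, 0, ∅⟩
  | n + 1 => step C v (T n) (state C v T n)

/-- The number of services completed by time `t`: the `n` for which `t` lies between the `n`-th
decision time (included) and the next one (excluded). -/
def numServed (C : Set (ℝ × ℝ)) (v : ℝ≥0∞) (T : ℕ → ℝ) (t : ℝ) : ℕ :=
  sInf {n : ℕ | t < (state C v T (n + 1)).time}

open Classical in
/-- The position at time `r` after departure of a server that travels from `x` to `y` at constant
speed `v`, and then stays at `y`. -/
def travelPos (v : ℝ≥0∞) (x y r : ℝ) : ℝ :=
  if travelTime v x y ≤ r then y else x + r / travelTime v x y * (y - x)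

/-- The position of the greedy server at time `t ≥ 0`. -/
def position (C : Set (ℝ × ℝ)) (v : ℝ≥0∞) (T : ℕ → ℝ) (t : ℝ) : ℝ :=
  travelPos v (state C v T (numServed C v T t)).pos (state C v T (numServed C v T t + 1)).pos
    (t - (state C v T (numServed C v T t)).time)

/-! ### The stochastic model -/

/-- The random input of the greedy server on the real line: `ξ₀` is the set of positions of the
initial customers, `ξ` the set of pairs (position, time) of later arrivals, and `T n` is the
duration of the `(n + 1)`-st service. -/
structure IsGreedyModel {Ω : Type*} [MeasurableSpace Ω] (μ : Measure Ω) (lam : ℝ)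
    (ξ₀ : Ω → Set ℝ) (ξ : Ω → Set (ℝ × ℝ)) (T : ℕ → Ω → ℝ) : Prop where
  initial : IsPoissonProcess μ (volume : Measure ℝ) ξ₀
  arrivals : IsPoissonProcess μ
    (ENNReal.ofReal lam • (volume : Measure (ℝ × ℝ)).restrict (Set.univ ×ˢ Set.Ici 0)) ξ
  measurable_service : ∀ n, Measurable (T n)
  service_nonneg : ∀ n, ∀ᵐ ω ∂μ, 0 ≤ T n ω
  service_indep : iIndepFun T μ
  service_identDistrib : ∀ n, IdentDistrib (T n) (T 0) μ μ
  service_mean : ∫ ω, T 0 ω ∂μ = 1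
  indep : iIndep ![sigmaPoints ξ₀, sigmaPoints ξ, sigmaSeq T] μ

/-- The position `S_t` of the greedy server, as a random process. -/
def S {Ω : Type*} (v : ℝ≥0∞) (ξ₀ : Ω → Set ℝ) (ξ : Ω → Set (ℝ × ℝ)) (T : ℕ → Ω → ℝ)
    (t : ℝ) (ω : Ω) : ℝ :=
  position (customers (ξ₀ ω) (ξ ω)) v (fun n => T n ω) t

/-- A real process is transient if almost surely it eventually leaves every bounded set for
ever. -/
def IsTransient {Ω : Type*} [MeasurableSpace Ω] (μ : Measure Ω) (X : ℝ → Ω → ℝ) : Prop :=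
  ∀ᵐ ω ∂μ, Tendsto (fun t => X t ω) atTop (Bornology.cobounded ℝ)

end GreedyServer

end

open MeasureTheory ProbabilityTheory Filter Topology
open scoped ENNReal

noncomputable section

namespace GreedyServer

/-! ### Locally finite configurations -/

/-! A decision taken at position `x` and time `t` that leads to a customer at distance `r` explores
the points within `r` of `x` with arrival time at most `t`. The explored customers are exactly the
served ones, and a Poisson process has independent restrictions to disjoint sets. So, given the path
up to step `n`, the unexplored customers are again Poisson, on the complement of the explored
region, and the remaining services are fresh (`pathLaw_step`, `pathLaw_bind`). It therefore suffices
to have estimates that are uniform over deterministic histories: an event of conditional probability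
at least `δ` after every history is almost sure (`pathLaw_eq_one`, a zero-one law).

The event in question is that the server is asymptotically at its running maximum, or at its running
minimum. To bound its probability from below, let the server make a fixed number of tiny steps with
services of length at least one. Then many unexplored customers accumulate close by on both sides.
On the side where a mass `M₁` is reached within the shorter distance, the server may jump over half
of this mass (`le_pathLaw_rightward`). Behind it everything has just been cleared, while the
territory ahead is dense in old customers, at a density `w` that grows at least linearly with time.
To turn back, the server would have to meet one of the few recent customers behind before one of the
many ahead.

`Frontier` makes this quantitative. With a clock `a` such that `a ^ 16` is `M ^ 16` plus `lam` times
the elapsed time and is at most `w`, the next customer is within `a / w` beyond the frontier up to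
probability `exp (-a)`. A recent competitor, or too short an advance, has probability at most `1 / a
^ 6`. Two such mishaps in a row are tolerated, so that a fatal one costs `1 / a ^ 18`, whereas `1 /
a` decreases by order `1 / a ^ 17` in a unit of time. Hence `1 / a + (1 / a ^ 6) ^ (3 - i)`, with
`i` the current number of mishaps, is a supermartingale that bounds the probability of failure
(`Frontier.pathLaw_compl_le`), and it starts below one half.

For the speed, let the server move to the right. A cell of length `1 / q` reached after `n`
services, at a time close to `n`, contains about `lam * n / q` customers; all of them are served
before the cell is left, and hardly any others. The number of services is thus multiplied by about
`1 + lam / q` per cell, by `exp lam` per unit of length, and the position after `n` services is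
asymptotic to `lam⁻¹ * log n` (`exists_pow_le`, `exists_le_pow`). Travel is negligible, because
steps back become small and the net displacement is logarithmic, so the time is asymptotic to `n`.
Reflection preserves the law, which gives each direction probability one half; transience follows
from the limit. -/

/-- The space-time boxes in which a configuration has to be finite. -/
def box (k : ℕ) : Set (ℝ × ℝ) := Set.Icc (-(k : ℝ)) k ×ˢ Set.Icc 0 (k : ℝ)

lemma measurableSet_box (k : ℕ) : MeasurableSet (box k) :=
  measurableSet_Icc.prod measurableSet_Icc

lemma box_mono : Monotone box := by
  intro i j hij c hc
  have : (i : ℝ) ≤ j := by exact_mod_cast hij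
  simp only [box, Set.mem_prod, Set.mem_Icc] at hc ⊢
  refine ⟨⟨?_, ?_⟩, ?_, ?_⟩ <;> linarith [hc.1.1, hc.1.2, hc.2.1, hc.2.2]

lemma exists_mem_box {c : ℝ × ℝ} (hc : 0 ≤ c.2) : ∃ k, c ∈ box k := by
  obtain ⟨k, hk⟩ := exists_nat_ge (max |c.1| c.2)
  refine ⟨k, ⟨?_, ?_⟩, hc, (le_max_right _ _).trans hk⟩
  · have := neg_abs_le c.1; have := (le_max_left |c.1| c.2).trans hk; linarith
  · have := le_abs_self c.1; have := (le_max_left |c.1| c.2).trans hk; linarith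

/-- A locally finite set of customers with nonnegative arrival times. -/
structure Conf where
  carrier : Set (ℝ × ℝ)
  nonneg : ∀ c ∈ carrier, 0 ≤ c.2
  finite : ∀ k, (carrier ∩ box k).Finite

namespace Conf

@[ext] lemma ext' {s s' : Conf} (h : s.carrier = s'.carrier) : s = s' := by
  cases s; cases s'; simp_all

/-- The number of points of `s` in `B`. -/
def cnt (s : Conf) (B : Set (ℝ × ℝ)) : ℕ∞ := (s.carrier ∩ B).encard

/-- The counts of a configuration in bounded sets. -/
def counts (s : Conf) (i : ℕ × {B : Set (ℝ × ℝ) // MeasurableSet B}) : ℕ∞ :=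
  s.cnt (i.2.1 ∩ box i.1)

/-- Only bounded sets enter. They have finite intensity, so that the law of a Poisson configuration
is determined on this σ-algebra (`map_conf_eq`). -/
instance : MeasurableSpace Conf := MeasurableSpace.comap counts MeasurableSpace.pi

lemma measurable_counts : Measurable counts := comap_measurable _

lemma measurable_iff {α : Type*} [MeasurableSpace α] {f : α → Conf} :
    Measurable f ↔ ∀ (k : ℕ) (B : Set (ℝ × ℝ)), MeasurableSet B →
      Measurable fun a => (f a).cnt (B ∩ box k) := by
  rw [measurable_comap_iff, measurable_pi_iff]
  exact ⟨fun h k B hB => h (k, ⟨B, hB⟩), fun h i => h i.1 i.2.1 i.2.2⟩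

/-- The restriction of a configuration to `B`. -/
def inter (s : Conf) (B : Set (ℝ × ℝ)) : Conf where
  carrier := s.carrier ∩ B
  nonneg c hc := s.nonneg c hc.1
  finite k := (s.finite k).subset fun _ hc => ⟨hc.1.1, hc.2⟩

lemma inter_inter (s : Conf) (A B : Set (ℝ × ℝ)) : (s.inter A).inter B = s.inter (A ∩ B) := by
  ext1; simp [inter, Set.inter_assoc]

lemma cnt_inter (s : Conf) (A B : Set (ℝ × ℝ)) : (s.inter A).cnt B = s.cnt (A ∩ B) := by
  simp [inter, cnt, Set.inter_assoc]

/-- The counting measure of a configuration in a box. -/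
def boxKernel (k : ℕ) : Kernel Conf (ℝ × ℝ) where
  toFun s := Measure.count.restrict (s.carrier ∩ box k)
  measurable' := by
    refine Measure.measurable_of_measurable_coe _ fun B hB => ?_
    have : ∀ s : Conf, Measure.count.restrict (s.carrier ∩ box k) B
        = ((s.cnt (B ∩ box k) : ℕ∞) : ℝ≥0∞) := by
      intro s
      rw [Measure.restrict_apply hB, Measure.count_apply (hB.inter (s.finite k).measurableSet)]
      congr 2
      ext c; simp; tauto
    simp_rw [this]
    exact (Measurable.of_discrete (f := fun n : ℕ∞ => (n : ℝ≥0∞))).comp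
      (measurable_iff.1 measurable_id k B hB)

instance (k : ℕ) (s : Conf) : IsFiniteMeasure (boxKernel k s) :=
  ⟨by
    change Measure.count.restrict (s.carrier ∩ box k) Set.univ < ∞
    rw [Measure.restrict_apply_univ]
    exact Measure.count_apply_lt_top.2 (s.finite k)⟩

lemma boxKernel_apply (k : ℕ) (s : Conf) {B : Set (ℝ × ℝ)} (hB : MeasurableSet B) :
    boxKernel k s B = ((s.cnt (B ∩ box k) : ℕ∞) : ℝ≥0∞) := by
  change Measure.count.restrict (s.carrier ∩ box k) B = _
  rw [Measure.restrict_apply hB, Measure.count_apply (hB.inter (s.finite k).measurableSet)]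
  congr 2
  ext c; simp; tauto

variable {P : Type*} [MeasurableSpace P]

/-- A count in a set depending on the parameter is the mass of a section under a finite kernel,
hence measurable. This covers random windows and random explored regions. -/
lemma measurable_cnt_box {f : P → Conf} (hf : Measurable f) (k : ℕ) {Q : Set (P × (ℝ × ℝ))}
    (hQ : MeasurableSet Q) :
    Measurable fun p => (f p).cnt ({c | (p, c) ∈ Q} ∩ box k) := by
  have hfin : ∀ p : P, IsFiniteMeasure ((boxKernel k).comap f hf p) := fun p => by
    rw [Kernel.comap_apply]; infer_instance
  have h := Kernel.measurable_kernel_prodMk_left_of_finite (κ := (boxKernel k).comap f hf) hQ hfin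
  have h2 : ∀ p, ((boxKernel k).comap f hf) p (Prod.mk p ⁻¹' Q)
      = (((f p).cnt ({c | (p, c) ∈ Q} ∩ box k) : ℕ∞) : ℝ≥0∞) := by
    intro p
    rw [Kernel.comap_apply, boxKernel_apply _ _ (measurable_prodMk_left hQ)]
    rfl
  simp_rw [h2] at h
  refine measurable_to_countable' fun n => ?_
  have h3 := h (measurableSet_singleton ((n : ℕ∞) : ℝ≥0∞))
  convert h3 using 1
  ext p
  simp

/-- If the count exceeded the supremum, a subset with one point more than the supremum would be
finite, hence contained in a single box. -/
lemma cnt_eq_iSup (s : Conf) (B : Set (ℝ × ℝ)) : s.cnt B = ⨆ k, s.cnt (B ∩ box k) := by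
  refine le_antisymm ?_ (iSup_le fun k => Set.encard_mono (by gcongr; exact Set.inter_subset_left))
  by_contra! hlt
  obtain ⟨t, ht, htc⟩ := Set.exists_subset_encard_eq (Order.add_one_le_of_lt hlt)
  have htop : (⨆ k, s.cnt (B ∩ box k)) ≠ ⊤ := ne_top_of_lt hlt
  have htf : t.Finite := by
    rw [← Set.encard_lt_top_iff, htc]
    exact ENat.add_lt_top.2 ⟨lt_top_iff_ne_top.2 htop, by simp⟩
  have : ∃ k, t ⊆ box k := by
    have hk : ∀ c ∈ t, ∃ k, c ∈ box k := fun c hc => exists_mem_box (s.nonneg c (ht hc).1)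
    choose! k hk using hk
    refine ⟨htf.toFinset.sup k, fun c hc => box_mono ?_ (hk c hc)⟩
    exact Finset.le_sup (f := k) (htf.mem_toFinset.2 hc)
  obtain ⟨k, hk⟩ := this
  have h1 : t.encard ≤ s.cnt (B ∩ box k) :=
    Set.encard_mono fun c hc => ⟨(ht hc).1, (ht hc).2, hk hc⟩
  have h2 := h1.trans (le_iSup (fun k => s.cnt (B ∩ box k)) k)
  rw [htc] at h2
  exact absurd (ENat.add_one_le_iff htop |>.1 h2) (lt_irrefl _)

lemma measurable_cnt {f : P → Conf} (hf : Measurable f) {Q : Set (P × (ℝ × ℝ))}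
    (hQ : MeasurableSet Q) : Measurable fun p => (f p).cnt {c | (p, c) ∈ Q} := by
  simp_rw [fun p => cnt_eq_iSup (f p) {c | (p, c) ∈ Q}]
  have hle : ∀ n : ℕ∞, MeasurableSet {p | ⨆ k, (f p).cnt ({c | (p, c) ∈ Q} ∩ box k) ≤ n} := by
    intro n
    simp only [iSup_le_iff, Set.ofPred_forall]
    exact MeasurableSet.iInter fun k =>
      measurable_cnt_box hf k hQ (Set.to_countable (Set.Iic n)).measurableSet
  refine measurable_to_countable' fun n => ?_
  have : (fun p => ⨆ k, (f p).cnt ({c | (p, c) ∈ Q} ∩ box k)) ⁻¹' {n} =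
      {p | ⨆ k, (f p).cnt ({c | (p, c) ∈ Q} ∩ box k) ≤ n} \
        ⋃ m ∈ Set.Iio n, {p | ⨆ k, (f p).cnt ({c | (p, c) ∈ Q} ∩ box k) ≤ m} := by
    ext p
    simp only [Set.mem_preimage, Set.mem_singleton_iff, Set.mem_sdiff, Set.mem_ofPred_eq,
      Set.mem_iUnion, Set.mem_Iio, exists_prop, not_exists, not_and, not_le]
    constructor
    · rintro rfl
      exact ⟨le_rfl, fun m hm => hm⟩
    · rintro ⟨h1, h2⟩
      by_contra h3
      exact lt_irrefl _ (h2 _ (lt_of_le_of_ne h1 h3))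
  rw [this]
  exact (hle n).diff (MeasurableSet.biUnion (Set.to_countable _) fun m _ => hle m)

lemma measurable_inter {f : P → Conf} (hf : Measurable f) {Q : Set (P × (ℝ × ℝ))}
    (hQ : MeasurableSet Q) : Measurable fun p => (f p).inter {c | (p, c) ∈ Q} := by
  refine measurable_iff.2 fun k B hB => ?_
  simp_rw [cnt_inter]
  have := measurable_cnt_box hf k (hQ.inter (measurable_snd hB))
  convert this using 3 with p
  ext c; simp [and_assoc]

lemma measurable_inter_const (B : Set (ℝ × ℝ)) (hB : MeasurableSet B) :
    Measurable fun s : Conf => s.inter B :=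
  measurable_inter (f := fun s : Conf => s) measurable_id (Q := Prod.snd ⁻¹' B) (measurable_snd hB)

end Conf

/-! ### The nearest customer -/

/-- `c` is strictly nearer to `p.1` than all the other customers of `s` that have arrived by
time `p.2`. -/
def IsStrictNearest (p : ℝ × ℝ) (s : Set (ℝ × ℝ)) (c : ℝ × ℝ) : Prop :=
  (c ∈ s ∧ c.2 ≤ p.2) ∧ ∀ c' ∈ s, c'.2 ≤ p.2 → c' ≠ c → |c.1 - p.1| < |c'.1 - p.1|

lemma IsStrictNearest.unique {p : ℝ × ℝ} {s : Set (ℝ × ℝ)} {c c' : ℝ × ℝ}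
    (h : IsStrictNearest p s c) (h' : IsStrictNearest p s c') : c = c' := by
  by_contra hne
  have h1 := h.2 c' h'.1.1 h'.1.2 (Ne.symm hne)
  have h2 := h'.2 c h.1.1 h.1.2 hne
  exact lt_asymm h1 h2

/-- The customers that have arrived by time `p.2`, at distance less than `r` from `p.1`. -/
def win (p : ℝ × ℝ) (r : ℝ) : Set (ℝ × ℝ) := {c | |c.1 - p.1| < r ∧ c.2 ≤ p.2}

lemma Conf.finite_win (s : Conf) (p : ℝ × ℝ) (r : ℝ) : (s.carrier ∩ win p r).Finite := by
  obtain ⟨k, hk⟩ := exists_nat_ge (max (|p.1| + r) p.2)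
  refine (s.finite k).subset fun c hc => ⟨hc.1, ?_⟩
  have h1 := (le_max_left _ _).trans hk
  have h2 := (le_max_right _ _).trans hk
  have h3 : |c.1| ≤ k := by
    have := abs_sub_abs_le_abs_sub c.1 p.1
    linarith [hc.2.1]
  exact ⟨abs_le.1 h3, s.nonneg c hc.1, hc.2.2.trans h2⟩

/-- By local finiteness a strict minimum of the distance is isolated, so a window of rational radius
contains that customer alone. This turns existence into a countable union of events about counts. -/
lemma isStrictNearest_iff (p : ℝ × ℝ) (s : Conf) (A : Set (ℝ × ℝ)) :
    (∃ c, IsStrictNearest p s.carrier c ∧ c ∈ A) ↔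
      ∃ q : ℚ, s.cnt (win p q) = 1 ∧ s.cnt (win p q ∩ A) = 1 := by
  constructor
  · rintro ⟨c, hc, hcA⟩
    have hfin := s.finite_win p (|c.1 - p.1| + 1)
    obtain ⟨q, hq1, hq2⟩ : ∃ q : ℚ, |c.1 - p.1| < q ∧ ∀ c' ∈ s.carrier, c'.2 ≤ p.2 → c' ≠ c →
        (q : ℝ) ≤ |c'.1 - p.1| := by
      have hex : ∃ d > |c.1 - p.1|, ∀ c' ∈ s.carrier, c'.2 ≤ p.2 → c' ≠ c → d ≤ |c'.1 - p.1| := by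
        by_cases hne : ((s.carrier ∩ win p (|c.1 - p.1| + 1)) \ {c}).Nonempty
        · obtain ⟨m, hm, hmin⟩ := Set.exists_min_image _ (fun c' : ℝ × ℝ => |c'.1 - p.1|)
            (hfin.sdiff (t := {c})) hne
          refine ⟨|m.1 - p.1|, hc.2 m hm.1.1 hm.1.2.2 hm.2, fun c' h1 h2 h3 => ?_⟩
          by_cases h4 : |c'.1 - p.1| < |c.1 - p.1| + 1
          · exact hmin c' ⟨⟨h1, h4, h2⟩, h3⟩
          · exact hm.1.2.1.le.trans (not_lt.1 h4)
        · refine ⟨|c.1 - p.1| + 1, by simp, fun c' h1 h2 h3 => ?_⟩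
          by_contra! h4
          exact hne ⟨c', ⟨h1, h4, h2⟩, h3⟩
      obtain ⟨d, hd1, hd2⟩ := hex
      obtain ⟨q, hq1, hq2⟩ := exists_rat_btwn hd1
      exact ⟨q, hq1, fun c' h1 h2 h3 => hq2.le.trans (hd2 c' h1 h2 h3)⟩
    have hset : s.carrier ∩ win p q = {c} := by
      ext c'
      simp only [Set.mem_inter_iff, Set.mem_singleton_iff, win, Set.mem_ofPred_eq]
      constructor
      · rintro ⟨h1, h2, h3⟩
        by_contra h4
        exact absurd (hq2 c' h1 h3 h4) (not_le.2 h2)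
      · rintro rfl
        exact ⟨hc.1.1, hq1, hc.1.2⟩
    refine ⟨q, ?_, ?_⟩
    · rw [Conf.cnt, hset, Set.encard_singleton]
    · rw [Conf.cnt, ← Set.inter_assoc, hset, Set.inter_eq_left.2 (by simpa using hcA),
        Set.encard_singleton]
  · rintro ⟨q, h1, h2⟩
    obtain ⟨c, hc⟩ := Set.encard_eq_one.1 h1
    obtain ⟨c', hc'⟩ := Set.encard_eq_one.1 h2
    have hcm : c' ∈ s.carrier ∩ (win p q ∩ A) := hc' ▸ rfl
    have : c' ∈ ({c} : Set (ℝ × ℝ)) := hc ▸ ⟨hcm.1, hcm.2.1⟩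
    obtain rfl : c' = c := this
    refine ⟨c', ⟨⟨hcm.1, hcm.2.1.2⟩, fun c'' h3 h4 h5 => ?_⟩, hcm.2.2⟩
    by_contra! h6
    have : c'' ∈ ({c'} : Set (ℝ × ℝ)) := hc ▸ ⟨h3, h6.trans_lt hcm.2.1.1, h4⟩
    exact h5 this

open Classical in
/-- The strictly nearest customer, if there is one. -/
def nearest (p : ℝ × ℝ) (s : Set (ℝ × ℝ)) : ℝ × ℝ :=
  if h : ∃ c, IsStrictNearest p s c then h.choose else 0

lemma IsStrictNearest.nearest_eq {p : ℝ × ℝ} {s : Set (ℝ × ℝ)} {c : ℝ × ℝ}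
    (h : IsStrictNearest p s c) : nearest p s = c := by
  have hex : ∃ c, IsStrictNearest p s c := ⟨c, h⟩
  rw [nearest, dif_pos hex]
  exact hex.choose_spec.unique h

lemma measurableSet_win {P : Type*} [MeasurableSpace P] {f : P → ℝ × ℝ} (hf : Measurable f)
    {r : P → ℝ} (hr : Measurable r) :
    MeasurableSet {x : P × (ℝ × ℝ) | x.2 ∈ win (f x.1) (r x.1)} := by
  have h1 : Measurable fun x : P × (ℝ × ℝ) => f x.1 := hf.comp measurable_fst
  have h2 : Measurable fun x : P × (ℝ × ℝ) => r x.1 := hr.comp measurable_fst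
  have h3 : Measurable fun x : P × (ℝ × ℝ) => |x.2.1 - (f x.1).1| := by fun_prop
  exact (measurableSet_lt h3 h2).inter
    (measurableSet_le (measurable_snd.comp measurable_snd) (measurable_snd.comp h1))

section
variable {P : Type*} [MeasurableSpace P] {f : P → Conf} {g : P → ℝ × ℝ}

lemma measurableSet_strictNearest_mem (hf : Measurable f) (hg : Measurable g)
    {A : Set (ℝ × ℝ)} (hA : MeasurableSet A) :
    MeasurableSet {a | ∃ c, IsStrictNearest (g a) (f a).carrier c ∧ c ∈ A} := by
  simp_rw [isStrictNearest_iff]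
  simp only [Set.ofPred_exists]
  refine MeasurableSet.iUnion fun q => MeasurableSet.inter ?_ ?_
  · exact Conf.measurable_cnt hf (measurableSet_win hg (r := fun _ => (q : ℝ)) measurable_const)
      (measurableSet_singleton 1)
  · exact Conf.measurable_cnt hf ((measurableSet_win hg (r := fun _ => (q : ℝ))
      measurable_const).inter (measurable_snd hA)) (measurableSet_singleton 1)

lemma measurableSet_strictNearest (hf : Measurable f) (hg : Measurable g) :
    MeasurableSet {a | ∃ c, IsStrictNearest (g a) (f a).carrier c} := by
  simpa using measurableSet_strictNearest_mem hf hg MeasurableSet.univ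

lemma measurable_nearest (hf : Measurable f) (hg : Measurable g) :
    Measurable fun a => nearest (g a) (f a).carrier := by
  intro A hA
  have h1 := measurableSet_strictNearest_mem hf hg hA
  have h2 := (measurableSet_strictNearest hf hg).compl
  -- Without a strictly nearest customer the value is the default `0`, which may or may not lie in
  -- `A`.
  by_cases h0 : (0 : ℝ × ℝ) ∈ A
  · convert h1.union h2 using 1
    ext a
    simp only [Set.mem_preimage, Set.mem_union, Set.mem_ofPred_eq, Set.mem_compl_iff]
    by_cases h : ∃ c, IsStrictNearest (g a) (f a).carrier c
    · obtain ⟨c, hc⟩ := h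
      rw [hc.nearest_eq]
      exact ⟨fun h => Or.inl ⟨c, hc, h⟩, fun h => h.elim
        (fun ⟨c', h1, h2⟩ => hc.unique h1 ▸ h2) (fun h => absurd ⟨c, hc⟩ h)⟩
    · rw [nearest, dif_neg h]
      exact ⟨fun _ => Or.inr h, fun _ => h0⟩
  · convert h1 using 1
    ext a
    simp only [Set.mem_preimage, Set.mem_ofPred_eq]
    by_cases h : ∃ c, IsStrictNearest (g a) (f a).carrier c
    · obtain ⟨c, hc⟩ := h
      rw [hc.nearest_eq]
      exact ⟨fun h => ⟨c, hc, h⟩, fun ⟨c', h1, h2⟩ => hc.unique h1 ▸ h2⟩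
    · rw [nearest, dif_neg h]
      exact ⟨fun h' => absurd h' h0, fun ⟨c, hc, _⟩ => absurd ⟨c, hc⟩ h⟩

end

/-! ### The dynamics on configurations -/

/-- The region of space-time explored by a server that moves from `p.1` to `y` at time `p.2`. -/
def explored (p : ℝ × ℝ) (y : ℝ) : Set (ℝ × ℝ) := {c | |c.1 - p.1| ≤ |y - p.1| ∧ c.2 ≤ p.2}

open Classical in
/-- Position and time at the end of the next cycle; the time is `-1` if there is no strictly
nearest customer. -/
def advance (v : ℝ≥0∞) (p : ℝ × ℝ) (s : Set (ℝ × ℝ)) (τ : ℝ) : ℝ × ℝ :=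
  if ∃ c, IsStrictNearest p s c then
    ((nearest p s).1, p.2 + travelTime v p.1 (nearest p s).1 + τ) else (0, -1)

/-- The successive positions, times and unexplored configurations. -/
def orbit (v : ℝ≥0∞) (p : ℝ × ℝ) (s : Conf) (T : ℕ → ℝ) : ℕ → (ℝ × ℝ) × Conf
  | 0 => (p, s)
  | n + 1 =>
    let q := orbit v p s T n
    let p' := advance v q.1 q.2.carrier (T n)
    (p', q.2.inter (explored q.1 p'.1)ᶜ)

/-- The sequence of services without its first term. -/
def shift (T : ℕ → ℝ) : ℕ → ℝ := fun n => T (n + 1)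

/-- The space-time region explored during the first `n` steps of the history `h`. -/
def exploredBy (n : ℕ) (h : ℕ → ℝ × ℝ) : Set (ℝ × ℝ) := ⋃ k < n, explored (h k) (h (k + 1)).1

/-- The path that agrees with `h` up to `n` and continues with the greedy dynamics. -/
def path (v : ℝ≥0∞) (n : ℕ) (h : ℕ → ℝ × ℝ) (s : Conf) (T : ℕ → ℝ) (k : ℕ) : ℝ × ℝ :=
  if k ≤ n then h k else (orbit v (h n) s T (k - n)).1

/-- The history `h` extended by one step. -/
def extend (v : ℝ≥0∞) (n : ℕ) (h : ℕ → ℝ × ℝ) (s : Set (ℝ × ℝ)) (τ : ℝ) : ℕ → ℝ × ℝ :=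
  Function.update h (n + 1) (advance v (h n) s τ)

lemma orbit_succ' (v : ℝ≥0∞) (p : ℝ × ℝ) (s : Conf) (T : ℕ → ℝ) (k : ℕ) :
    orbit v p s T (k + 1) = orbit v (advance v p s.carrier (T 0))
      (s.inter (explored p (advance v p s.carrier (T 0)).1)ᶜ) (shift T) k := by
  induction k with
  | zero => rfl
  | succ k ih =>
    rw [orbit, ih]
    rfl

/-- One step of the dynamics is absorbed into the history, and what remains is the same dynamics on
the unexplored customers with shifted services. The Markov property rests on this identity. -/
lemma path_succ (v : ℝ≥0∞) (n : ℕ) (h : ℕ → ℝ × ℝ) (s : Conf) (T : ℕ → ℝ) :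
    path v n h s T = path v (n + 1) (extend v n h s.carrier (T 0))
      (s.inter (explored (h n) (advance v (h n) s.carrier (T 0)).1)ᶜ) (shift T) := by
  funext k
  rcases lt_trichotomy k (n + 1) with hk | hk | hk
  · rw [path, path, if_pos (by omega), if_pos (by omega), extend, Function.update_of_ne (by omega)]
  · subst hk
    rw [path, path, if_neg (by omega), if_pos le_rfl, extend, Function.update_self]
    simp [orbit]
  · rw [path, path, if_neg (by omega), if_neg (by omega), extend, Function.update_self]
    obtain ⟨m, rfl⟩ : ∃ m, k = n + 1 + m := ⟨k - (n + 1), by omega⟩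
    rw [show n + 1 + m - n = m + 1 by omega, orbit_succ', show n + 1 + m - (n + 1) = m by omega]

lemma exploredBy_extend (v : ℝ≥0∞) (n : ℕ) (h : ℕ → ℝ × ℝ) (s : Set (ℝ × ℝ)) (τ : ℝ) :
    exploredBy (n + 1) (extend v n h s τ) =
      exploredBy n h ∪ explored (h n) (advance v (h n) s τ).1 := by
  ext c
  simp only [exploredBy, Set.mem_iUnion, Set.mem_union, exists_prop]
  constructor
  · rintro ⟨k, hk, hc⟩
    rcases Nat.lt_succ_iff_lt_or_eq.1 hk with hk' | rfl
    · refine Or.inl ⟨k, hk', ?_⟩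
      rwa [extend, Function.update_of_ne (by omega), Function.update_of_ne (by omega)] at hc
    · right
      rwa [extend, Function.update_of_ne (by omega), Function.update_self] at hc
  · rintro (⟨k, hk, hc⟩ | hc)
    · refine ⟨k, by omega, ?_⟩
      rwa [extend, Function.update_of_ne (by omega), Function.update_of_ne (by omega)]
    · refine ⟨n, by omega, ?_⟩
      rwa [extend, Function.update_of_ne (by omega), Function.update_self]

lemma exploredBy_congr {n : ℕ} {h h' : ℕ → ℝ × ℝ} (hh : ∀ k ≤ n, h k = h' k) :
    exploredBy n h = exploredBy n h' := by
  ext c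
  simp only [exploredBy, Set.mem_iUnion, exists_prop]
  refine exists_congr fun k => and_congr_right fun hk => ?_
  rw [hh k hk.le, hh (k + 1) hk]

lemma path_congr (v : ℝ≥0∞) {n : ℕ} {h h' : ℕ → ℝ × ℝ} (hh : ∀ k ≤ n, h k = h' k) (s : Conf)
    (T : ℕ → ℝ) : path v n h s T = path v n h' s T := by
  funext k
  rw [path, path, hh n le_rfl]
  split_ifs with hk
  · exact hh k hk
  · rfl

lemma travelTime_nonneg (v : ℝ≥0∞) (x y : ℝ) : 0 ≤ travelTime v x y := ENNReal.toReal_nonneg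

lemma measurable_shift : Measurable shift :=
  measurable_pi_lambda _ fun n => measurable_pi_apply (n + 1)

section
variable {P : Type*} [MeasurableSpace P]

lemma measurable_travelTime (v : ℝ≥0∞) {f g : P → ℝ} (hf : Measurable f) (hg : Measurable g) :
    Measurable fun a => travelTime v (f a) (g a) := by
  unfold travelTime
  have : Measurable fun a => |g a - f a| := by fun_prop
  exact (this.ennreal_ofReal.div_const v).ennreal_toReal

lemma measurable_advance (v : ℝ≥0∞) {p : P → ℝ × ℝ} {s : P → Conf} {τ : P → ℝ}
    (hp : Measurable p) (hs : Measurable s) (hτ : Measurable τ) :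
    Measurable fun a => advance v (p a) (s a).carrier (τ a) := by
  unfold advance
  have hn := measurable_nearest hs hp
  refine Measurable.ite (measurableSet_strictNearest hs hp) ?_ measurable_const
  exact (measurable_fst.comp hn).prodMk (((measurable_snd.comp hp).add
    (measurable_travelTime v (measurable_fst.comp hp) (measurable_fst.comp hn))).add hτ)

lemma measurableSet_explored {p : P → ℝ × ℝ} {y : P → ℝ} (hp : Measurable p) (hy : Measurable y) :
    MeasurableSet {a : P × (ℝ × ℝ) | a.2 ∈ explored (p a.1) (y a.1)} := by
  have h1 : Measurable fun x : P × (ℝ × ℝ) => p x.1 := hp.comp measurable_fst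
  have h2 : Measurable fun x : P × (ℝ × ℝ) => y x.1 := hy.comp measurable_fst
  have h3 : Measurable fun x : P × (ℝ × ℝ) => |x.2.1 - (p x.1).1| := by fun_prop
  have h4 : Measurable fun x : P × (ℝ × ℝ) => |y x.1 - (p x.1).1| := by fun_prop
  exact (measurableSet_le h3 h4).inter
    (measurableSet_le (measurable_snd.comp measurable_snd) (measurable_snd.comp h1))

lemma measurable_inter_explored_compl {p : P → ℝ × ℝ} {y : P → ℝ} {s : P → Conf}
    (hp : Measurable p) (hy : Measurable y) (hs : Measurable s) :
    Measurable fun a => (s a).inter (explored (p a) (y a))ᶜ :=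
  Conf.measurable_inter hs (measurableSet_explored hp hy).compl

lemma measurable_orbit (v : ℝ≥0∞) {p : P → ℝ × ℝ} {s : P → Conf} {T : P → ℕ → ℝ}
    (hp : Measurable p) (hs : Measurable s) (hT : Measurable T) (n : ℕ) :
    Measurable fun a => orbit v (p a) (s a) (T a) n := by
  induction n with
  | zero => exact hp.prodMk hs
  | succ n ih =>
    have h1 := measurable_advance v (measurable_fst.comp ih) (measurable_snd.comp ih)
      ((measurable_pi_apply n).comp hT)
    exact h1.prodMk (measurable_inter_explored_compl (measurable_fst.comp ih)
      (measurable_fst.comp h1) (measurable_snd.comp ih))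

lemma measurable_path (v : ℝ≥0∞) (n : ℕ) {h : P → ℕ → ℝ × ℝ} {s : P → Conf} {T : P → ℕ → ℝ}
    (hh : Measurable h) (hs : Measurable s) (hT : Measurable T) :
    Measurable fun a => path v n (h a) (s a) (T a) := by
  refine measurable_pi_lambda _ fun k => ?_
  unfold path
  by_cases hk : k ≤ n
  · simp only [hk, if_true]
    exact (measurable_pi_apply k).comp hh
  · simp only [hk, if_false]
    exact measurable_fst.comp (measurable_orbit v ((measurable_pi_apply n).comp hh) hs hT _)

lemma measurableSet_exploredBy (n : ℕ) {h : P → ℕ → ℝ × ℝ} (hh : Measurable h) :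
    MeasurableSet {a : P × (ℝ × ℝ) | a.2 ∈ exploredBy n (h a.1)} := by
  have : {a : P × (ℝ × ℝ) | a.2 ∈ exploredBy n (h a.1)} =
      ⋃ k < n, {a : P × (ℝ × ℝ) | a.2 ∈ explored (h a.1 k) (h a.1 (k + 1)).1} := by
    ext a; simp [exploredBy]
  rw [this]
  exact MeasurableSet.biUnion (Set.to_countable _) fun k _ => measurableSet_explored
    ((measurable_pi_apply k).comp hh) (measurable_fst.comp ((measurable_pi_apply (k + 1)).comp hh))

end

lemma measurableSet_exploredBy_const (n : ℕ) (h : ℕ → ℝ × ℝ) : MeasurableSet (exploredBy n h) :=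
  measurable_prodMk_left (x := ()) (measurableSet_exploredBy n (P := Unit) (h := fun _ => h)
    measurable_const)

lemma measurableSet_win_const (p : ℝ × ℝ) (r : ℝ) : MeasurableSet (win p r) :=
  measurable_prodMk_left (x := ()) (measurableSet_win (P := Unit) (f := fun _ => p)
    (r := fun _ => r) measurable_const measurable_const)

/-! ### One step of the dynamics in a random environment -/

/-- The properties of the customers `η` and the services `T` that make the dynamics Markovian. -/
structure IsFresh {Ω : Type*} [MeasurableSpace Ω] (μ : Measure Ω) (η : Ω → Conf)
    (T : Ω → ℕ → ℝ) : Prop where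
  measurable_conf : Measurable η
  measurable_service : Measurable T
  nonneg : ∀ ω n, 0 ≤ T ω n
  indep : ∀ B : Set (ℝ × ℝ), MeasurableSet B →
    IndepFun (fun ω => ((η ω).inter B, T ω 0)) (fun ω => ((η ω).inter Bᶜ, shift (T ω))) μ
  map_shift : ∀ B : Set (ℝ × ℝ), MeasurableSet B →
    μ.map (fun ω => ((η ω).inter B, shift (T ω))) = μ.map (fun ω => ((η ω).inter B, T ω))
  exists_nearest : ∀ (p : ℝ × ℝ) (R : Set (ℝ × ℝ)) (r : ℝ), 0 ≤ p.2 → (∀ c ∈ R, |c.1| ≤ r) →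
    ∀ᵐ ω ∂μ, ∃ c, IsStrictNearest p ((η ω).inter Rᶜ).carrier c

section
variable {Ω : Type*} [MeasurableSpace Ω] {μ : Measure Ω} [IsProbabilityMeasure μ]

lemma lintegral_prod_of_indepFun {α β : Type*} [MeasurableSpace α] [MeasurableSpace β]
    {X : Ω → α} {Y : Ω → β} (hX : Measurable X) (hY : Measurable Y) (h : IndepFun X Y μ)
    {F : α × β → ℝ≥0∞} (hF : Measurable F) :
    ∫⁻ ω, F (X ω, Y ω) ∂μ = ∫⁻ ω, ∫⁻ y, F (X ω, y) ∂(μ.map Y) ∂μ := by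
  have h1 := (indepFun_iff_map_prod_eq_prod_map_map hX.aemeasurable hY.aemeasurable).1 h
  have h2 : ∫⁻ ω, F (X ω, Y ω) ∂μ = ∫⁻ z, F z ∂(μ.map fun ω => (X ω, Y ω)) :=
    (lintegral_map hF (hX.prodMk hY)).symm
  have : IsProbabilityMeasure (μ.map Y) := Measure.isProbabilityMeasure_map hY.aemeasurable
  rw [h2, h1, lintegral_prod _ hF.aemeasurable, lintegral_map ?_ hX]
  exact hF.lintegral_prod_right'

/-- The dyadic approximation of `d` from above. -/
def dyadicAbove (j : ℕ) (d : ℝ) : ℝ := (⌊2 ^ j * d⌋₊ + 1) / 2 ^ j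

lemma lt_dyadicAbove (j : ℕ) (d : ℝ) : d < dyadicAbove j d := by
  rw [dyadicAbove, lt_div_iff₀ (by positivity), mul_comm]
  exact Nat.lt_floor_add_one _

lemma dyadicAbove_le (j : ℕ) {d : ℝ} (hd : 0 ≤ d) : dyadicAbove j d ≤ d + 1 / 2 ^ j := by
  rw [dyadicAbove, add_div]
  gcongr
  rw [div_le_iff₀ (by positivity), mul_comm]
  exact Nat.floor_le (by positivity)

/-- By local finiteness there is a gap beyond the explored radius, and the dyadic radii, which
exceed it strictly, eventually fall into the gap. -/
lemma eventually_inter_win_eq (s : Conf) (p : ℝ × ℝ) (y : ℝ) :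
    ∀ᶠ j in atTop, s.inter (win p (dyadicAbove j |y - p.1|))ᶜ = s.inter (explored p y)ᶜ := by
  have hfin := s.finite_win p (|y - p.1| + 2)
  obtain ⟨d, hd, hdmin⟩ : ∃ d > |y - p.1|, ∀ c ∈ s.carrier, c.2 ≤ p.2 → |y - p.1| < |c.1 - p.1| →
      d ≤ |c.1 - p.1| := by
    by_cases hne : ((s.carrier ∩ win p (|y - p.1| + 2)) ∩ {c | |y - p.1| < |c.1 - p.1|}).Nonempty
    · obtain ⟨m, hm, hmin⟩ := Set.exists_min_image _ (fun c' : ℝ × ℝ => |c'.1 - p.1|)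
        (hfin.inter_of_left {c | |y - p.1| < |c.1 - p.1|}) hne
      refine ⟨|m.1 - p.1|, hm.2, fun c' h1 h2 h3 => ?_⟩
      by_cases h4 : |c'.1 - p.1| < |y - p.1| + 2
      · exact hmin c' ⟨⟨h1, h4, h2⟩, h3⟩
      · exact hm.1.2.1.le.trans (not_lt.1 h4)
    · refine ⟨|y - p.1| + 2, by simp, fun c' h1 h2 h3 => ?_⟩
      by_contra! h4
      exact hne ⟨c', ⟨h1, h4, h2⟩, h3⟩
  have hlim : Tendsto (fun j : ℕ => |y - p.1| + (1 / 2 : ℝ) ^ j) atTop (𝓝 (|y - p.1| + 0)) :=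
    tendsto_const_nhds.add (tendsto_pow_atTop_nhds_zero_of_lt_one (by norm_num) (by norm_num))
  rw [add_zero] at hlim
  filter_upwards [hlim.eventually (gt_mem_nhds hd)] with j hj
  have hj' : dyadicAbove j |y - p.1| < d := by
    refine (dyadicAbove_le j (abs_nonneg _)).trans_lt ?_
    simpa using hj
  ext c
  simp only [Conf.inter, Set.mem_inter_iff, Set.mem_compl_iff, win, explored, Set.mem_ofPred_eq]
  refine and_congr_right fun hc => not_congr ?_
  constructor
  · rintro ⟨h1, h2⟩
    refine ⟨?_, h2⟩
    by_contra! h3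
    exact absurd (hdmin c hc h2 h3) (not_le.2 (h1.trans hj'))
  · rintro ⟨h1, h2⟩
    exact ⟨h1.trans_lt (lt_dyadicAbove j _), h2⟩

variable {η : Ω → Conf} {T : Ω → ℕ → ℝ}

lemma measurable_dyadicAbove (j : ℕ) : Measurable (dyadicAbove j) := by
  unfold dyadicAbove
  have h : Measurable fun d : ℝ => 2 ^ j * d := by fun_prop
  have h1 : Measurable fun d : ℝ => ((⌊2 ^ j * d⌋₊ : ℕ) : ℝ) :=
    (measurable_from_nat (f := fun n : ℕ => (n : ℝ))).comp (Nat.measurable_floor.comp h)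
  fun_prop

/-- After discretization of the explored radius, the unexplored environment can be replaced by an
independent copy. -/
lemma lintegral_step_dyadic (hη : IsFresh μ η T) (p : ℝ × ℝ) {R : Set (ℝ × ℝ)}
    (hR : MeasurableSet R) {F : ((ℝ × ℝ) × ℝ) × (Conf × (ℕ → ℝ)) → ℝ≥0∞} (hF : Measurable F)
    (hex : ∀ᵐ ω ∂μ, ∃ c, IsStrictNearest p ((η ω).inter Rᶜ).carrier c) (j : ℕ) :
    ∫⁻ ω, F ((nearest p ((η ω).inter Rᶜ).carrier, T ω 0), (((η ω).inter Rᶜ).inter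
        (win p (dyadicAbove j |(nearest p ((η ω).inter Rᶜ).carrier).1 - p.1|))ᶜ, shift (T ω))) ∂μ
    = ∫⁻ ω, ∫⁻ ω', F ((nearest p ((η ω).inter Rᶜ).carrier, T ω 0), (((η ω').inter Rᶜ).inter
        (win p (dyadicAbove j |(nearest p ((η ω).inter Rᶜ).carrier).1 - p.1|))ᶜ, T ω')) ∂μ ∂μ := by
  have hηm := hη.measurable_conf
  have hTm := hη.measurable_service
  have hηR : Measurable fun ω => (η ω).inter Rᶜ :=
    (Conf.measurable_inter_const _ hR.compl).comp hηm
  set c : Ω → ℝ × ℝ := fun ω => nearest p ((η ω).inter Rᶜ).carrier with hc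
  have hcm : Measurable c := measurable_nearest hηR measurable_const
  set idx : Ω → ℕ := fun ω => ⌊2 ^ j * |(c ω).1 - p.1|⌋₊ with hidx
  have hidxm : Measurable idx := by
    refine Nat.measurable_floor.comp ?_
    have : Measurable fun ω => (c ω).1 := measurable_fst.comp hcm
    fun_prop
  -- the event that the nearest customer exists and lies in the `i`-th shell
  set W : ℕ → Set (ℝ × ℝ) := fun i => win p ((i + 1) / 2 ^ j) with hW
  have hWm : ∀ i, MeasurableSet (W i) := fun i => measurableSet_win_const _ _
  set E : ℕ → Set Ω := fun i =>
    {ω | (∃ c, IsStrictNearest p ((η ω).inter Rᶜ).carrier c) ∧ idx ω = i} with hE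
  have hEm : ∀ i, MeasurableSet (E i) := fun i =>
    (measurableSet_strictNearest hηR measurable_const).inter (hidxm (measurableSet_singleton i))
  have hEd : Pairwise (Function.onFun Disjoint E) := by
    intro i i' hii'
    refine Set.disjoint_left.2 fun ω h1 h2 => hii' ?_
    exact h1.2.symm.trans h2.2
  have hEu : ∀ᵐ ω ∂μ, ω ∈ ⋃ i, E i := by
    filter_upwards [hex] with ω hω
    exact Set.mem_iUnion.2 ⟨idx ω, hω, rfl⟩
  have hdy : ∀ ω i, ω ∈ E i → dyadicAbove j |(c ω).1 - p.1| = (i + 1) / 2 ^ j := by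
    intro ω i hω
    have : idx ω = i := hω.2
    rw [dyadicAbove, ← this]
  -- the event and the nearest customer are functions of the environment inside `W i`
  set E' : ℕ → Set (Conf × ℝ) := fun i => {a | (∃ c, IsStrictNearest p (a.1.inter Rᶜ).carrier c) ∧
    ⌊2 ^ j * |(nearest p (a.1.inter Rᶜ).carrier).1 - p.1|⌋₊ = i} with hE'
  have hmR : Measurable fun a : Conf × ℝ => a.1.inter Rᶜ :=
    (Conf.measurable_inter_const _ hR.compl).comp measurable_fst
  have hmn : Measurable fun a : Conf × ℝ => nearest p (a.1.inter Rᶜ).carrier :=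
    measurable_nearest hmR measurable_const
  have hE'm : ∀ i, MeasurableSet (E' i) := fun i => by
    refine (measurableSet_strictNearest hmR measurable_const).inter ?_
    have h1 : Measurable fun a : Conf × ℝ => 2 ^ j * |(nearest p (a.1.inter Rᶜ).carrier).1 - p.1| := by
      have : Measurable fun a : Conf × ℝ => (nearest p (a.1.inter Rᶜ).carrier).1 :=
        measurable_fst.comp hmn
      fun_prop
    exact (Nat.measurable_floor.comp h1) (measurableSet_singleton i)
  have key : ∀ ω i, (ω ∈ E i ↔ ((η ω).inter (W i), T ω 0) ∈ E' i) ∧ (ω ∈ E i →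
      c ω = nearest p (((η ω).inter (W i)).inter Rᶜ).carrier) := by
    intro ω i
    have hlt : ∀ x : ℝ × ℝ, ⌊2 ^ j * |x.1 - p.1|⌋₊ = i → |x.1 - p.1| < (i + 1) / 2 ^ j := by
      intro x hx
      rw [lt_div_iff₀ (by positivity), mul_comm, ← hx]
      exact Nat.lt_floor_add_one _
    have hfwd : ∀ x, IsStrictNearest p ((η ω).inter Rᶜ).carrier x → x ∈ W i →
        IsStrictNearest p (((η ω).inter (W i)).inter Rᶜ).carrier x := by
      intro x hx hxW
      refine ⟨⟨⟨⟨hx.1.1.1, hxW⟩, hx.1.1.2⟩, hx.1.2⟩, fun c' h1 h2 h3 => ?_⟩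
      exact hx.2 c' ⟨h1.1.1, h1.2⟩ h2 h3
    have hbwd : ∀ x, IsStrictNearest p (((η ω).inter (W i)).inter Rᶜ).carrier x →
        IsStrictNearest p ((η ω).inter Rᶜ).carrier x := by
      intro x hx
      refine ⟨⟨⟨hx.1.1.1.1, hx.1.1.2⟩, hx.1.2⟩, fun c' h1 h2 h3 => ?_⟩
      by_cases h4 : c' ∈ W i
      · exact hx.2 c' ⟨⟨h1.1, h4⟩, h1.2⟩ h2 h3
      -- An arrived customer outside `W i` is at least as far away as the radius of `W i`, hence
      -- farther than a candidate inside.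
      · have h5 : ¬ |c'.1 - p.1| < (i + 1) / 2 ^ j := fun h => h4 ⟨h, h2⟩
        exact hx.1.1.1.2.1.trans_le (not_lt.1 h5)
    have hin : ω ∈ E i → ∃ x, IsStrictNearest p ((η ω).inter Rᶜ).carrier x ∧ x ∈ W i ∧
        c ω = x := by
      rintro ⟨⟨x, hx⟩, hi⟩
      have hcx : c ω = x := hx.nearest_eq
      refine ⟨x, hx, ⟨hlt x ?_, hx.1.2⟩, hcx⟩
      rw [← hcx]; exact hi
    refine ⟨⟨fun h => ?_, fun h => ?_⟩, fun h => ?_⟩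
    · obtain ⟨x, hx, hxW, hcx⟩ := hin h
      refine ⟨⟨x, hfwd x hx hxW⟩, ?_⟩
      have h2 : idx ω = i := h.2
      simp only [hidx, hcx] at h2
      simp only [(hfwd x hx hxW).nearest_eq, h2]
    · obtain ⟨⟨x, hx⟩, hi⟩ := h
      simp only [hx.nearest_eq] at hi
      refine ⟨⟨x, hbwd x hx⟩, ?_⟩
      simp only [hidx, hc, (hbwd x hx).nearest_eq, hi]
    · obtain ⟨x, hx, hxW, hcx⟩ := hin h
      rw [hcx, (hfwd x hx hxW).nearest_eq]
  -- On the `i`-th shell the explored window is the deterministic set `W i`, and the integrand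
  -- splits into what happens inside (with the first service) and outside (with the later ones).
  set G : ℕ → (Conf × ℝ) × (Conf × (ℕ → ℝ)) → ℝ≥0∞ := fun i a => (E' i).indicator
    (fun b => F ((nearest p (b.1.inter Rᶜ).carrier, b.2), (a.2.1.inter Rᶜ, a.2.2))) a.1 with hG
  have hGm : ∀ i, Measurable (G i) := by
    intro i
    have h1 : Measurable fun a : (Conf × ℝ) × (Conf × (ℕ → ℝ)) =>
        F ((nearest p (a.1.1.inter Rᶜ).carrier, a.1.2), (a.2.1.inter Rᶜ, a.2.2)) := by
      refine hF.comp (Measurable.prodMk (Measurable.prodMk (hmn.comp measurable_fst)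
        (measurable_snd.comp measurable_fst)) (Measurable.prodMk ?_
        (measurable_snd.comp measurable_snd)))
      exact (Conf.measurable_inter_const _ hR.compl).comp (measurable_fst.comp measurable_snd)
    have h2 := h1.indicator (measurable_fst (hE'm i))
    convert h2 using 1
    funext a
    by_cases ha : a.1 ∈ E' i
    · rw [Set.indicator_of_mem (show a ∈ Prod.fst ⁻¹' E' i from ha)]
      exact Set.indicator_of_mem ha _
    · rw [Set.indicator_of_notMem (show a ∉ Prod.fst ⁻¹' E' i from ha)]
      exact Set.indicator_of_notMem ha _
  have hswap : ∀ (s : Conf) (i : ℕ), (s.inter Rᶜ).inter (W i)ᶜ = (s.inter (W i)ᶜ).inter Rᶜ := by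
    intro s i
    rw [Conf.inter_inter, Conf.inter_inter, Set.inter_comm]
  have hUm : ∀ i, Measurable fun ω => ((η ω).inter (W i), T ω 0) := fun i =>
    ((Conf.measurable_inter_const _ (hWm i)).comp hηm).prodMk ((measurable_pi_apply 0).comp hTm)
  have hVm : ∀ i, Measurable fun ω => ((η ω).inter (W i)ᶜ, T ω) := fun i =>
    ((Conf.measurable_inter_const _ (hWm i).compl).comp hηm).prodMk hTm
  have hV'm : ∀ i, Measurable fun ω => ((η ω).inter (W i)ᶜ, shift (T ω)) := fun i =>
    ((Conf.measurable_inter_const _ (hWm i).compl).comp hηm).prodMk (measurable_shift.comp hTm)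
  have hsplit : ∀ f : Ω → ℝ≥0∞, ∫⁻ ω, f ω ∂μ = ∑' i, ∫⁻ ω in E i, f ω ∂μ := by
    intro f
    rw [← lintegral_iUnion hEm hEd, Measure.restrict_eq_self_of_ae_mem hEu]
  rw [hsplit, hsplit]
  congr 1
  funext i
  have hL : ∫⁻ ω in E i, F ((c ω, T ω 0), (((η ω).inter Rᶜ).inter
      (win p (dyadicAbove j |(c ω).1 - p.1|))ᶜ, shift (T ω))) ∂μ =
      ∫⁻ ω, G i (((η ω).inter (W i), T ω 0), ((η ω).inter (W i)ᶜ, shift (T ω))) ∂μ := by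
    rw [← lintegral_indicator (hEm i)]
    congr 1
    funext ω
    by_cases hω : ω ∈ E i
    · rw [Set.indicator_of_mem hω, hdy ω i hω, hG]
      simp only
      rw [Set.indicator_of_mem ((key ω i).1.1 hω), ← (key ω i).2 hω, ← hswap]
    · rw [Set.indicator_of_notMem hω, hG]
      simp only
      rw [Set.indicator_of_notMem fun h => hω ((key ω i).1.2 h)]
  have hRt : ∫⁻ ω in E i, ∫⁻ ω', F ((c ω, T ω 0), (((η ω').inter Rᶜ).inter
      (win p (dyadicAbove j |(c ω).1 - p.1|))ᶜ, T ω')) ∂μ ∂μ =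
      ∫⁻ ω, ∫⁻ ω', G i (((η ω).inter (W i), T ω 0), ((η ω').inter (W i)ᶜ, T ω')) ∂μ ∂μ := by
    rw [← lintegral_indicator (hEm i)]
    congr 1
    funext ω
    by_cases hω : ω ∈ E i
    · rw [Set.indicator_of_mem hω, hdy ω i hω, hG]
      simp only
      congr 1
      funext ω'
      rw [Set.indicator_of_mem ((key ω i).1.1 hω), ← (key ω i).2 hω, ← hswap]
    · rw [Set.indicator_of_notMem hω, hG]
      simp only [Set.indicator_of_notMem fun h => hω ((key ω i).1.2 h), lintegral_zero]
  -- Inside and outside of the deterministic `W i` are independent, and outside the shifted services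
  -- have the law of the original ones.
  rw [hL, hRt, lintegral_prod_of_indepFun (hUm i) (hV'm i) (hη.indep (W i) (hWm i)) (hGm i),
    hη.map_shift _ (hWm i).compl]
  congr 1
  funext ω
  exact lintegral_map (f := fun y => G i (((η ω).inter (W i), T ω 0), y))
    ((hGm i).comp measurable_prodMk_left) (hVm i)

/-- One step of the dynamics: the unexplored environment can be replaced by an independent copy. -/
lemma lintegral_step (hη : IsFresh μ η T) (p : ℝ × ℝ) {R : Set (ℝ × ℝ)}
    (hR : MeasurableSet R) {F : ((ℝ × ℝ) × ℝ) × (Conf × (ℕ → ℝ)) → ℝ≥0∞} (hF : Measurable F)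
    (hF1 : ∀ a, F a ≤ 1)
    (hex : ∀ᵐ ω ∂μ, ∃ c, IsStrictNearest p ((η ω).inter Rᶜ).carrier c) :
    ∫⁻ ω, F ((nearest p ((η ω).inter Rᶜ).carrier, T ω 0), (((η ω).inter Rᶜ).inter
        (explored p (nearest p ((η ω).inter Rᶜ).carrier).1)ᶜ, shift (T ω))) ∂μ
    = ∫⁻ ω, ∫⁻ ω', F ((nearest p ((η ω).inter Rᶜ).carrier, T ω 0), (((η ω').inter Rᶜ).inter
        (explored p (nearest p ((η ω).inter Rᶜ).carrier).1)ᶜ, T ω')) ∂μ ∂μ := by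
  have hηm := hη.measurable_conf
  have hTm := hη.measurable_service
  have hηR : Measurable fun ω => (η ω).inter Rᶜ :=
    (Conf.measurable_inter_const _ hR.compl).comp hηm
  set c : Ω → ℝ × ℝ := fun ω => nearest p ((η ω).inter Rᶜ).carrier with hc
  have hcm : Measurable c := measurable_nearest hηR measurable_const
  have hT0 : Measurable fun ω => T ω 0 := (measurable_pi_apply 0).comp hTm
  have hr : ∀ j, Measurable fun ω => dyadicAbove j |(c ω).1 - p.1| := fun j => by
    refine (measurable_dyadicAbove j).comp ?_
    have : Measurable fun ω => (c ω).1 := measurable_fst.comp hcm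
    fun_prop
  have hm1 : ∀ j, Measurable fun ω => F ((c ω, T ω 0), (((η ω).inter Rᶜ).inter
      (win p (dyadicAbove j |(c ω).1 - p.1|))ᶜ, shift (T ω))) := fun j =>
    hF.comp ((hcm.prodMk hT0).prodMk ((Conf.measurable_inter hηR
      (measurableSet_win measurable_const (hr j)).compl).prodMk (measurable_shift.comp hTm)))
  have hm2 : ∀ j, Measurable fun a : Ω × Ω => F ((c a.1, T a.1 0), (((η a.2).inter Rᶜ).inter
      (win p (dyadicAbove j |(c a.1).1 - p.1|))ᶜ, T a.2)) := fun j =>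
    hF.comp (((hcm.comp measurable_fst).prodMk (hT0.comp measurable_fst)).prodMk
      ((Conf.measurable_inter (hηR.comp measurable_snd) (measurableSet_win measurable_const
        ((hr j).comp measurable_fst)).compl).prodMk (hTm.comp measurable_snd)))
  have hm3 : Measurable fun a : Ω × Ω => F ((c a.1, T a.1 0), (((η a.2).inter Rᶜ).inter
      (explored p (c a.1).1)ᶜ, T a.2)) :=
    hF.comp (((hcm.comp measurable_fst).prodMk (hT0.comp measurable_fst)).prodMk
      ((measurable_inter_explored_compl measurable_const (measurable_fst.comp
        (hcm.comp measurable_fst)) (hηR.comp measurable_snd)).prodMk (hTm.comp measurable_snd)))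
  -- For each outcome the discretized integrand equals the true one for all large `j`, on both sides
  -- of the identity.
  have hl1 := tendsto_lintegral_of_dominated_convergence (μ := μ) (fun _ => 1)
    (F := fun j ω => F ((c ω, T ω 0), (((η ω).inter Rᶜ).inter
      (win p (dyadicAbove j |(c ω).1 - p.1|))ᶜ, shift (T ω))))
    (f := fun ω => F ((c ω, T ω 0), (((η ω).inter Rᶜ).inter
        (explored p (c ω).1)ᶜ, shift (T ω)))) hm1 (fun j => ae_of_all _ fun ω => hF1 _)
    (by simp) (ae_of_all _ fun ω => by
      refine tendsto_const_nhds.congr' ?_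
      filter_upwards [eventually_inter_win_eq ((η ω).inter Rᶜ) p (c ω).1] with j hj
      rw [hj])
  have hl2 := tendsto_lintegral_of_dominated_convergence (μ := μ.prod μ) (fun _ => 1)
    (F := fun j a => F ((c a.1, T a.1 0), (((η a.2).inter Rᶜ).inter
      (win p (dyadicAbove j |(c a.1).1 - p.1|))ᶜ, T a.2)))
    (f := fun a => F ((c a.1, T a.1 0), (((η a.2).inter Rᶜ).inter
        (explored p (c a.1).1)ᶜ, T a.2))) hm2 (fun j => ae_of_all _ fun ω => hF1 _)
    (by simp) (ae_of_all _ fun a => by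
      refine tendsto_const_nhds.congr' ?_
      filter_upwards [eventually_inter_win_eq ((η a.2).inter Rᶜ) p (c a.1).1] with j hj
      rw [hj])
  rw [lintegral_prod _ hm3.aemeasurable] at hl2
  refine tendsto_nhds_unique hl1 (hl2.congr fun j => ?_)
  exact (lintegral_prod _ (hm2 j).aemeasurable).trans (lintegral_step_dyadic hη p hR hF hex j).symm

end

/-! ### The law of the path of the server -/

/-- The times of the history `h` are nonnegative and nondecreasing up to step `n`. -/
def IsAdmissible (n : ℕ) (h : ℕ → ℝ × ℝ) : Prop :=
  0 ≤ (h 0).2 ∧ ∀ k < n, (h k).2 ≤ (h (k + 1)).2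

lemma IsAdmissible.time_mono {n : ℕ} {h : ℕ → ℝ × ℝ} (hh : IsAdmissible n h) {i j : ℕ}
    (hij : i ≤ j) (hj : j ≤ n) : (h i).2 ≤ (h j).2 := by
  induction j, hij using Nat.le_induction with
  | base => exact le_rfl
  | succ j hij ih => exact (ih (by omega)).trans (hh.2 j (by omega))

lemma IsAdmissible.time_nonneg {n : ℕ} {h : ℕ → ℝ × ℝ} (hh : IsAdmissible n h) {j : ℕ}
    (hj : j ≤ n) : 0 ≤ (h j).2 := hh.1.trans (hh.time_mono (Nat.zero_le j) hj)

lemma exploredBy_bounded (n : ℕ) (h : ℕ → ℝ × ℝ) : ∃ r, ∀ c ∈ exploredBy n h, |c.1| ≤ r := by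
  induction n with
  | zero => exact ⟨0, fun c hc => by simp [exploredBy] at hc⟩
  | succ n ih =>
    obtain ⟨r, hr⟩ := ih
    refine ⟨max r (|(h n).1| + |(h (n + 1)).1 - (h n).1|), fun c hc => ?_⟩
    simp only [exploredBy, Set.mem_iUnion, exists_prop] at hc hr
    obtain ⟨k, hk, hc⟩ := hc
    rcases Nat.lt_succ_iff_lt_or_eq.1 hk with hk' | rfl
    · exact (hr c ⟨k, hk', hc⟩).trans (le_max_left _ _)
    · refine le_trans ?_ (le_max_right _ _)
      have := abs_sub_abs_le_abs_sub c.1 (h k).1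
      linarith [hc.1]

section
variable {Ω : Type*} [MeasurableSpace Ω] (μ : Measure Ω) (η : Ω → Conf) (T : Ω → ℕ → ℝ)
  (v : ℝ≥0∞)

/-- The law of the path of the server after the history `h` up to step `n`. -/
def pathLaw (n : ℕ) (h : ℕ → ℝ × ℝ) : Measure (ℕ → ℝ × ℝ) :=
  μ.map fun ω => path v n h ((η ω).inter (exploredBy n h)ᶜ) (T ω)

variable {μ η T}

lemma IsFresh.measurable_path_aux (hη : IsFresh μ η T) (n : ℕ) :
    Measurable fun a : (ℕ → ℝ × ℝ) × Ω =>
      path v n a.1 ((η a.2).inter (exploredBy n a.1)ᶜ) (T a.2) :=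
  measurable_path v n measurable_fst (Conf.measurable_inter
    (hη.measurable_conf.comp measurable_snd) (measurableSet_exploredBy n measurable_fst).compl)
    (hη.measurable_service.comp measurable_snd)

lemma IsFresh.measurable_path_const (hη : IsFresh μ η T) (n : ℕ) (h : ℕ → ℝ × ℝ) :
    Measurable fun ω => path v n h ((η ω).inter (exploredBy n h)ᶜ) (T ω) :=
  (hη.measurable_path_aux v n).comp measurable_prodMk_left

lemma pathLaw_apply (hη : IsFresh μ η T) (n : ℕ) (h : ℕ → ℝ × ℝ) {A : Set (ℕ → ℝ × ℝ)}
    (hA : MeasurableSet A) : pathLaw μ η T v n h A =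
      μ {ω | path v n h ((η ω).inter (exploredBy n h)ᶜ) (T ω) ∈ A} :=
  Measure.map_apply (hη.measurable_path_const v n h) hA

lemma pathLaw_congr {n : ℕ} {h h' : ℕ → ℝ × ℝ} (hh : ∀ k ≤ n, h k = h' k) :
    pathLaw μ η T v n h = pathLaw μ η T v n h' := by
  unfold pathLaw
  rw [exploredBy_congr hh]
  congr 1
  funext ω
  exact path_congr v hh _ _

lemma IsFresh.ae_nearest (hη : IsFresh μ η T) {n : ℕ} {h : ℕ → ℝ × ℝ} (hh : 0 ≤ (h n).2) :
    ∀ᵐ ω ∂μ, ∃ c, IsStrictNearest (h n) ((η ω).inter (exploredBy n h)ᶜ).carrier c := by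
  obtain ⟨r, hr⟩ := exploredBy_bounded n h
  exact hη.exists_nearest (h n) _ r hh hr

lemma measurableSet_isAdmissible (n : ℕ) : MeasurableSet {h | IsAdmissible n h} := by
  have h2 : ∀ k, Measurable fun h : ℕ → ℝ × ℝ => (h k).2 := fun k =>
    measurable_snd.comp (measurable_pi_apply k)
  have : {h | IsAdmissible n h} = {h : ℕ → ℝ × ℝ | 0 ≤ (h 0).2} ∩
      ⋂ k < n, {h : ℕ → ℝ × ℝ | (h k).2 ≤ (h (k + 1)).2} := by
    ext h; simp [IsAdmissible]
  rw [this]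
  exact (measurableSet_le measurable_const (h2 0)).inter (MeasurableSet.biInter
    (Set.to_countable _) fun k _ => measurableSet_le (h2 k) (h2 (k + 1)))

lemma IsAdmissible.extend (hη : IsFresh μ η T) {n : ℕ} {h : ℕ → ℝ × ℝ} (hh : IsAdmissible n h)
    {ω : Ω} {s : Set (ℝ × ℝ)} (hs : ∃ c, IsStrictNearest (h n) s c) :
    IsAdmissible (n + 1) (extend v n h s (T ω 0)) := by
  refine ⟨?_, fun k hk => ?_⟩
  · rw [GreedyServer.extend, Function.update_of_ne (by omega)]
    exact hh.1
  · rcases Nat.lt_succ_iff_lt_or_eq.1 hk with hk' | rfl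
    · rw [GreedyServer.extend, Function.update_of_ne (by omega), Function.update_of_ne (by omega)]
      exact hh.2 k hk'
    · rw [GreedyServer.extend, Function.update_of_ne (by omega), Function.update_self, advance,
        if_pos hs]
      have h1 := travelTime_nonneg v (h k).1 (nearest (h k) s).1
      have h2 := hη.nonneg ω 0
      simp only
      linarith

lemma path_of_le {n : ℕ} (h : ℕ → ℝ × ℝ) (s : Conf) (t : ℕ → ℝ) {k : ℕ} (hk : k ≤ n) :
    path v n h s t k = h k := by
  rw [path, if_pos hk]

lemma path_eq_extend {n : ℕ} (h : ℕ → ℝ × ℝ) (s : Conf) (t : ℕ → ℝ) {k : ℕ} (hk : k ≤ n + 1) :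
    path v n h s t k = extend v n h s.carrier (t 0) k := by
  rw [path_succ, path_of_le v _ _ _ hk]

variable [IsProbabilityMeasure μ]

lemma measurable_pathLaw (hη : IsFresh μ η T) (n : ℕ) :
    Measurable fun h => pathLaw μ η T v n h := by
  refine Measure.measurable_of_measurable_coe _ fun A hA => ?_
  simp_rw [fun h => pathLaw_apply v hη n h hA]
  exact measurable_measure_prodMk_left (ν := μ) (hη.measurable_path_aux v n hA)

/-- The Markov property for one step. -/
lemma pathLaw_step (hη : IsFresh μ η T) {n : ℕ} {h : ℕ → ℝ × ℝ} (hh : 0 ≤ (h n).2)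
    {A : Set (ℕ → ℝ × ℝ)} (hA : MeasurableSet A) :
    pathLaw μ η T v n h A = ∫⁻ ω, pathLaw μ η T v (n + 1)
      (extend v n h ((η ω).inter (exploredBy n h)ᶜ).carrier (T ω 0)) A ∂μ := by
  have hex := hη.ae_nearest (T := T) hh
  set R := exploredBy n h with hRdef
  have hR : MeasurableSet R := measurableSet_exploredBy_const n h
  set E : (ℝ × ℝ) × ℝ → ℕ → ℝ × ℝ := fun a => Function.update h (n + 1)
    (a.1.1, (h n).2 + travelTime v (h n).1 a.1.1 + a.2) with hE
  have hEm : Measurable E := by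
    refine measurable_pi_lambda _ fun k => ?_
    by_cases hk : k = n + 1
    · subst hk
      simp only [hE, Function.update_self]
      have h1 : Measurable fun a : (ℝ × ℝ) × ℝ => a.1.1 := measurable_fst.comp measurable_fst
      exact h1.prodMk ((measurable_const.add (measurable_travelTime v measurable_const h1)).add
        measurable_snd)
    · simp only [hE, Function.update_of_ne hk]
      exact measurable_const
  set F : ((ℝ × ℝ) × ℝ) × (Conf × (ℕ → ℝ)) → ℝ≥0∞ := fun a =>
    A.indicator 1 (path v (n + 1) (E a.1) a.2.1 a.2.2) with hF
  have hFm : Measurable F := (measurable_one.indicator hA).comp (measurable_path v (n + 1)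
    (hEm.comp measurable_fst) (measurable_fst.comp measurable_snd)
    (measurable_snd.comp measurable_snd))
  have hF1 : ∀ a, F a ≤ 1 := fun a => Set.indicator_le_self' (fun _ _ => zero_le) _
  have hstep := lintegral_step hη (h n) hR hFm hF1 hex
  have hext : ∀ ω, (∃ c, IsStrictNearest (h n) ((η ω).inter Rᶜ).carrier c) →
      advance v (h n) ((η ω).inter Rᶜ).carrier (T ω 0) =
        ((nearest (h n) ((η ω).inter Rᶜ).carrier).1, (h n).2 + travelTime v (h n).1
          (nearest (h n) ((η ω).inter Rᶜ).carrier).1 + T ω 0) := fun ω hω => by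
    rw [advance, if_pos hω]
  have hL : pathLaw μ η T v n h A = ∫⁻ ω, F ((nearest (h n) ((η ω).inter Rᶜ).carrier, T ω 0),
      (((η ω).inter Rᶜ).inter (explored (h n) (nearest (h n) ((η ω).inter Rᶜ).carrier).1)ᶜ,
        shift (T ω))) ∂μ := by
    rw [pathLaw, ← lintegral_indicator_one hA,
      lintegral_map (measurable_one.indicator hA) (hη.measurable_path_const v n h)]
    refine lintegral_congr_ae ?_
    filter_upwards [hex] with ω hω
    rw [path_succ, hext ω hω, extend, hext ω hω]
  have hRt : ∀ᵐ ω ∂μ, pathLaw μ η T v (n + 1)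
      (extend v n h ((η ω).inter R ᶜ).carrier (T ω 0)) A =
      ∫⁻ ω', F ((nearest (h n) ((η ω).inter Rᶜ).carrier, T ω 0), (((η ω').inter Rᶜ).inter
        (explored (h n) (nearest (h n) ((η ω).inter Rᶜ).carrier).1)ᶜ, T ω')) ∂μ := by
    filter_upwards [hex] with ω hω
    rw [pathLaw, ← lintegral_indicator_one hA,
      lintegral_map (measurable_one.indicator hA) (hη.measurable_path_const v _ _)]
    congr 1
    funext ω'
    rw [exploredBy_extend, hext ω hω, ← hRdef, Set.compl_union, ← Conf.inter_inter, extend,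
      hext ω hω]
  rw [hL, hstep, lintegral_congr_ae hRt]

/-- The Markov property. -/
lemma pathLaw_bind (hη : IsFresh μ η T) {n : ℕ} {h : ℕ → ℝ × ℝ} (hh : IsAdmissible n h) {m : ℕ}
    (hnm : n ≤ m) :
    (∀ᵐ p ∂(pathLaw μ η T v n h), IsAdmissible m p) ∧
      (pathLaw μ η T v n h).bind (fun p => pathLaw μ η T v m p) = pathLaw μ η T v n h := by
  induction m, hnm using Nat.le_induction with
  | base =>
    have h0 : ∀ᵐ p ∂(pathLaw μ η T v n h), ∀ k ≤ n, p k = h k := by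
      refine ae_all_iff.2 fun k => ?_
      by_cases hk : k ≤ n
      · simp only [hk, forall_const]
        refine (ae_map_iff (p := fun p : ℕ → ℝ × ℝ => p k = h k)
          (hη.measurable_path_const v n h).aemeasurable
          (measurableSet_eq_fun (measurable_pi_apply k) measurable_const)).2 ?_
        exact ae_of_all _ fun ω => path_of_le v _ _ _ hk
      · exact ae_of_all _ fun p hk' => absurd hk' hk
    refine ⟨?_, ?_⟩
    · filter_upwards [h0] with p hp
      refine ⟨hp 0 (Nat.zero_le _) ▸ hh.1, fun k hk => ?_⟩
      rw [hp k hk.le, hp (k + 1) hk]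
      exact hh.2 k hk
    ext A hA
    rw [Measure.bind_apply hA (measurable_pathLaw v hη n).aemeasurable]
    have : ∀ᵐ p ∂(pathLaw μ η T v n h), pathLaw μ η T v n p A = pathLaw μ η T v n h A := by
      filter_upwards [h0] with p hp
      rw [pathLaw_congr v hp]
    rw [lintegral_congr_ae this, lintegral_const]
    have : IsProbabilityMeasure (pathLaw μ η T v n h) :=
      Measure.isProbabilityMeasure_map (hη.measurable_path_const v n h).aemeasurable
    rw [measure_univ, mul_one]
  | succ m hnm ih =>
    obtain ⟨ih1, ih2⟩ := ih
    have hone : ∀ p, IsAdmissible m p → ∀ᵐ ω ∂μ, IsAdmissible (m + 1)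
        (path v m p ((η ω).inter (exploredBy m p)ᶜ) (T ω)) := by
      intro p hp
      filter_upwards [hη.ae_nearest (T := T) (hp.time_nonneg le_rfl)] with ω hω
      have h1 := hp.extend v hη (ω := ω) hω
      refine ⟨?_, fun k hk => ?_⟩
      · rw [path_eq_extend v _ _ _ (Nat.zero_le _)]; exact h1.1
      · rw [path_eq_extend v _ _ _ (by omega), path_eq_extend v _ _ _ (by omega)]
        exact h1.2 k hk
    refine ⟨?_, ?_⟩
    · rw [← ih2]
      have hz : (Measure.bind (pathLaw μ η T v n h) fun p => pathLaw μ η T v m p)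
          {p | IsAdmissible (m + 1) p}ᶜ = 0 := by
        have hm : Measurable fun p => pathLaw μ η T v m p {p | IsAdmissible (m + 1) p}ᶜ :=
          (Measure.measurable_coe (measurableSet_isAdmissible _).compl).comp
            (measurable_pathLaw v hη m)
        rw [Measure.bind_apply (measurableSet_isAdmissible _).compl
          (measurable_pathLaw v hη m).aemeasurable]
        refine (lintegral_eq_zero_iff hm).2 ?_
        filter_upwards [ih1] with p hp
        rw [Pi.zero_apply]
        rw [pathLaw_apply v hη _ _ (measurableSet_isAdmissible _).compl]
        exact hone p hp
      exact hz
    · ext A hA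
      set f : (ℕ → ℝ × ℝ) → ℝ≥0∞ := fun p => pathLaw μ η T v (m + 1) p A with hf
      have hfm : Measurable f :=
        (Measure.measurable_coe hA).comp (measurable_pathLaw v hη (m + 1))
      rw [Measure.bind_apply hA (measurable_pathLaw v hη (m + 1)).aemeasurable]
      -- Both sides are disintegrated over the law at step `m`; for each admissible history the
      -- one-step property identifies the integrands.
      conv_lhs => rw [← ih2]
      rw [Measure.lintegral_bind (measurable_pathLaw v hη m).aemeasurable hfm.aemeasurable]
      conv_rhs => rw [← ih2]
      rw [Measure.bind_apply hA (measurable_pathLaw v hη m).aemeasurable]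
      refine lintegral_congr_ae ?_
      filter_upwards [ih1] with p hp
      rw [pathLaw_step v hη (hp.time_nonneg le_rfl) hA]
      have : pathLaw μ η T v m p = μ.map fun ω => path v m p ((η ω).inter (exploredBy m p)ᶜ) (T ω) :=
        rfl
      rw [this, lintegral_map hfm (hη.measurable_path_const v m p)]
      congr 1
      funext ω
      simp only [hf]
      rw [pathLaw_congr v fun k hk => path_eq_extend v p _ (T ω) hk]

/-- If from every admissible history the path is in `G` with probability at least `δ`, then it is
almost surely in `G`. -/
lemma pathLaw_eq_one (hη : IsFresh μ η T) {h : ℕ → ℝ × ℝ} (hh : 0 ≤ (h 0).2)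
    {G : Set (ℕ → ℝ × ℝ)} (hG : MeasurableSet G) {δ : ℝ} (hδ : 0 < δ)
    (hlow : ∀ m p, IsAdmissible m p → ENNReal.ofReal δ ≤ pathLaw μ η T v m p G) :
    pathLaw μ η T v 0 h Gᶜ = 0 := by
  set Q := pathLaw μ η T v 0 h with hQ
  have hprob : ∀ m p, IsProbabilityMeasure (pathLaw μ η T v m p) := fun m p =>
    Measure.isProbabilityMeasure_map (hη.measurable_path_const v m p).aemeasurable
  have : IsProbabilityMeasure Q := hprob 0 h
  -- An event `B` that depends on the steps up to `m` is decided by the history, after which `G`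
  -- still has probability at least `δ`.
  have hcyl : ∀ B ∈ measurableCylinders (fun _ : ℕ => ℝ × ℝ),
      ENNReal.ofReal δ * Q B ≤ Q (B ∩ G) := by
    intro B hB
    have hBm : MeasurableSet B := MeasurableSet.of_mem_measurableCylinders hB
    obtain ⟨s, S, hS, rfl⟩ := (mem_measurableCylinders _).1 hB
    set m := s.sup id with hm
    have hdep : ∀ p p' : ℕ → ℝ × ℝ, (∀ k ≤ m, p k = p' k) → p ∈ cylinder s S → p' ∈ cylinder s S := by
      intro p p' hpp hp
      rw [mem_cylinder] at hp ⊢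
      convert hp using 1
      funext k
      exact (hpp k (Finset.le_sup (f := id) k.2)).symm
    obtain ⟨h1, h2⟩ := pathLaw_bind v hη (n := 0) (h := h) ⟨hh, by simp⟩ (Nat.zero_le m)
    rw [← hQ] at h1 h2
    conv_rhs => rw [← h2]
    rw [Measure.bind_apply (hBm.inter hG) (measurable_pathLaw v hη m).aemeasurable,
      ← lintegral_indicator_one hBm, ← lintegral_const_mul _ (measurable_one.indicator hBm)]
    refine lintegral_mono_ae ?_
    filter_upwards [h1] with p hp
    by_cases hpB : p ∈ cylinder s S
    · rw [Set.indicator_of_mem hpB, Pi.one_apply, mul_one]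
      refine (hlow m p hp).trans ?_
      rw [pathLaw_apply v hη _ _ hG, pathLaw_apply v hη _ _ (hBm.inter hG)]
      refine measure_mono fun ω hω => ⟨hdep p _ (fun k hk => (path_of_le v _ _ _ hk).symm) hpB, hω⟩
    · rw [Set.indicator_of_notMem hpB, mul_zero]
      exact zero_le
  have hdense := Measure.MeasureDense.of_generateFrom_isSetAlgebra_finite (μ := Q)
    (isSetAlgebra_measurableCylinders (α := fun _ : ℕ => ℝ × ℝ))
    generateFrom_measurableCylinders.symm
  by_contra hne
  have hpos : 0 < (Q Gᶜ).toReal := ENNReal.toReal_pos hne (measure_ne_top _ _)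
  -- Let `B` approximate the complement of `G` up to `ε`, and let `x` be the mass of that
  -- complement. Then `B` has mass at least `x - ε ≥ 3 * x / 4`, but `δ` times its mass is at most
  -- the mass of `B ∩ G`, below `ε ≤ δ * x / 4`. So `x = 0`.
  obtain ⟨B, hB, hBε⟩ := hdense.approx Gᶜ hG.compl (measure_ne_top _ _)
    (min (δ * (Q Gᶜ).toReal / 4) ((Q Gᶜ).toReal / 4)) (by positivity)
  have h1 : Q (B ∩ G) ≤ Q (symmDiff Gᶜ B) := measure_mono fun p hp => Or.inr ⟨hp.1, fun h => h hp.2⟩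
  have h2 : Q Gᶜ ≤ Q B + Q (symmDiff Gᶜ B) := by
    refine (measure_mono fun p hp => ?_).trans (measure_union_le _ _)
    by_cases hpB : p ∈ B
    · exact Or.inl hpB
    · exact Or.inr (Or.inl ⟨hp, hpB⟩)
  have h3 := (hcyl B hB).trans h1
  have e1 : Q Gᶜ = ENNReal.ofReal (Q Gᶜ).toReal := (ENNReal.ofReal_toReal (measure_ne_top _ _)).symm
  have e2 : Q B = ENNReal.ofReal (Q B).toReal := (ENNReal.ofReal_toReal (measure_ne_top _ _)).symm
  have e3 : Q (symmDiff Gᶜ B) = ENNReal.ofReal (Q (symmDiff Gᶜ B)).toReal :=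
    (ENNReal.ofReal_toReal (measure_ne_top _ _)).symm
  rw [e2, e3, ← ENNReal.ofReal_mul hδ.le, ENNReal.ofReal_le_ofReal_iff ENNReal.toReal_nonneg] at h3
  rw [e1, e2, e3, ← ENNReal.ofReal_add ENNReal.toReal_nonneg ENNReal.toReal_nonneg,
    ENNReal.ofReal_le_ofReal_iff (add_nonneg ENNReal.toReal_nonneg ENNReal.toReal_nonneg)] at h2
  rw [e3, ENNReal.ofReal_lt_ofReal_iff (by positivity), lt_min_iff] at hBε
  nlinarith [hBε.1, hBε.2]

end

/-! ### Independence and laws of Poisson processes -/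

section
variable {Ω E : Type*} [mΩ : MeasurableSpace Ω] [MeasurableSpace E] {μ : Measure Ω}

omit mΩ in
lemma isPiSystem_image2_inter (m m' : MeasurableSpace Ω) :
    IsPiSystem {s | ∃ a b, MeasurableSet[m] a ∧ MeasurableSet[m'] b ∧ s = a ∩ b} := by
  rintro _ ⟨a, b, ha, hb, rfl⟩ _ ⟨a', b', ha', hb', rfl⟩ _
  exact ⟨a ∩ a', b ∩ b', ha.inter ha', hb.inter hb', Set.inter_inter_inter_comm _ _ _ _⟩

omit mΩ in
lemma sup_eq_generateFrom_inter (m m' : MeasurableSpace Ω) : m ⊔ m' =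
    MeasurableSpace.generateFrom
      {s | ∃ a b, MeasurableSet[m] a ∧ MeasurableSet[m'] b ∧ s = a ∩ b} := by
  refine le_antisymm (sup_le ?_ ?_) (MeasurableSpace.generateFrom_le ?_)
  · intro a ha
    exact MeasurableSpace.measurableSet_generateFrom
      ⟨a, Set.univ, ha, MeasurableSet.univ, (Set.inter_univ a).symm⟩
  · intro a ha
    exact MeasurableSpace.measurableSet_generateFrom
      ⟨Set.univ, a, MeasurableSet.univ, ha, (Set.univ_inter a).symm⟩
  · rintro _ ⟨a, b, ha, hb, rfl⟩
    have h1 : MeasurableSet[m ⊔ m'] a := le_sup_left (a := m) _ ha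
    have h2 : MeasurableSet[m ⊔ m'] b := le_sup_right (a := m) _ hb
    exact MeasurableSet.inter h1 h2

/-- Intersections of one event of each family form a generating π-system on which probabilities
factorize. It serves to superpose initial and later customers. -/
lemma iIndep_sup {ι : Type*} {m m' : ι → MeasurableSpace Ω} (hm : ∀ i, m i ≤ mΩ)
    (hm' : ∀ i, m' i ≤ mΩ) (h : iIndep m μ) (h' : iIndep m' μ)
    (hi : Indep (⨆ i, m i) (⨆ i, m' i) μ) : iIndep (fun i => m i ⊔ m' i) μ := by
  refine iIndepSets.iIndep (fun i => sup_le (hm i) (hm' i)) _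
    (fun i => isPiSystem_image2_inter (m i) (m' i))
    (fun i => sup_eq_generateFrom_inter (m i) (m' i)) ?_
  refine (iIndepSets_iff _ _).2 fun s f hf => ?_
  choose! a b ha hb hab using hf
  have h1 : ⋂ i ∈ s, f i = (⋂ i ∈ s, a i) ∩ ⋂ i ∈ s, b i := by
    simp_rw [← Set.iInter_inter_distrib]
    exact Set.iInter₂_congr hab
  have hma : MeasurableSet[⨆ i, m i] (⋂ i ∈ s, a i) :=
    Finset.measurableSet_biInter s fun i hi => le_iSup m i _ (ha i hi)
  have hmb : MeasurableSet[⨆ i, m' i] (⋂ i ∈ s, b i) :=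
    Finset.measurableSet_biInter s fun i hi => le_iSup m' i _ (hb i hi)
  have hone : ∀ i ∈ s, μ (f i) = μ (a i) * μ (b i) := fun i his => by
    rw [hab i his]
    exact (Indep_iff _ _ _).1 hi _ _ (le_iSup m i _ (ha i his)) (le_iSup m' i _ (hb i his))
  rw [h1, (Indep_iff _ _ _).1 hi _ _ hma hmb, h.meas_biInter ha, h'.meas_biInter hb,
    ← Finset.prod_mul_distrib]
  exact (Finset.prod_congr rfl hone).symm

/-- This regroups four σ-algebras: customers inside a region with the first service, against
customers outside with the later services. -/
lemma indep_sup_sup [IsProbabilityMeasure μ] {a b c d : MeasurableSpace Ω} (ha : a ≤ mΩ)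
    (hb : b ≤ mΩ) (hc : c ≤ mΩ) (hd : d ≤ mΩ) (hab : Indep a b μ) (hcd : Indep c d μ)
    (h : Indep (a ⊔ b) (c ⊔ d) μ) : Indep (a ⊔ c) (b ⊔ d) μ := by
  refine IndepSets.indep (sup_le ha hc) (sup_le hb hd) (isPiSystem_image2_inter a c)
    (isPiSystem_image2_inter b d) (sup_eq_generateFrom_inter a c)
    (sup_eq_generateFrom_inter b d) ((IndepSets_iff _ _ _).2 ?_)
  rintro _ _ ⟨x, y, hx, hy, rfl⟩ ⟨z, w, hz, hw, rfl⟩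
  have la : ∀ s, MeasurableSet[a] s → MeasurableSet[a ⊔ b] s := fun s hs =>
    le_sup_left (a := a) _ hs
  have lb : ∀ s, MeasurableSet[b] s → MeasurableSet[a ⊔ b] s := fun s hs =>
    le_sup_right (a := a) _ hs
  have lc : ∀ s, MeasurableSet[c] s → MeasurableSet[c ⊔ d] s := fun s hs =>
    le_sup_left (a := c) _ hs
  have ld : ∀ s, MeasurableSet[d] s → MeasurableSet[c ⊔ d] s := fun s hs =>
    le_sup_right (a := c) _ hs
  have hh := (Indep_iff _ _ _).1 h
  rw [Set.inter_inter_inter_comm, hh _ _ (MeasurableSet.inter (la x hx) (lb z hz))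
    (MeasurableSet.inter (lc y hy) (ld w hw)), hh _ _ (la x hx) (lc y hy),
    hh _ _ (lb z hz) (ld w hw), (Indep_iff _ _ _).1 hab _ _ hx hz,
    (Indep_iff _ _ _).1 hcd _ _ hy hw]
  ring

omit mΩ [MeasurableSpace E] in
lemma count_preimage_eq_sum {κ : Type*} [DecidableEq κ] (g : E → κ) (K : Finset κ)
    (ξ : Ω → Set E) (ω : Ω) : count ξ (g ⁻¹' K) ω = ∑ k ∈ K, count ξ (g ⁻¹' {k}) ω := by
  induction K using Finset.induction_on with
  | empty => simp [count]
  | insert a K ha ih =>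
    rw [Finset.sum_insert ha, ← ih]
    simp only [count]
    rw [← Set.encard_union_eq, ← Set.inter_union_distrib_left, ← Set.preimage_union]
    · rw [Finset.coe_insert, Set.insert_eq]
    · refine Set.disjoint_left.2 fun x h1 h2 => ha ?_
      have h3 : g x = a := h1.2
      have h4 : g x ∈ K := h2.2
      exact h3 ▸ h4

namespace IsPoissonProcess

variable {ν : Measure E} {ξ : Ω → Set E}

lemma iIndepFun_count (h : IsPoissonProcess μ ν ξ) {κ : Type*} [Fintype κ] {B : κ → Set E}
    (hB : ∀ k, MeasurableSet (B k)) (hd : Pairwise fun i j => Disjoint (B i) (B j)) :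
    iIndepFun (fun k => count ξ (B k)) μ := by
  have h1 := h.indep_count (Fintype.card κ) (fun i => B ((Fintype.equivFin κ).symm i))
    (fun i => hB _) fun i j hij => hd (by simpa using hij)
  have h2 := h1.precomp (Fintype.equivFin κ).injective
  simpa using h2

lemma iIndepFun_count_preimage (h : IsPoissonProcess μ ν ξ) {κ : Type*} [Fintype κ] {g : E → κ}
    (hg : ∀ k, MeasurableSet (g ⁻¹' {k})) : iIndepFun (fun k => count ξ (g ⁻¹' {k})) μ :=
  h.iIndepFun_count hg fun _ _ hij => Set.disjoint_left.2 fun _ h1 h2 => hij (h1.symm.trans h2)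

/-- The restrictions of a Poisson process to a set and to its complement are independent. -/
lemma indepFun_compl [IsProbabilityMeasure μ] (h : IsPoissonProcess μ ν ξ) {B : Set E}
    (hB : MeasurableSet B) :
    IndepFun (fun ω (A : {A : Set E // MeasurableSet A}) => count ξ (A.1 ∩ B) ω)
      (fun ω (A : {A : Set E // MeasurableSet A}) => count ξ (A.1 ∩ Bᶜ) ω) μ := by
  classical
  refine IndepFun.process_indepFun_process (fun A => h.measurable_count _ (A.2.inter hB))
    (fun A => h.measurable_count _ (A.2.inter hB.compl)) fun I J => ?_
  -- Each point is labelled by its membership in the finitely many sets and in `B`. Counts of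
  -- different labels are independent, and the labels inside `B` are disjoint from those outside.
  let g : E → ((I → Bool) × (J → Bool)) × Bool := fun c =>
    ((fun i => decide (c ∈ i.1.1), fun j => decide (c ∈ j.1.1)), decide (c ∈ B))
  have hdec : ∀ A : Set E, MeasurableSet A → Measurable fun c => decide (c ∈ A) := fun A hA =>
    measurable_to_bool (by convert hA using 1; ext c; simp)
  have hgm : Measurable g := by
    refine ((measurable_pi_lambda _ fun i => hdec _ i.1.2).prodMk
      (measurable_pi_lambda _ fun j => hdec _ j.1.2)).prodMk (hdec _ hB)
  have hg : ∀ k, MeasurableSet (g ⁻¹' {k}) := fun k => hgm (measurableSet_singleton k)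
  have hind := h.iIndepFun_count_preimage hg
  have hi2 := indep_iSup_of_disjoint (S := {k | k.2 = true}) (T := {k | k.2 = false})
    (fun k => (h.measurable_count _ (hg k)).comap_le) hind
    (Set.disjoint_left.2 fun k h1 h2 => by simp_all)
  have hcount : ∀ (S : Set (((I → Bool) × (J → Bool)) × Bool)) (K : Finset _), (∀ k ∈ K, k ∈ S) →
      Measurable[⨆ k ∈ S, MeasurableSpace.comap (count ξ (g ⁻¹' {k})) inferInstance]
        fun ω => count ξ (g ⁻¹' K) ω := by
    intro S K hK
    simp_rw [count_preimage_eq_sum g K]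
    refine @Finset.measurable_fun_sum _ _ _ _ _ _ (_) _ _ fun k hk => ?_
    exact (comap_measurable (count ξ (g ⁻¹' {k}))).mono (le_iSup₂_of_le k (hK k hk) le_rfl) le_rfl
  rw [IndepFun_iff_Indep]
  refine indep_of_indep_of_le_left (indep_of_indep_of_le_right hi2 ?_) ?_
  · refine Measurable.comap_le (@measurable_pi_lambda _ _ _ (_) _ _ fun j => ?_)
    have := hcount {k | k.2 = false} (Finset.univ.filter fun k => k.1.2 j = true ∧ k.2 = false)
      (by simp)
    convert this using 2 with ω
    congr 1
    ext c
    simp [g]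
  · refine Measurable.comap_le (@measurable_pi_lambda _ _ _ (_) _ _ fun i => ?_)
    have := hcount {k | k.2 = true} (Finset.univ.filter fun k => k.1.1 i = true ∧ k.2 = true)
      (by simp)
    convert this using 2 with ω
    congr 1
    ext c
    simp [g]

/-- The intensity determines the joint laws of the counts in sets of finite intensity. -/
lemma map_count_eq [IsProbabilityMeasure μ] (h : IsPoissonProcess μ ν ξ) {ξ' : Ω → Set E}
    (h' : IsPoissonProcess μ ν ξ') {ι : Type*} [Fintype ι] {A : ι → Set E}
    (hA : ∀ i, MeasurableSet (A i)) (hfin : ∀ i, ν (A i) ≠ ∞) :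
    μ.map (fun ω i => count ξ (A i) ω) = μ.map (fun ω i => count ξ' (A i) ω) := by
  classical
  let g : E → (ι → Bool) := fun c i => decide (c ∈ A i)
  have hdec : ∀ A : Set E, MeasurableSet A → Measurable fun c => decide (c ∈ A) := fun A hA =>
    measurable_to_bool (by convert hA using 1; ext c; simp)
  have hgm : Measurable g := measurable_pi_lambda _ fun i => hdec _ (hA i)
  have hg : ∀ k, MeasurableSet (g ⁻¹' {k}) := fun k => hgm (measurableSet_singleton k)
  -- The label of the points outside all `A i` is left out, since its atom may have infinite
  -- intensity.
  have hgfin : ∀ k : {k : ι → Bool // ∃ i, k i = true}, ν (g ⁻¹' {k.1}) ≠ ∞ := by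
    rintro ⟨k, i, hi⟩
    refine ne_top_of_le_ne_top (hfin i) (measure_mono fun c hc => ?_)
    have : g c = k := hc
    rw [← this] at hi
    simpa [g] using hi
  have key : ∀ ζ : Ω → Set E, IsPoissonProcess μ ν ζ →
      μ.map (fun ω i => count ζ (A i) ω) =
      (Measure.pi fun k : {k : ι → Bool // ∃ i, k i = true} =>
        (poissonMeasure (ν (g ⁻¹' {k.1})).toNNReal).map (Nat.cast : ℕ → ℕ∞)).map
        (fun x i => ∑ k : {k : ι → Bool // ∃ i, k i = true}, if k.1 i then x k else 0) := by
    intro ζ hζ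
    have hX : ∀ k : {k : ι → Bool // ∃ i, k i = true}, Measurable (count ζ (g ⁻¹' {k.1})) :=
      fun k => hζ.measurable_count _ (hg _)
    have h1 := (hζ.iIndepFun_count_preimage hg).precomp
      (g := fun k : {k : ι → Bool // ∃ i, k i = true} => k.1) Subtype.val_injective
    rw [iIndepFun_iff_map_fun_eq_pi_map fun k => (hX k).aemeasurable] at h1
    simp_rw [fun k : {k : ι → Bool // ∃ i, k i = true} =>
      (hζ.map_count _ (hg k.1) (hgfin k)).symm]
    rw [← h1, Measure.map_map (Measurable.of_discrete) (measurable_pi_lambda _ hX)]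
    congr 1
    funext ω i
    simp only [Function.comp_apply]
    have h2 := count_preimage_eq_sum g (Finset.univ.filter fun k => k i = true) ζ ω
    have h3 : (g ⁻¹' (Finset.univ.filter fun k => k i = true : Finset (ι → Bool))) = A i := by
      ext c; simp [g]
    rw [h3] at h2
    rw [h2, Finset.sum_filter, ← Finset.sum_subtype
      (Finset.univ.filter fun k : ι → Bool => ∃ i, k i = true) (by simp)
      (fun k => if k i = true then count ζ (g ⁻¹' {k}) ω else 0)]
    refine (Finset.sum_filter_of_ne fun k _ hk => ?_).symm
    by_contra hk'
    exact hk (if_neg fun h => hk' ⟨i, h⟩)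
  rw [key ξ h, key ξ' h']

end IsPoissonProcess

end

/-! ### Tail bounds for Poisson variables -/

section
open scoped NNReal Nat

lemma lintegral_poissonMeasure (r : ℝ≥0) (f : ℕ → ℝ≥0∞) : ∫⁻ n, f n ∂(poissonMeasure r) =
    ∑' n : ℕ, ENNReal.ofReal (Real.exp (-r) * r ^ n / n !) * f n := by
  rw [poissonMeasure, lintegral_sum_measure]
  simp_rw [lintegral_smul_measure, lintegral_dirac, smul_eq_mul]

lemma tsum_poissonMeasure (r : ℝ≥0) :
    ∑' n : ℕ, ENNReal.ofReal (Real.exp (-r) * r ^ n / n !) = 1 := by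
  have := lintegral_poissonMeasure r fun _ => 1
  simpa using this.symm

lemma lintegral_exp_poissonMeasure (r : ℝ≥0) (θ : ℝ) :
    ∫⁻ n : ℕ, ENNReal.ofReal (Real.exp (θ * n)) ∂(poissonMeasure r) =
      ENNReal.ofReal (Real.exp (r * (Real.exp θ - 1))) := by
  rw [lintegral_poissonMeasure]
  set r' : ℝ≥0 := ⟨r * Real.exp θ, by positivity⟩ with hr'
  have hterm : ∀ n : ℕ, ENNReal.ofReal (Real.exp (-r) * r ^ n / n !) *
      ENNReal.ofReal (Real.exp (θ * n)) = ENNReal.ofReal (Real.exp (r * (Real.exp θ - 1))) *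
        ENNReal.ofReal (Real.exp (-r') * r' ^ n / n !) := by
    intro n
    rw [← ENNReal.ofReal_mul (by positivity), ← ENNReal.ofReal_mul (by positivity)]
    congr 1
    have h1 : (r' : ℝ) = r * Real.exp θ := rfl
    have h2 : Real.exp (θ * n) = Real.exp θ ^ n := by rw [← Real.exp_nat_mul, mul_comm]
    have h3 : Real.exp (r * (Real.exp θ - 1)) * Real.exp (-r') = Real.exp (-r) := by
      rw [← Real.exp_add, h1]; congr 1; ring
    rw [h2, ← h3, h1, mul_pow]
    ring
  simp_rw [hterm]
  rw [ENNReal.tsum_mul_left, tsum_poissonMeasure, mul_one]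

/-- Markov's inequality for `exp (θ * n)`. The event is written as `θ * b ≤ θ * n` so that a
negative `θ` yields the lower tail. -/
lemma poissonMeasure_exp_le (r : ℝ≥0) (θ b : ℝ) :
    poissonMeasure r {n : ℕ | θ * b ≤ θ * n} ≤
      ENNReal.ofReal (Real.exp (r * (Real.exp θ - 1) - θ * b)) := by
  have h := mul_meas_ge_le_lintegral₀ (μ := poissonMeasure r)
    (f := fun n : ℕ => ENNReal.ofReal (Real.exp (θ * n))) (by fun_prop)
    (ENNReal.ofReal (Real.exp (θ * b)))
  rw [lintegral_exp_poissonMeasure] at h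
  have h2 : {n : ℕ | θ * b ≤ θ * n} =
      {n : ℕ | ENNReal.ofReal (Real.exp (θ * b)) ≤ ENNReal.ofReal (Real.exp (θ * n))} := by
    ext n
    simp only [Set.mem_ofPred_eq]
    rw [ENNReal.ofReal_le_ofReal_iff (by positivity), Real.exp_le_exp]
  rw [h2, Real.exp_sub, ENNReal.ofReal_div_of_pos (by positivity)]
  rw [ENNReal.le_div_iff_mul_le (Or.inl (by positivity)) (Or.inl (by simp)), mul_comm]
  exact h

/-- Since `i ! ≤ (i + J) !`, the tail is at most `r ^ J` times a total mass of one. The case `J = 1`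
is used for rare events, `J = 2` for coincidences. -/
lemma poissonMeasure_ge_le_pow (r : ℝ≥0) (J : ℕ) :
    poissonMeasure r {n : ℕ | J ≤ n} ≤ (r : ℝ≥0∞) ^ J := by
  have h1 : {n : ℕ | J ≤ n} = ⋃ i : ℕ, {i + J} := by
    ext n
    simp only [Set.mem_ofPred_eq, Set.mem_iUnion, Set.mem_singleton_iff]
    exact ⟨fun h => ⟨n - J, by omega⟩, fun ⟨i, hi⟩ => by omega⟩
  rw [h1]
  refine (measure_iUnion_le _).trans ?_
  have h2 : ∀ i : ℕ, poissonMeasure r {i + J} ≤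
      (r : ℝ≥0∞) ^ J * ENNReal.ofReal (Real.exp (-r) * r ^ i / i !) := by
    intro i
    rw [poissonMeasure_singleton, ← ENNReal.coe_pow, ← ENNReal.ofReal_coe_nnreal,
      ← ENNReal.ofReal_mul (by positivity)]
    refine ENNReal.ofReal_le_ofReal ?_
    push_cast
    rw [pow_add]
    have h3 : (i ! : ℝ) ≤ (i + J) ! := by exact_mod_cast Nat.factorial_le (by omega)
    have h4 : Real.exp (-r) * (r ^ i * r ^ J) / (i + J) ! ≤
        Real.exp (-r) * (r ^ i * r ^ J) / i ! := by gcongr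
    exact h4.trans_eq (by ring)
  refine (ENNReal.tsum_le_tsum h2).trans ?_
  rw [ENNReal.tsum_mul_left, tsum_poissonMeasure, mul_one]

end

namespace IsPoissonProcess

variable {Ω E : Type*} [MeasurableSpace Ω] [MeasurableSpace E] {μ : Measure Ω} {ν : Measure E}
  {ξ : Ω → Set E}

lemma measure_count_mem (h : IsPoissonProcess μ ν ξ) {B : Set E} (hB : MeasurableSet B)
    (hf : ν B ≠ ∞) (K : Set ℕ∞) :
    μ {ω | count ξ B ω ∈ K} = poissonMeasure (ν B).toNNReal {n : ℕ | (n : ℕ∞) ∈ K} := by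
  have h1 := h.map_count B hB hf
  have h2 := Measure.map_apply (μ := μ) (h.measurable_count B hB) (s := K) (MeasurableSet.of_discrete)
  rw [h1, Measure.map_apply (.of_discrete) (MeasurableSet.of_discrete)] at h2
  exact h2.symm

lemma measure_count_eq_zero (h : IsPoissonProcess μ ν ξ) {B : Set E} (hB : MeasurableSet B)
    (hf : ν B ≠ ∞) : μ {ω | count ξ B ω = 0} = ENNReal.ofReal (Real.exp (-(ν B).toReal)) := by
  have h1 := h.measure_count_mem hB hf {0}
  have h2 : {n : ℕ | (n : ℕ∞) ∈ ({0} : Set ℕ∞)} = {0} := by ext n; simp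
  rw [h2, poissonMeasure_singleton] at h1
  simpa [ENNReal.coe_toNNReal_eq_toReal] using h1

lemma measure_le_count_le_pow (h : IsPoissonProcess μ ν ξ) {B : Set E} (hB : MeasurableSet B)
    (hf : ν B ≠ ∞) (J : ℕ) : μ {ω | (J : ℕ∞) ≤ count ξ B ω} ≤ ν B ^ J := by
  have h1 := h.measure_count_mem hB hf {x | (J : ℕ∞) ≤ x}
  simp only [Set.mem_ofPred_eq, Nat.cast_le] at h1
  rw [h1]
  refine (poissonMeasure_ge_le_pow _ J).trans ?_
  rw [ENNReal.coe_toNNReal hf]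

lemma measure_le_count_le_exp (h : IsPoissonProcess μ ν ξ) {B : Set E} (hB : MeasurableSet B)
    (hf : ν B ≠ ∞) {θ : ℝ} (hθ : 0 ≤ θ) (b : ℕ) : μ {ω | (b : ℕ∞) ≤ count ξ B ω} ≤
      ENNReal.ofReal (Real.exp ((ν B).toReal * (Real.exp θ - 1) - θ * b)) := by
  have h1 := h.measure_count_mem hB hf {x | (b : ℕ∞) ≤ x}
  simp only [Set.mem_ofPred_eq, Nat.cast_le] at h1
  rw [h1]
  refine (measure_mono fun n hn => ?_).trans (poissonMeasure_exp_le _ θ b)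
  have : (b : ℝ) ≤ n := by exact_mod_cast hn
  exact mul_le_mul_of_nonneg_left this hθ

lemma measure_count_le_le_exp (h : IsPoissonProcess μ ν ξ) {B : Set E} (hB : MeasurableSet B)
    (hf : ν B ≠ ∞) {θ : ℝ} (hθ : 0 ≤ θ) (a : ℕ) : μ {ω | count ξ B ω ≤ a} ≤
      ENNReal.ofReal (Real.exp ((ν B).toReal * (Real.exp (-θ) - 1) + θ * a)) := by
  have h1 := h.measure_count_mem hB hf {x | x ≤ (a : ℕ∞)}
  simp only [Set.mem_ofPred_eq, Nat.cast_le] at h1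
  rw [h1]
  refine (measure_mono fun n hn => ?_).trans ((poissonMeasure_exp_le _ (-θ) a).trans_eq ?_)
  · have : (n : ℝ) ≤ a := by exact_mod_cast hn
    simp only [Set.mem_ofPred_eq]
    nlinarith
  · rw [neg_mul, sub_neg_eq_add]
    rfl

lemma ae_count_eq_zero (h : IsPoissonProcess μ ν ξ) {B : Set E} (hB : MeasurableSet B)
    (hf : ν B = 0) : ∀ᵐ ω ∂μ, count ξ B ω = 0 := by
  have h1 := h.measure_le_count_le_pow hB (by simp [hf]) 1
  rw [hf, pow_one] at h1
  refine measure_mono_null (fun ω hω => ?_) (le_antisymm h1 bot_le)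
  exact Order.one_le_iff_ne_zero.2 hω

end IsPoissonProcess

/-! ### Variables of mean one -/

section
variable {Ω : Type*} [MeasurableSpace Ω] {μ : Measure Ω} [IsProbabilityMeasure μ]

/-- A variable of mean one is at most `1` with positive probability. -/
lemma measure_le_one_pos {X : Ω → ℝ} (hX : Integrable X μ) (hmean : ∫ ω, X ω ∂μ = 1) :
    0 < μ {ω | X ω ≤ 1} := by
  have h1 : 0 < μ {ω | X ω ≤ ∫ a, X a ∂μ} := measure_le_integral_pos hX
  rwa [hmean] at h1

/-- A variable of mean one is bounded away from zero with positive probability. -/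
lemma measure_one_le_pos {X : Ω → ℝ} (hX : Integrable X μ) (hmean : ∫ ω, X ω ∂μ = 1) :
    0 < μ {ω | 1 ≤ X ω} := by
  have h1 : 0 < μ {ω | ∫ a, X a ∂μ ≤ X ω} := measure_integral_le_pos hX
  rwa [hmean] at h1

end

/-! ### The joint input of customers and services -/

/-- The intensity of the process of all customers: unit intensity on the line of initial customers,
and intensity `lam` on the half-plane of later arrivals. -/
def intensity (lam : ℝ) : Measure (ℝ × ℝ) :=
  (volume : Measure ℝ).map (fun x => (x, (0 : ℝ))) +
    ENNReal.ofReal lam • (volume : Measure (ℝ × ℝ)).restrict (Set.univ ×ˢ Set.Ioi 0)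

lemma intensity_apply (lam : ℝ) {B : Set (ℝ × ℝ)} (hB : MeasurableSet B) :
    intensity lam B = volume {x : ℝ | (x, (0 : ℝ)) ∈ B} +
      ENNReal.ofReal lam * volume (B ∩ (Set.univ ×ˢ Set.Ioi 0)) := by
  rw [intensity, Measure.add_apply, Measure.map_apply (by fun_prop) hB, Measure.smul_apply,
    Measure.restrict_apply hB, smul_eq_mul]
  rfl

lemma intensity_prod_Iic_le (lam : ℝ) {A : Set ℝ} (hA : MeasurableSet A) (t : ℝ) :
    intensity lam (A ×ˢ Set.Iic t) ≤ volume A * (1 + ENNReal.ofReal lam * ENNReal.ofReal t) := by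
  have h1 : (A ×ˢ Set.Iic t) ∩ (Set.univ ×ˢ Set.Ioi 0) = A ×ˢ Set.Ioc 0 t := by
    ext c; simp only [Set.mem_inter_iff, Set.mem_prod, Set.mem_univ, Set.mem_Iic, Set.mem_Ioi,
      Set.mem_Ioc]; tauto
  rw [intensity_apply lam (hA.prod measurableSet_Iic), mul_add, mul_one, h1,
    Measure.volume_eq_prod, Measure.prod_prod, Real.volume_Ioc, sub_zero, mul_left_comm]
  gcongr
  exact fun x hx => hx.1

lemma intensity_prod_Iic_ne_top (lam : ℝ) {A : Set ℝ} (hA : MeasurableSet A)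
    (hf : volume A ≠ ∞) (t : ℝ) : intensity lam (A ×ˢ Set.Iic t) ≠ ∞ :=
  ne_top_of_le_ne_top (by finiteness) (intensity_prod_Iic_le lam hA t)

lemma intensity_box_ne_top (lam : ℝ) (k : ℕ) : intensity lam (box k) ≠ ∞ :=
  ne_top_of_le_ne_top (intensity_prod_Iic_ne_top lam (A := Set.Icc (-(k : ℝ)) k)
    measurableSet_Icc (by simp) k) (measure_mono fun _ hc => ⟨hc.1, hc.2.2⟩)

/-- The reflection of the customers. -/
def reflectPoint (c : ℝ × ℝ) : ℝ × ℝ := (-c.1, c.2)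

@[simp] lemma reflectPoint_reflectPoint (c : ℝ × ℝ) : reflectPoint (reflectPoint c) = c := by
  simp [reflectPoint]

lemma measurable_reflectPoint : Measurable reflectPoint := by
  unfold reflectPoint; fun_prop

lemma measurePreserving_reflectPoint :
    MeasurePreserving reflectPoint (volume : Measure (ℝ × ℝ)) volume := by
  have h := (Measure.measurePreserving_neg (volume : Measure ℝ)).prod
    (MeasurePreserving.id (volume : Measure ℝ))
  exact h

lemma intensity_preimage_reflectPoint (lam : ℝ) {B : Set (ℝ × ℝ)} (hB : MeasurableSet B) :
    intensity lam (reflectPoint ⁻¹' B) = intensity lam B := by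
  rw [intensity_apply lam (measurable_reflectPoint hB), intensity_apply lam hB]
  congr 1
  · have h1 : MeasurableSet {x : ℝ | (x, (0 : ℝ)) ∈ B} := by
      have : Measurable fun x : ℝ => (x, (0 : ℝ)) := by fun_prop
      exact this hB
    exact (Measure.measurePreserving_neg (volume : Measure ℝ)).measure_preimage
      h1.nullMeasurableSet
  · congr 1
    have := measurePreserving_reflectPoint.measure_preimage
      (hB.inter (MeasurableSet.univ.prod measurableSet_Ioi)).nullMeasurableSet
      (s := B ∩ (Set.univ ×ˢ Set.Ioi (0 : ℝ)))
    rw [← this]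
    congr 1

/-- The reflected configuration. -/
def Conf.reflect (s : Conf) : Conf where
  carrier := reflectPoint ⁻¹' s.carrier
  nonneg c hc := s.nonneg (reflectPoint c) hc
  finite k := by
    refine ((s.finite k).image reflectPoint).subset fun c hc => ⟨reflectPoint c, ⟨hc.1, ?_⟩, by simp⟩
    obtain ⟨⟨h1, h2⟩, h3⟩ := hc.2
    exact ⟨⟨by simpa [reflectPoint] using h2, by simpa [reflectPoint] using neg_le.1 h1⟩, h3⟩

lemma Conf.cnt_reflect (s : Conf) (B : Set (ℝ × ℝ)) :
    s.reflect.cnt B = s.cnt (reflectPoint ⁻¹' B) := by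
  have : s.reflect.carrier ∩ B = reflectPoint '' (s.carrier ∩ reflectPoint ⁻¹' B) := by
    ext c
    constructor
    · rintro ⟨h1, h2⟩
      exact ⟨reflectPoint c, ⟨h1, by simpa using h2⟩, by simp⟩
    · rintro ⟨d, ⟨h1, h2⟩, rfl⟩
      exact ⟨by simpa [reflect] using h1, h2⟩
  rw [Conf.cnt, this, Set.InjOn.encard_image, Conf.cnt]
  exact (Function.Involutive.injective reflectPoint_reflectPoint).injOn

/-- The customers form a Poisson process with the above intensity, and the services are
independent of them, i.i.d. with mean one and an exponential moment. -/
structure IsInput {Ω : Type*} [MeasurableSpace Ω] (μ : Measure Ω) (lam : ℝ) (η : Ω → Conf)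
    (T : Ω → ℕ → ℝ) : Prop where
  measurable_conf : Measurable η
  poisson : IsPoissonProcess μ (intensity lam) fun ω => (η ω).carrier
  measurable_service : Measurable T
  nonneg : ∀ ω n, 0 ≤ T ω n
  service_indep : iIndepFun (fun n ω => T ω n) μ
  service_identDistrib : ∀ n, IdentDistrib (fun ω => T ω n) (fun ω => T ω 0) μ μ
  service_mean : ∫ ω, T ω 0 ∂μ = 1
  exists_exp : ∃ α : ℝ, 0 < α ∧ Integrable (fun ω => Real.exp (α * T ω 0)) μ
  indep : IndepFun η T μ

section
variable {Ω : Type*} [mΩ : MeasurableSpace Ω] {μ : Measure Ω} [IsProbabilityMeasure μ] {lam : ℝ}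
  {η : Ω → Conf} {T : Ω → ℕ → ℝ}

/-- Two independent Poisson configurations with the same intensity have the same law. -/
lemma map_conf_eq {η' : Ω → Conf} (hm : Measurable η) (hm' : Measurable η')
    (h : IsPoissonProcess μ (intensity lam) fun ω => (η ω).carrier)
    (h' : IsPoissonProcess μ (intensity lam) fun ω => (η' ω).carrier) :
    μ.map η = μ.map η' := by
  have hc : μ.map (fun ω i => (η ω).counts i) = μ.map (fun ω i => (η' ω).counts i) := by
    refine (map_eq_iff_forall_finset_map_restrict_eq (Conf.measurable_counts.comp hm).aemeasurable
      (Conf.measurable_counts.comp hm').aemeasurable).2 fun I => ?_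
    exact h.map_count_eq h' (A := fun i : I => i.1.2.1 ∩ box i.1.1)
      (fun i => i.1.2.2.inter (measurableSet_box _))
      (fun i => ne_top_of_le_ne_top (intensity_box_ne_top lam i.1.1)
        (measure_mono Set.inter_subset_right))
  ext A hA
  obtain ⟨B, hB, rfl⟩ := hA
  have h1 := congrArg (fun ρ => ρ B) hc
  have e1 := Measure.map_apply (μ := μ) (Conf.measurable_counts.comp hm) hB
  have e2 := Measure.map_apply (μ := μ) (Conf.measurable_counts.comp hm') hB
  have h1 := e1.symm.trans (h1.trans e2)
  rw [Measure.map_apply hm (Conf.measurable_counts hB),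
    Measure.map_apply hm' (Conf.measurable_counts hB)]
  exact h1

namespace IsInput

omit [IsProbabilityMeasure μ] in
lemma measurable_reflect (h : IsInput μ lam η T) : Measurable fun ω => (η ω).reflect := by
  refine Conf.measurable_iff.2 fun k B hB => ?_
  simp_rw [Conf.cnt_reflect]
  exact h.poisson.measurable_count _ (measurable_reflectPoint (hB.inter (measurableSet_box k)))

omit [IsProbabilityMeasure μ] in
lemma reflect (h : IsInput μ lam η T) : IsInput μ lam (fun ω => (η ω).reflect) T where
  measurable_conf := h.measurable_reflect
  poisson := by
    have hcnt : ∀ B, count (fun ω => (η ω).reflect.carrier) B =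
        count (fun ω => (η ω).carrier) (reflectPoint ⁻¹' B) := fun B => by
      funext ω; exact Conf.cnt_reflect (η ω) B
    refine ⟨fun B hB => ?_, fun B hB hf => ?_, fun n B hB hd => ?_⟩
    · rw [hcnt]; exact h.poisson.measurable_count _ (measurable_reflectPoint hB)
    · rw [hcnt, h.poisson.map_count _ (measurable_reflectPoint hB)
        (by rwa [intensity_preimage_reflectPoint lam hB]), intensity_preimage_reflectPoint lam hB]
    · simp_rw [hcnt]
      exact h.poisson.indep_count n _ (fun i => measurable_reflectPoint (hB i))
        fun i j hij => (hd hij).preimage _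
  measurable_service := h.measurable_service
  nonneg := h.nonneg
  service_indep := h.service_indep
  service_identDistrib := h.service_identDistrib
  service_mean := h.service_mean
  exists_exp := h.exists_exp
  indep := by
    have hr : Measurable Conf.reflect := by
      refine Conf.measurable_iff.2 fun k B hB => ?_
      simp_rw [Conf.cnt_reflect]
      exact Conf.measurable_cnt (f := fun s : Conf => s) measurable_id
        (Q := Prod.snd ⁻¹' (reflectPoint ⁻¹' (B ∩ box k)))
        (measurable_snd (measurable_reflectPoint (hB.inter (measurableSet_box k))))
    exact h.indep.comp hr measurable_id

lemma map_reflect (h : IsInput μ lam η T) :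
    μ.map (fun ω => ((η ω).reflect, T ω)) = μ.map (fun ω => (η ω, T ω)) := by
  rw [(indepFun_iff_map_prod_eq_prod_map_map h.measurable_reflect.aemeasurable
    h.measurable_service.aemeasurable).1 h.reflect.indep, (indepFun_iff_map_prod_eq_prod_map_map
    h.measurable_conf.aemeasurable h.measurable_service.aemeasurable).1 h.indep,
    map_conf_eq h.measurable_reflect h.measurable_conf h.reflect.poisson h.poisson]

omit [IsProbabilityMeasure μ] in
/-- Customers have almost surely different distances to a given point. -/
lemma ae_dist_injOn (h : IsInput μ lam η T) (x t : ℝ) : ∀ᵐ ω ∂μ, ∀ c ∈ (η ω).carrier,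
    ∀ c' ∈ (η ω).carrier, c.2 ≤ t → c'.2 ≤ t → |c.1 - x| = |c'.1 - x| → c = c' := by
  have hK : ∀ K : ℕ, ∀ᵐ ω ∂μ, ∀ c ∈ (η ω).carrier, ∀ c' ∈ (η ω).carrier, c.2 ≤ t → c'.2 ≤ t →
      |c.1 - x| < K → |c.1 - x| = |c'.1 - x| → c = c' := by
    intro K
    set C : ℝ≥0∞ := 2 * (1 + ENNReal.ofReal lam * ENNReal.ofReal t) with hC
    -- `A N j` consists of the positions at distance between `j / (N + 1)` and `(j + 1) / (N + 1)`
    -- from `x`. Two customers at equal distance share such a set, which has probability at most `(C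
    -- / (N + 1)) ^ 2`. Summed over `K * (N + 1)` shells this is `K * C ^ 2 / (N + 1)`, which tends
    -- to zero.
    set A : ℕ → ℕ → Set ℝ := fun N j =>
      Set.Icc (x + j / (N + 1)) (x + (j + 1) / (N + 1)) ∪
        Set.Icc (x - (j + 1) / (N + 1)) (x - j / (N + 1)) with hA
    have hAm : ∀ N j, MeasurableSet (A N j) := fun N j => measurableSet_Icc.union measurableSet_Icc
    have hvol : ∀ N j, volume (A N j) ≤ 2 * (((N + 1 : ℕ) : ℝ≥0∞))⁻¹ := by
      intro N j
      refine (measure_union_le _ _).trans ?_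
      rw [Real.volume_Icc, Real.volume_Icc, two_mul]
      have e : ENNReal.ofReal (1 / (N + 1 : ℝ)) = ((N + 1 : ℕ) : ℝ≥0∞)⁻¹ := by
        rw [one_div, ENNReal.ofReal_inv_of_pos (by positivity)]
        congr 1
        rw [← ENNReal.ofReal_natCast]; push_cast; rfl
      refine (add_le_add (le_of_eq ?_) (le_of_eq ?_)) <;> rw [← e] <;> congr 1 <;> field_simp <;> ring
    have hint : ∀ N j, intensity lam (A N j ×ˢ Set.Iic t) ≤ C * ((N + 1 : ℕ) : ℝ≥0∞)⁻¹ := by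
      intro N j
      refine (intensity_prod_Iic_le lam (hAm N j) t).trans ?_
      calc _ ≤ 2 * (((N + 1 : ℕ) : ℝ≥0∞))⁻¹ * (1 + ENNReal.ofReal lam * ENNReal.ofReal t) := by
            gcongr; exact hvol N j
        _ = _ := by rw [hC]; ring
    have hCf : C ≠ ∞ := by rw [hC]; finiteness
    set bad : Set Ω := {ω | ∃ c ∈ (η ω).carrier, ∃ c' ∈ (η ω).carrier, c.2 ≤ t ∧ c'.2 ≤ t ∧
      |c.1 - x| < K ∧ |c.1 - x| = |c'.1 - x| ∧ c ≠ c'} with hbad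
    have hsub : ∀ N : ℕ, bad ⊆ ⋃ j ∈ Finset.range (K * (N + 1)),
        {ω | ((2 : ℕ) : ℕ∞) ≤ count (fun ω => (η ω).carrier) (A N j ×ˢ Set.Iic t) ω} := by
      rintro N ω ⟨c, hc, c', hc', h1, h2, h3, h4, h5⟩
      have hN : (0 : ℝ) < N + 1 := by positivity
      set j := ⌊|c.1 - x| * (N + 1)⌋₊ with hj
      have hj1 : (j : ℝ) ≤ |c.1 - x| * (N + 1) := Nat.floor_le (by positivity)
      have hj2 : |c.1 - x| * (N + 1) < j + 1 := Nat.lt_floor_add_one _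
      have hmem : ∀ d : ℝ × ℝ, |d.1 - x| = |c.1 - x| → d.1 ∈ A N j := by
        intro d hd
        rw [← hd] at hj1 hj2
        have g1 : (j : ℝ) / (N + 1) ≤ |d.1 - x| := by rwa [div_le_iff₀ hN]
        have g2 : |d.1 - x| ≤ (j + 1) / (N + 1) := by rw [le_div_iff₀ hN]; exact hj2.le
        rcases le_total 0 (d.1 - x) with h | h
        · rw [abs_of_nonneg h] at g1 g2
          exact Or.inl ⟨by linarith, by linarith⟩
        · rw [abs_of_nonpos h] at g1 g2
          exact Or.inr ⟨by linarith, by linarith⟩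
      simp only [Set.mem_iUnion, Finset.mem_range, exists_prop, Set.mem_ofPred_eq]
      refine ⟨j, ?_, ?_⟩
      · have : (j : ℝ) < K * (N + 1) := hj1.trans_lt (by gcongr)
        exact_mod_cast this
      · rw [count, Nat.cast_ofNat, ← Set.encard_pair h5]
        refine Set.encard_mono ?_
        rintro d (rfl | rfl)
        · exact ⟨hc, hmem _ rfl, h1⟩
        · exact ⟨hc', hmem _ h4.symm, h2⟩
    have hle : ∀ N : ℕ, μ bad ≤ K * C ^ 2 * ((N + 1 : ℕ) : ℝ≥0∞)⁻¹ := by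
      intro N
      refine (measure_mono (hsub N)).trans ((measure_biUnion_finset_le _ _).trans ?_)
      have hone : ∀ j ∈ Finset.range (K * (N + 1)),
          μ {ω | ((2 : ℕ) : ℕ∞) ≤ count (fun ω => (η ω).carrier) (A N j ×ˢ Set.Iic t) ω} ≤
            (C * ((N + 1 : ℕ) : ℝ≥0∞)⁻¹) ^ 2 := by
        intro j _
        have hf : intensity lam (A N j ×ˢ Set.Iic t) ≠ ∞ :=
          ne_top_of_le_ne_top (by finiteness) (hint N j)
        refine (h.poisson.measure_le_count_le_pow ((hAm N j).prod measurableSet_Iic) hf 2).trans ?_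
        gcongr
        exact hint N j
      refine (Finset.sum_le_sum hone).trans ?_
      rw [Finset.sum_const, Finset.card_range, nsmul_eq_mul, mul_pow]
      have hN1 : ((N + 1 : ℕ) : ℝ≥0∞) * ((N + 1 : ℕ) : ℝ≥0∞)⁻¹ = 1 :=
        ENNReal.mul_inv_cancel (by positivity) (by finiteness)
      rw [Nat.cast_mul]
      calc _ = (K : ℝ≥0∞) * C ^ 2 * ((N + 1 : ℕ) : ℝ≥0∞)⁻¹ *
            (((N + 1 : ℕ) : ℝ≥0∞) * ((N + 1 : ℕ) : ℝ≥0∞)⁻¹) := by ring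
        _ ≤ _ := by rw [hN1, mul_one]
    have hzero : μ bad = 0 := by
      have hlim : Tendsto (fun N : ℕ => K * C ^ 2 * ((N + 1 : ℕ) : ℝ≥0∞)⁻¹) atTop
          (𝓝 (K * C ^ 2 * 0)) := by
        refine ENNReal.Tendsto.const_mul ?_ (Or.inr (by finiteness))
        exact ENNReal.tendsto_inv_nat_nhds_zero.comp (tendsto_add_atTop_nat 1)
      rw [mul_zero] at hlim
      exact le_antisymm (ge_of_tendsto' hlim hle) bot_le
    refine measure_mono_null (fun ω hω => ?_) hzero
    by_contra hb
    refine hω fun c hc c' hc' h1 h2 h3 h4 => ?_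
    by_contra h5
    exact hb ⟨c, hc, c', hc', h1, h2, h3, h4, h5⟩
  filter_upwards [ae_all_iff.2 hK] with ω hω c hc c' hc' h1 h2 h3
  obtain ⟨K, hK⟩ := exists_nat_gt |c.1 - x|
  exact hω K c hc c' hc' h1 h2 hK h3

omit [IsProbabilityMeasure μ] in
/-- There are almost surely initial customers arbitrarily far to the right. -/
lemma ae_exists_initial_gt (h : IsInput μ lam η T) (r : ℝ) :
    ∀ᵐ ω ∂μ, ∃ c ∈ (η ω).carrier, c.2 = 0 ∧ r < c.1 := by
  set B : ℕ → Set (ℝ × ℝ) := fun N => Set.Ioc r (r + N) ×ˢ {0} with hB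
  have hBm : ∀ N, MeasurableSet (B N) := fun N => measurableSet_Ioc.prod (measurableSet_singleton 0)
  have hBi : ∀ N, intensity lam (B N) = N := by
    intro N
    rw [intensity_apply lam (hBm N)]
    have h1 : {x : ℝ | (x, (0 : ℝ)) ∈ B N} = Set.Ioc r (r + N) := by ext x; simp [hB]
    have h2 : B N ∩ (Set.univ ×ˢ Set.Ioi 0) = ∅ := by
      ext c
      simp only [hB, Set.mem_inter_iff, Set.mem_prod, Set.mem_singleton_iff, Set.mem_univ,
        Set.mem_Ioi, Set.mem_empty_iff_false, iff_false]
      rintro ⟨⟨_, h1⟩, _, h2⟩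
      exact h2.ne' h1
    rw [h1, h2, Real.volume_Ioc]
    simp
  set bad : Set Ω := {ω | ¬ ∃ c ∈ (η ω).carrier, c.2 = 0 ∧ r < c.1} with hbad
  have hle : ∀ N : ℕ, μ bad ≤ ENNReal.ofReal (Real.exp (-N)) := by
    intro N
    have := h.poisson.measure_count_eq_zero (hBm N) (by rw [hBi]; finiteness)
    rw [hBi] at this
    refine (measure_mono fun ω hω => ?_).trans_eq (by simpa using this)
    simp only [Set.mem_ofPred_eq, count]
    rw [Set.encard_eq_zero]
    by_contra hne
    obtain ⟨c, hc1, hc2⟩ := Set.nonempty_iff_ne_empty.2 hne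
    exact hω ⟨c, hc1, hc2.2, hc2.1.1⟩
  have hlim : Tendsto (fun N : ℕ => ENNReal.ofReal (Real.exp (-N))) atTop (𝓝 (ENNReal.ofReal 0)) :=
    ENNReal.tendsto_ofReal (Real.tendsto_exp_neg_atTop_nhds_zero.comp tendsto_natCast_atTop_atTop)
  rw [ENNReal.ofReal_zero] at hlim
  exact le_antisymm (ge_of_tendsto' hlim hle) bot_le

-- An initial customer beyond the bounded set `R` is a candidate, local finiteness provides a
-- minimal distance, and distances are almost surely distinct.
omit [IsProbabilityMeasure μ] in
lemma ae_exists_nearest (h : IsInput μ lam η T) (p : ℝ × ℝ) (R : Set (ℝ × ℝ)) (r : ℝ)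
    (hp : 0 ≤ p.2) (hR : ∀ c ∈ R, |c.1| ≤ r) :
    ∀ᵐ ω ∂μ, ∃ c, IsStrictNearest p ((η ω).inter Rᶜ).carrier c := by
  filter_upwards [h.ae_dist_injOn p.1 p.2, h.ae_exists_initial_gt r] with ω h1 h2
  obtain ⟨c₀, hc₀, h0, hr⟩ := h2
  have hc₀R : c₀ ∉ R := fun hc => absurd (hR c₀ hc) (not_le.2 (hr.trans_le (le_abs_self _)))
  set s := (η ω).inter Rᶜ with hs
  have hfin := s.finite_win p (|c₀.1 - p.1| + 1)
  have hmem : c₀ ∈ s.carrier ∩ win p (|c₀.1 - p.1| + 1) :=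
    ⟨⟨hc₀, hc₀R⟩, by simp, by rw [h0]; exact hp⟩
  obtain ⟨m, hm, hmin⟩ := Set.exists_min_image _ (fun c : ℝ × ℝ => |c.1 - p.1|) hfin ⟨c₀, hmem⟩
  refine ⟨m, ⟨hm.1, hm.2.2⟩, fun c hc hct hne => ?_⟩
  have hle : |m.1 - p.1| ≤ |c.1 - p.1| := by
    by_cases hcw : |c.1 - p.1| < |c₀.1 - p.1| + 1
    · exact hmin c ⟨hc, hcw, hct⟩
    · exact hm.2.1.le.trans (not_lt.1 hcw)
  exact lt_of_le_of_ne hle fun heq => hne (h1 c hc.1 m hm.1.1 hct hm.2.2 heq.symm)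

omit [IsProbabilityMeasure μ] in
lemma measurable_service_apply (h : IsInput μ lam η T) (n : ℕ) : Measurable fun ω => T ω n :=
  (measurable_pi_apply n).comp h.measurable_service

lemma map_shift (h : IsInput μ lam η T) : μ.map (fun ω => shift (T ω)) = μ.map T := by
  have h1 := (iIndepFun_iff_map_fun_eq_infinitePi_map fun n => h.measurable_service_apply n).1
    h.service_indep
  have h2 := (iIndepFun_iff_map_fun_eq_infinitePi_map (X := fun n ω => T ω (n + 1))
    fun n => h.measurable_service_apply (n + 1)).1
    (h.service_indep.precomp (add_left_injective 1))
  have h3 : (fun n => μ.map fun ω => T ω (n + 1)) = fun n => μ.map fun ω => T ω n := by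
    funext n
    rw [(h.service_identDistrib (n + 1)).map_eq, (h.service_identDistrib n).map_eq]
  rw [h3] at h2
  exact h2.trans h1.symm

omit [IsProbabilityMeasure μ] in
lemma indepFun_shift (h : IsInput μ lam η T) :
    IndepFun (fun ω => T ω 0) (fun ω => shift (T ω)) μ := by
  have h1 := indep_iSup_of_disjoint (S := {0}) (T := {n | 0 < n})
    (fun n => (h.measurable_service_apply n).comap_le) h.service_indep
    (Set.disjoint_left.2 fun n h1 h2 => by simp_all)
  rw [IndepFun_iff_Indep]
  refine indep_of_indep_of_le_left (indep_of_indep_of_le_right h1 ?_) ?_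
  · refine Measurable.comap_le (@measurable_pi_lambda _ _ _ (_) _ _ fun n => ?_)
    exact (comap_measurable fun ω => T ω (n + 1)).mono
      (le_iSup₂_of_le (n + 1) (Nat.succ_pos n) le_rfl) le_rfl
  · exact le_iSup₂_of_le 0 rfl le_rfl

/-- Three independences are combined by `indep_sup_sup`: of the Poisson process inside and outside a
region, of the first and the later services, and of customers and services. -/
lemma isFresh (h : IsInput μ lam η T) : IsFresh μ η T where
  measurable_conf := h.measurable_conf
  measurable_service := h.measurable_service
  nonneg := h.nonneg
  indep B hB := by
    have hm1 : Measurable fun ω => (η ω).inter B :=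
      (Conf.measurable_inter_const _ hB).comp h.measurable_conf
    have hm2 : Measurable fun ω => (η ω).inter Bᶜ :=
      (Conf.measurable_inter_const _ hB.compl).comp h.measurable_conf
    have hle : ∀ B, MeasurableSet B → MeasurableSpace.comap (fun ω => (η ω).inter B) inferInstance
        ≤ MeasurableSpace.comap η inferInstance := fun B hB =>
      Measurable.comap_le ((Conf.measurable_inter_const _ hB).comp (comap_measurable η))
    have hab : IndepFun (fun ω => (η ω).inter B) (fun ω => (η ω).inter Bᶜ) μ := by
      have h1 := h.poisson.indepFun_compl hB
      rw [IndepFun_iff_Indep] at h1 ⊢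
      have hcoord : ∀ C : Set (ℝ × ℝ), MeasurableSpace.comap (fun ω => (η ω).inter C)
          inferInstance ≤ MeasurableSpace.comap (fun ω (A : {A : Set (ℝ × ℝ) // MeasurableSet A}) =>
            count (fun ω => (η ω).carrier) (A.1 ∩ C) ω) inferInstance := by
        intro C
        refine Measurable.comap_le ((@Conf.measurable_iff _ (_) _).2 fun k A hA => ?_)
        have h2 := (measurable_pi_apply (⟨A ∩ box k, hA.inter (measurableSet_box k)⟩ :
          {A : Set (ℝ × ℝ) // MeasurableSet A})).comp (comap_measurable fun ω
            (A : {A : Set (ℝ × ℝ) // MeasurableSet A}) =>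
              count (fun ω => (η ω).carrier) (A.1 ∩ C) ω)
        convert h2 using 2 with ω
        rw [Conf.cnt_inter, Set.inter_comm C]
        rfl
      exact indep_of_indep_of_le_left (indep_of_indep_of_le_right h1 (hcoord Bᶜ)) (hcoord B)
    have hfin := indep_sup_sup hm1.comap_le hm2.comap_le
      (h.measurable_service_apply 0).comap_le
      (measurable_shift.comp h.measurable_service).comap_le hab h.indepFun_shift ?_
    · rw [IndepFun_iff_Indep]
      rwa [← MeasurableSpace.comap_prodMk, ← MeasurableSpace.comap_prodMk] at hfin
    · have h2 := h.indep
      rw [IndepFun_iff_Indep] at h2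
      refine indep_of_indep_of_le_left (indep_of_indep_of_le_right h2 (sup_le ?_ ?_))
        (sup_le (hle _ hB) (hle _ hB.compl))
      · exact Measurable.comap_le ((measurable_pi_apply 0).comp (comap_measurable T))
      · exact Measurable.comap_le (measurable_shift.comp (comap_measurable T))
  map_shift B hB := by
    have hm1 : Measurable fun ω => (η ω).inter B :=
      (Conf.measurable_inter_const _ hB).comp h.measurable_conf
    have h1 : IndepFun (fun ω => (η ω).inter B) T μ :=
      h.indep.comp (Conf.measurable_inter_const _ hB) measurable_id
    have h2 : IndepFun (fun ω => (η ω).inter B) (fun ω => shift (T ω)) μ :=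
      h1.comp measurable_id measurable_shift
    rw [(indepFun_iff_map_prod_eq_prod_map_map hm1.aemeasurable
      h.measurable_service.aemeasurable).1 h1, (indepFun_iff_map_prod_eq_prod_map_map
      hm1.aemeasurable
      (show Measurable fun ω => shift (T ω) from
        measurable_shift.comp h.measurable_service).aemeasurable).1 h2, h.map_shift]
  exists_nearest p R r hp hR := h.ae_exists_nearest p R r hp hR

end IsInput
end

/-! ### Construction of the input from the model -/

section
variable {Ω : Type*} [mΩ : MeasurableSpace Ω] {μ : Measure Ω} {lam : ℝ}
  {ξ₀ : Ω → Set ℝ} {ξ : Ω → Set (ℝ × ℝ)} {T : ℕ → Ω → ℝ}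

/-- The number of customers in `B`. -/
def superCount (ξ₀ : Ω → Set ℝ) (ξ : Ω → Set (ℝ × ℝ)) (B : Set (ℝ × ℝ)) (ω : Ω) : ℕ∞ :=
  count ξ₀ ((fun x : ℝ => (x, (0 : ℝ))) ⁻¹' B) ω + count ξ (B ∩ (Set.univ ×ˢ Set.Ioi 0)) ω

-- Later arrivals are restricted to positive times so that they are disjoint from the initial
-- customers; almost surely nothing is lost, by `ae_no_early_arrival`.
omit mΩ in
lemma encard_superposition (ξ₀ : Ω → Set ℝ) (ξ : Ω → Set (ℝ × ℝ)) (B : Set (ℝ × ℝ)) (ω : Ω) :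
    (customers (ξ₀ ω) (ξ ω ∩ (Set.univ ×ˢ Set.Ioi 0)) ∩ B).encard = superCount ξ₀ ξ B ω := by
  have hinj : Function.Injective fun x : ℝ => (x, (0 : ℝ)) := fun x y h => congrArg Prod.fst h
  rw [customers, Set.union_inter_distrib_right, Set.encard_union_eq, superCount, count, count,
    ← hinj.injOn.encard_image]
  · congr 2
    · ext c
      constructor
      · rintro ⟨⟨x, hx, rfl⟩, hB⟩; exact ⟨x, ⟨hx, hB⟩, rfl⟩
      · rintro ⟨x, ⟨hx, hB⟩, rfl⟩; exact ⟨⟨x, hx, rfl⟩, hB⟩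
    · ext c; simp only [Set.mem_inter_iff]; tauto
  · refine Set.disjoint_left.2 ?_
    rintro _ ⟨⟨x, _, rfl⟩, _⟩ ⟨⟨_, _, h⟩, _⟩
    exact lt_irrefl (0 : ℝ) h

/-- Local finiteness of the model. -/
def IsLocallyFinite (ξ₀ : Ω → Set ℝ) (ξ : Ω → Set (ℝ × ℝ)) (ω : Ω) : Prop :=
  ∀ k, superCount ξ₀ ξ (box k) ω < ⊤

open Classical in
/-- The configuration of customers, empty if it is not locally finite. -/
def modelConf (ξ₀ : Ω → Set ℝ) (ξ : Ω → Set (ℝ × ℝ)) (ω : Ω) : Conf :=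
  if h : IsLocallyFinite ξ₀ ξ ω then
    { carrier := customers (ξ₀ ω) (ξ ω ∩ (Set.univ ×ˢ Set.Ioi 0))
      nonneg := by
        rintro _ (⟨x, _, rfl⟩ | ⟨_, _, hc⟩)
        · exact le_rfl
        · exact le_of_lt hc
      finite := fun k => by
        rw [← Set.encard_lt_top_iff, encard_superposition]
        exact h k }
  else ⟨∅, by simp, by simp⟩

open Classical in
omit mΩ in
lemma cnt_modelConf (ξ₀ : Ω → Set ℝ) (ξ : Ω → Set (ℝ × ℝ)) (ω : Ω) (B : Set (ℝ × ℝ)) :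
    (modelConf ξ₀ ξ ω).cnt B = if IsLocallyFinite ξ₀ ξ ω then superCount ξ₀ ξ B ω else 0 := by
  unfold modelConf
  split_ifs with h
  · exact encard_superposition ξ₀ ξ B ω
  · simp [Conf.cnt]

lemma measurable_fst_zero : Measurable fun x : ℝ => (x, (0 : ℝ)) := by fun_prop

omit mΩ in
lemma measurable_count_sigmaPoints {E : Type*} [MeasurableSpace E] (ξ : Ω → Set E) {B : Set E}
    (hB : MeasurableSet B) : Measurable[sigmaPoints ξ] (count ξ B) :=
  (comap_measurable (count ξ B)).mono (le_iSup₂_of_le B hB le_rfl) le_rfl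

omit mΩ in
lemma measurable_superCount (ξ₀ : Ω → Set ℝ) (ξ : Ω → Set (ℝ × ℝ)) {B : Set (ℝ × ℝ)}
    (hB : MeasurableSet B) : Measurable[sigmaPoints ξ₀ ⊔ sigmaPoints ξ] (superCount ξ₀ ξ B) := by
  refine @Measurable.add _ _ _ _ _ (_) _ _ ?_ ?_
  · exact (measurable_count_sigmaPoints ξ₀ (measurable_fst_zero hB)).mono le_sup_left le_rfl
  · exact (measurable_count_sigmaPoints ξ (hB.inter (MeasurableSet.univ.prod
      measurableSet_Ioi))).mono le_sup_right le_rfl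

omit mΩ in
lemma measurable_modelConf (ξ₀ : Ω → Set ℝ) (ξ : Ω → Set (ℝ × ℝ)) :
    Measurable[sigmaPoints ξ₀ ⊔ sigmaPoints ξ] (modelConf ξ₀ ξ) := by
  classical
  refine (@Conf.measurable_iff _ (_) _).2 fun k B hB => ?_
  simp_rw [cnt_modelConf]
  refine @Measurable.ite _ _ (_) (_) _ _ _ _ ?_ (measurable_superCount ξ₀ ξ
    (hB.inter (measurableSet_box k))) (@measurable_const _ _ (_) (_) _)
  have : {ω | IsLocallyFinite ξ₀ ξ ω} = ⋂ k, superCount ξ₀ ξ (box k) ⁻¹' Set.Iio ⊤ := by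
    ext ω; simp [IsLocallyFinite]
  rw [this]
  exact MeasurableSet.iInter fun k =>
    measurable_superCount ξ₀ ξ (measurableSet_box k) (MeasurableSet.of_discrete)

omit mΩ in
lemma arrivals_intensity (lam : ℝ) (B : Set (ℝ × ℝ)) (hB : MeasurableSet B) :
    (ENNReal.ofReal lam • (volume : Measure (ℝ × ℝ)).restrict (Set.univ ×ˢ Set.Ici 0))
      (B ∩ (Set.univ ×ˢ Set.Ioi 0)) =
    ENNReal.ofReal lam * volume (B ∩ (Set.univ ×ˢ Set.Ioi 0)) := by
  rw [Measure.smul_apply, smul_eq_mul, Measure.restrict_apply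
    (hB.inter (MeasurableSet.univ.prod measurableSet_Ioi)), Set.inter_assoc]
  congr 3
  ext c
  simp only [Set.mem_inter_iff, Set.mem_prod, Set.mem_univ, true_and, Set.mem_Ioi, Set.mem_Ici]
  exact ⟨fun h => h.1, fun h => ⟨h, h.le⟩⟩

namespace IsGreedyModel

variable (h : IsGreedyModel μ lam ξ₀ ξ T)
include h

lemma sigmaPoints_initial_le : sigmaPoints ξ₀ ≤ mΩ :=
  iSup₂_le fun B hB => (h.initial.measurable_count B hB).comap_le

lemma sigmaPoints_arrivals_le : sigmaPoints ξ ≤ mΩ :=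
  iSup₂_le fun B hB => (h.arrivals.measurable_count B hB).comap_le

lemma sigmaSeq_le : sigmaSeq T ≤ mΩ :=
  (measurable_pi_lambda _ h.measurable_service).comap_le

lemma indep_points : Indep (sigmaPoints ξ₀) (sigmaPoints ξ) μ :=
  h.indep.indep (i := 0) (j := 1) (by decide)

lemma indep_service : Indep (sigmaPoints ξ₀ ⊔ sigmaPoints ξ) (sigmaSeq T) μ := by
  have h1 := indep_iSup_of_disjoint (m := ![sigmaPoints ξ₀, sigmaPoints ξ, sigmaSeq T])
    (S := {0, 1}) (T := {2}) (by
      intro i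
      fin_cases i
      · exact h.sigmaPoints_initial_le
      · exact h.sigmaPoints_arrivals_le
      · exact h.sigmaSeq_le) h.indep (by simp)
  refine indep_of_indep_of_le_left (indep_of_indep_of_le_right h1 ?_) (sup_le ?_ ?_)
  · exact le_iSup₂_of_le (2 : Fin 3) rfl le_rfl
  · exact le_iSup₂_of_le (0 : Fin 3) (by simp) le_rfl
  · exact le_iSup₂_of_le (1 : Fin 3) (by simp) le_rfl

lemma map_superCount {B : Set (ℝ × ℝ)} (hB : MeasurableSet B)
    (hf : intensity lam B ≠ ∞) : μ.map (superCount ξ₀ ξ B) =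
      (poissonMeasure (intensity lam B).toNNReal).map (Nat.cast : ℕ → ℕ∞) := by
  have hBp := hB.inter (MeasurableSet.univ.prod (measurableSet_Ioi (a := (0 : ℝ))))
  have hB0 := measurable_fst_zero hB
  have e := intensity_apply lam hB
  rw [e] at hf ⊢
  have hf1 := (ENNReal.add_ne_top.1 hf).1
  have hf2 := (ENNReal.add_ne_top.1 hf).2
  have h1 := h.initial.map_count _ hB0 hf1
  have h2 := h.arrivals.map_count _ hBp (by rwa [arrivals_intensity lam B hB])
  rw [arrivals_intensity lam B hB] at h2
  rw [ENNReal.toNNReal_add hf1 hf2]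
  have hind : IndepFun (count ξ₀ ((fun x : ℝ => (x, (0 : ℝ))) ⁻¹' B))
      (count ξ (B ∩ (Set.univ ×ˢ Set.Ioi 0))) μ := by
    rw [IndepFun_iff_Indep]
    exact indep_of_indep_of_le_left (indep_of_indep_of_le_right h.indep_points
      (le_iSup₂_of_le _ hBp le_rfl)) (le_iSup₂_of_le _ hB0 le_rfl)
  exact (hind.hasLaw_add_map_cast_poissonMeasure
    ⟨(h.initial.measurable_count _ hB0).aemeasurable, h1⟩
    ⟨(h.arrivals.measurable_count _ hBp).aemeasurable, h2⟩).map_eq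

lemma measurable_superCount' {B : Set (ℝ × ℝ)} (hB : MeasurableSet B) :
    Measurable (superCount ξ₀ ξ B) :=
  (measurable_superCount ξ₀ ξ hB).mono
    (sup_le h.sigmaPoints_initial_le h.sigmaPoints_arrivals_le) le_rfl

lemma indep_superCount (n : ℕ) (B : Fin n → Set (ℝ × ℝ))
    (hB : ∀ i, MeasurableSet (B i)) (hd : Pairwise fun i j => Disjoint (B i) (B j)) :
    iIndepFun (fun i => superCount ξ₀ ξ (B i)) μ := by
  have hBp := fun i => (hB i).inter (MeasurableSet.univ.prod (measurableSet_Ioi (a := (0 : ℝ))))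
  have hB0 := fun i => measurable_fst_zero (hB i)
  have h1 := h.initial.indep_count n _ hB0 fun i j hij => (hd hij).preimage _
  have h2 := h.arrivals.indep_count n _ hBp fun i j hij =>
    (hd hij).mono Set.inter_subset_left Set.inter_subset_left
  have h3 := iIndep_sup (fun i => (h.initial.measurable_count _ (hB0 i)).comap_le)
    (fun i => (h.arrivals.measurable_count _ (hBp i)).comap_le) h1 h2
    (indep_of_indep_of_le_left (indep_of_indep_of_le_right h.indep_points
      (iSup_le fun i => le_iSup₂_of_le _ (hBp i) le_rfl))
      (iSup_le fun i => le_iSup₂_of_le _ (hB0 i) le_rfl))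
  rw [iIndepFun_iff_iIndep]
  refine (iIndep_iff _ _).2 fun s f hf => (iIndep_iff _ _).1 h3 s fun i hi => ?_
  refine (Measurable.comap_le (@Measurable.add _ _ _ _ _ (_) _ _ ?_ ?_) :
    MeasurableSpace.comap (superCount ξ₀ ξ (B i)) inferInstance ≤ _) _ (hf i hi)
  · exact (comap_measurable _).mono le_sup_left le_rfl
  · exact (comap_measurable _).mono le_sup_right le_rfl

lemma ae_isLocallyFinite [IsProbabilityMeasure μ] : ∀ᵐ ω ∂μ, IsLocallyFinite ξ₀ ξ ω := by
  refine ae_all_iff.2 fun k => ?_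
  have h1 := Measure.map_apply (μ := μ) (h.measurable_superCount' (measurableSet_box k))
    (s := {⊤}) (MeasurableSet.of_discrete)
  rw [h.map_superCount (measurableSet_box k) (intensity_box_ne_top lam k),
    Measure.map_apply (.of_discrete) (MeasurableSet.of_discrete)] at h1
  refine measure_mono_null (t := superCount ξ₀ ξ (box k) ⁻¹' {⊤}) (fun ω hω => ?_) ?_
  · exact not_lt_top_iff.1 hω
  · have he : (Nat.cast : ℕ → ℕ∞) ⁻¹' {⊤} = ∅ := by ext n; simp
    rw [← h1, he, measure_empty]

lemma ae_no_early_arrival : ∀ᵐ ω ∂μ, ∀ c ∈ ξ ω, 0 < c.2 := by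
  have hm : MeasurableSet (Set.univ ×ˢ Set.Iic (0 : ℝ) : Set (ℝ × ℝ)) :=
    MeasurableSet.univ.prod measurableSet_Iic
  have h1 := h.arrivals.ae_count_eq_zero hm (by
    rw [Measure.smul_apply, Measure.restrict_apply hm]
    have : (Set.univ ×ˢ Set.Iic (0 : ℝ) : Set (ℝ × ℝ)) ∩ Set.univ ×ˢ Set.Ici 0 =
        Set.univ ×ˢ {0} := by
      ext c
      simp only [Set.mem_inter_iff, Set.mem_prod, Set.mem_univ, true_and, Set.mem_Iic,
        Set.mem_Ici, Set.mem_singleton_iff]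
      exact ⟨fun h => le_antisymm h.1 h.2, fun h => ⟨h.le, h.ge⟩⟩
    rw [this, Measure.volume_eq_prod, Measure.prod_prod]
    simp)
  filter_upwards [h1] with ω hω c hc
  by_contra hneg
  rw [count, Set.encard_eq_zero] at hω
  have : c ∈ ξ ω ∩ (Set.univ ×ˢ Set.Iic (0 : ℝ)) := ⟨hc, Set.mem_univ _, not_lt.1 hneg⟩
  rw [hω] at this
  exact this

/-- The model is described almost surely by an input. -/
lemma exists_isInput [IsProbabilityMeasure μ]
    (hexp : ∃ α : ℝ, 0 < α ∧ Integrable (fun ω => Real.exp (α * T 0 ω)) μ) :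
    ∃ (η : Ω → Conf) (T' : Ω → ℕ → ℝ), IsInput μ lam η T' ∧
      ∀ᵐ ω ∂μ, (η ω).carrier = customers (ξ₀ ω) (ξ ω) ∧ T' ω = fun n => T n ω := by
  classical
  -- Taking positive parts makes the services nonnegative everywhere and changes them only on a null
  -- set.
  have hmax : ∀ n, (fun ω => max (T n ω) 0) =ᵐ[μ] T n := fun n => by
    filter_upwards [h.service_nonneg n] with ω hω using max_eq_left hω
  have hle : sigmaPoints ξ₀ ⊔ sigmaPoints ξ ≤ mΩ :=
    sup_le h.sigmaPoints_initial_le h.sigmaPoints_arrivals_le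
  have hcnt : ∀ B, count (fun ω => (modelConf ξ₀ ξ ω).carrier) B =ᵐ[μ] superCount ξ₀ ξ B := by
    intro B
    filter_upwards [h.ae_isLocallyFinite] with ω hω
    exact (cnt_modelConf ξ₀ ξ ω B).trans (if_pos hω)
  have hmeas : Measurable (modelConf ξ₀ ξ) := (measurable_modelConf ξ₀ ξ).mono hle le_rfl
  refine ⟨modelConf ξ₀ ξ, fun ω n => max (T n ω) 0, ⟨hmeas, ⟨?_, ?_, ?_⟩, ?_, ?_, ?_, ?_, ?_, ?_, ?_⟩,
    ?_⟩
  · intro B hB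
    exact Conf.measurable_cnt hmeas (Q := Prod.snd ⁻¹' B) (measurable_snd hB)
  · intro B hB hf
    rw [Measure.map_congr (hcnt B), h.map_superCount hB hf]
  · intro n B hB hd
    exact (h.indep_superCount n B hB hd).congr fun i => (hcnt (B i)).symm
  · exact measurable_pi_lambda _ fun n => (h.measurable_service n).max measurable_const
  · exact fun ω n => le_max_right _ _
  · exact h.service_indep.congr fun n => (hmax n).symm
  · intro n
    have := (h.service_identDistrib n).comp (u := fun x : ℝ => max x 0) (by fun_prop)
    exact this
  · rw [integral_congr_ae (hmax 0), h.service_mean]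
  · obtain ⟨α, hα, hint⟩ := hexp
    refine ⟨α, hα, hint.congr ?_⟩
    filter_upwards [hmax 0] with ω hω
    exact congrArg (fun x => Real.exp (α * x)) hω.symm
  · rw [IndepFun_iff_Indep]
    refine indep_of_indep_of_le_left (indep_of_indep_of_le_right h.indep_service ?_)
      (Measurable.comap_le (measurable_modelConf ξ₀ ξ))
    refine Measurable.comap_le (@measurable_pi_lambda _ _ _ (_) _ _ fun n => ?_)
    have hc : Measurable fun a : ℕ → ℝ => max (a n) 0 :=
      (measurable_pi_apply n).max measurable_const
    exact hc.comp (comap_measurable fun ω n => T n ω)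
  · filter_upwards [h.ae_isLocallyFinite, h.ae_no_early_arrival, ae_all_iff.2 hmax]
      with ω h1 h2 h3
    refine ⟨?_, funext h3⟩
    have : ξ ω ∩ (Set.univ ×ˢ Set.Ioi 0) = ξ ω :=
      Set.inter_eq_left.2 fun c hc => ⟨Set.mem_univ _, h2 c hc⟩
    rw [modelConf, dif_pos h1]
    change customers (ξ₀ ω) (ξ ω ∩ (Set.univ ×ˢ Set.Ioi 0)) = _
    rw [this]

end IsGreedyModel
end

/-! ### Geometry of the explored region -/

/-- A discrete intermediate value principle. Applied to the side of a given point on which the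
server is, it finds the step that crosses this point and thereby explores it. -/
lemma exists_last_step {P : ℕ → Prop} {j n : ℕ} (hjn : j ≤ n) (hj : P j) (hn : ¬ P n) :
    ∃ i, j ≤ i ∧ i < n ∧ P i ∧ ¬ P (i + 1) := by
  induction n, hjn using Nat.le_induction with
  | base => exact absurd hj hn
  | succ n hjn ih =>
    by_cases h : P n
    · exact ⟨n, hjn, Nat.lt_succ_self n, h, hn⟩
    · obtain ⟨i, h1, h2, h3⟩ := ih h
      exact ⟨i, h1, h2.trans (Nat.lt_succ_self n), h3⟩

lemma mem_exploredBy {n : ℕ} {h : ℕ → ℝ × ℝ} {c : ℝ × ℝ} :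
    c ∈ exploredBy n h ↔ ∃ k < n, c ∈ explored (h k) (h (k + 1)).1 := by
  simp [exploredBy]

lemma IsAdmissible.exploredBy_time_le {n : ℕ} {h : ℕ → ℝ × ℝ} (hh : IsAdmissible n h) {c : ℝ × ℝ}
    (hc : c ∈ exploredBy n h) : c.2 ≤ (h n).2 := by
  obtain ⟨k, hk, hc⟩ := mem_exploredBy.1 hc
  exact hc.2.trans (hh.time_mono hk.le le_rfl)

/-- To the right of the server, the explored region is closed under moves towards the server and
back in time. -/
lemma IsAdmissible.exploredBy_of_le {n : ℕ} {h : ℕ → ℝ × ℝ} (hh : IsAdmissible n h)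
    {c c' : ℝ × ℝ} (hc' : c' ∈ exploredBy n h) (h1 : (h n).1 ≤ c.1) (h2 : c.1 ≤ c'.1)
    (hs : c.2 ≤ c'.2) : c ∈ exploredBy n h := by
  obtain ⟨j, hj, hcj⟩ := mem_exploredBy.1 hc'
  rcases le_or_gt (h j).1 c.1 with hle | hlt
  · refine mem_exploredBy.2 ⟨j, hj, ?_, hs.trans hcj.2⟩
    refine le_trans ?_ hcj.1
    rw [abs_of_nonneg (by linarith), abs_of_nonneg (by linarith)]
    linarith
  -- If the server was to the right of `c` at step `j`, a later step crossed `c`, and that step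
  -- explored it, being taken no earlier.
  · obtain ⟨i, hi1, hi2, hi3, hi4⟩ := exists_last_step (P := fun i => c.1 < (h i).1) hj.le hlt
      (not_lt.2 h1)
    refine mem_exploredBy.2 ⟨i, hi2, ?_, hs.trans (hcj.2.trans (hh.time_mono hi1 hi2.le))⟩
    rw [abs_of_neg (by linarith), abs_of_nonpos (by linarith [not_lt.1 hi4])]
    linarith [not_lt.1 hi4]

/-- The history `h` extended by the service of `c` of duration `τ`. -/
def serve (v : ℝ≥0∞) (n : ℕ) (h : ℕ → ℝ × ℝ) (c : ℝ × ℝ) (τ : ℝ) : ℕ → ℝ × ℝ :=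
  Function.update h (n + 1) (c.1, (h n).2 + travelTime v (h n).1 c.1 + τ)

lemma serve_of_le (v : ℝ≥0∞) {n : ℕ} (h : ℕ → ℝ × ℝ) (c : ℝ × ℝ) (τ : ℝ) {k : ℕ} (hk : k ≤ n) :
    serve v n h c τ k = h k := Function.update_of_ne (by omega) _ _

lemma serve_succ (v : ℝ≥0∞) (n : ℕ) (h : ℕ → ℝ × ℝ) (c : ℝ × ℝ) (τ : ℝ) :
    serve v n h c τ (n + 1) = (c.1, (h n).2 + travelTime v (h n).1 c.1 + τ) :=
  Function.update_self _ _ _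

lemma exploredBy_serve (v : ℝ≥0∞) (n : ℕ) (h : ℕ → ℝ × ℝ) (c : ℝ × ℝ) (τ : ℝ) :
    exploredBy (n + 1) (serve v n h c τ) = exploredBy n h ∪ explored (h n) c.1 := by
  ext d
  rw [Set.mem_union, mem_exploredBy, mem_exploredBy]
  constructor
  · rintro ⟨k, hk, hd⟩
    rcases Nat.lt_succ_iff_lt_or_eq.1 hk with hk' | rfl
    · rw [serve_of_le v h c τ hk'.le, serve_of_le v h c τ (by omega)] at hd
      exact Or.inl ⟨k, hk', hd⟩
    · rw [serve_of_le v h c τ le_rfl, serve_succ] at hd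
      exact Or.inr hd
  · rintro (⟨k, hk, hd⟩ | hd)
    · refine ⟨k, by omega, ?_⟩
      rwa [serve_of_le v h c τ hk.le, serve_of_le v h c τ (by omega)]
    · refine ⟨n, by omega, ?_⟩
      rwa [serve_of_le v h c τ le_rfl, serve_succ]

lemma IsAdmissible.serve {v : ℝ≥0∞} {n : ℕ} {h : ℕ → ℝ × ℝ} (hh : IsAdmissible n h) (c : ℝ × ℝ)
    {τ : ℝ} (hτ : 0 ≤ τ) : IsAdmissible (n + 1) (serve v n h c τ) := by
  refine ⟨by rw [serve_of_le v h c τ (Nat.zero_le _)]; exact hh.1, fun k hk => ?_⟩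
  rcases Nat.lt_succ_iff_lt_or_eq.1 hk with hk' | rfl
  · rw [serve_of_le v h c τ hk'.le, serve_of_le v h c τ (by omega)]
    exact hh.2 k hk'
  · rw [serve_of_le v h c τ le_rfl, serve_succ]
    have := travelTime_nonneg v (h k).1 c.1
    simp only
    linarith

lemma IsStrictNearest.extend_eq {v : ℝ≥0∞} {n : ℕ} {h : ℕ → ℝ × ℝ} {s : Set (ℝ × ℝ)} {c : ℝ × ℝ}
    (hc : IsStrictNearest (h n) s c) (τ : ℝ) : extend v n h s τ = serve v n h c τ := by
  rw [extend, serve, advance, if_pos ⟨c, hc⟩, hc.nearest_eq]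

lemma IsStrictNearest.abs_le {p : ℝ × ℝ} {s : Set (ℝ × ℝ)} {c d : ℝ × ℝ}
    (hc : IsStrictNearest p s c) (hd : d ∈ s) (hdt : d.2 ≤ p.2) : |c.1 - p.1| ≤ |d.1 - p.1| := by
  by_cases h : d = c
  · rw [h]
  · exact (hc.2 d hd hdt h).le

/-- The past times at which the points slightly to the right of `e` are unexplored. -/
def freshTimes (n : ℕ) (h : ℕ → ℝ × ℝ) (e : ℝ) : Set ℝ :=
  {s | s ∈ Set.Ioc 0 (h n).2 ∧ ∀ k : ℕ, (e + 1 / ((k : ℝ) + 1), s) ∉ exploredBy n h}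

lemma measurableSet_freshTimes (n : ℕ) (h : ℕ → ℝ × ℝ) (e : ℝ) :
    MeasurableSet (freshTimes n h e) := by
  have : freshTimes n h e = Set.Ioc 0 (h n).2 ∩
      ⋂ k : ℕ, (fun s : ℝ => (e + 1 / ((k : ℝ) + 1), s)) ⁻¹' (exploredBy n h)ᶜ := by
    ext s; simp [freshTimes]
  rw [this]
  exact measurableSet_Ioc.inter (MeasurableSet.iInter fun k =>
    measurable_prodMk_left (measurableSet_exploredBy_const n h).compl)

/-- Exploration spreads towards the server, so an explored point beyond `e` would make some `e + 1 /
(k + 1)` explored at the same time. -/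
lemma IsAdmissible.notMem_of_freshTimes {n : ℕ} {h : ℕ → ℝ × ℝ} (hh : IsAdmissible n h) {e s z : ℝ}
    (he : (h n).1 ≤ e) (hs : s ∈ freshTimes n h e) (hz : e < z) : (z, s) ∉ exploredBy n h := by
  intro hmem
  obtain ⟨k, hk⟩ := exists_nat_one_div_lt (sub_pos.2 hz)
  have hk0 : (0 : ℝ) < 1 / ((k : ℝ) + 1) := by positivity
  exact hs.2 k (hh.exploredBy_of_le hmem (by simp only; linarith) (by simp only; linarith) le_rfl)

/-- The density of the unexplored customers slightly to the right of `e`. -/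
def density (lam : ℝ) (n : ℕ) (h : ℕ → ℝ × ℝ) (e : ℝ) : ℝ :=
  lam * (volume (freshTimes n h e)).toReal

lemma volume_freshTimes_ne_top (n : ℕ) (h : ℕ → ℝ × ℝ) (e : ℝ) :
    volume (freshTimes n h e) ≠ ∞ :=
  ne_top_of_le_ne_top (by simp) (measure_mono (t := Set.Ioc 0 (h n).2) fun _ hs => hs.1)

/-- The density grows with time and to the right, as long as one stays out of the newly explored
region. -/
lemma density_serve_ge {lam : ℝ} (hlam : 0 ≤ lam) {v : ℝ≥0∞} {n : ℕ} {h : ℕ → ℝ × ℝ}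
    (hh : IsAdmissible n h) {c : ℝ × ℝ} {τ e e' : ℝ} (hτ : 0 ≤ τ) (he : (h n).1 ≤ e)
    (hee : e ≤ e') (hr : (h n).1 + |c.1 - (h n).1| ≤ e') :
    density lam n h e + lam * ((serve v n h c τ (n + 1)).2 - (h n).2) ≤
      density lam (n + 1) (serve v n h c τ) e' := by
  set t' := (serve v n h c τ (n + 1)).2 with ht'
  have htt : (h n).2 ≤ t' := by
    have := (hh.serve (v := v) c hτ).2 n (Nat.lt_succ_self n)
    rwa [serve_of_le v h c τ le_rfl] at this
  -- The step explores nothing beyond `e'`, so the old fresh times remain fresh there, and all times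
  -- elapsed during the step are added.
  have hsub : freshTimes n h e ∪ Set.Ioc (h n).2 t' ⊆ freshTimes (n + 1) (serve v n h c τ) e' := by
    have hpos : ∀ k : ℕ, (0 : ℝ) < 1 / ((k : ℝ) + 1) := fun k => by positivity
    have hnot : ∀ (k : ℕ) (s : ℝ), (e' + 1 / ((k : ℝ) + 1), s) ∉ explored (h n) c.1 := by
      intro k s hmem
      have h1 : |e' + 1 / ((k : ℝ) + 1) - (h n).1| ≤ |c.1 - (h n).1| := hmem.1
      have := (le_abs_self _).trans h1
      linarith [hpos k]
    rintro s (hs | hs)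
    · refine ⟨⟨hs.1.1, hs.1.2.trans htt⟩, fun k => ?_⟩
      rw [exploredBy_serve]
      rintro (hmem | hmem)
      · exact hh.notMem_of_freshTimes he hs (by linarith [hpos k]) hmem
      · exact hnot k s hmem
    · refine ⟨⟨(hh.time_nonneg le_rfl).trans_lt hs.1, hs.2⟩, fun k => ?_⟩
      rw [exploredBy_serve]
      rintro (hmem | hmem)
      · exact absurd (hh.exploredBy_time_le hmem) (not_le.2 hs.1)
      · exact hnot k s hmem
  have hdisj : Disjoint (freshTimes n h e) (Set.Ioc (h n).2 t') :=
    Set.disjoint_left.2 fun s h1 h2 => absurd h1.1.2 (not_le.2 h2.1)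
  have hm := measure_mono (μ := volume) hsub
  rw [measure_union hdisj measurableSet_Ioc, Real.volume_Ioc] at hm
  have hm' := ENNReal.toReal_mono (volume_freshTimes_ne_top _ _ _) hm
  rw [ENNReal.toReal_add (volume_freshTimes_ne_top _ _ _) (by simp),
    ENNReal.toReal_ofReal (by linarith)] at hm'
  unfold density
  nlinarith

/-- The unexplored past customers with positions in `I`. -/
def unexplored (n : ℕ) (h : ℕ → ℝ × ℝ) (I : Set ℝ) : Set (ℝ × ℝ) :=
  (I ×ˢ Set.Icc 0 (h n).2) \ exploredBy n h

lemma measurableSet_unexplored (n : ℕ) (h : ℕ → ℝ × ℝ) {I : Set ℝ} (hI : MeasurableSet I) :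
    MeasurableSet (unexplored n h I) :=
  (hI.prod measurableSet_Icc).diff (measurableSet_exploredBy_const n h)

lemma intensity_prod_le (lam : ℝ) {I S : Set ℝ} (hI : MeasurableSet I) (hS : MeasurableSet S) :
    intensity lam (I ×ˢ S) ≤ volume I * (1 + ENNReal.ofReal lam * volume S) := by
  rw [intensity_apply lam (hI.prod hS), mul_add, mul_one]
  refine add_le_add (measure_mono fun x hx => hx.1) ?_
  calc ENNReal.ofReal lam * volume ((I ×ˢ S) ∩ (Set.univ ×ˢ Set.Ioi 0))
      ≤ ENNReal.ofReal lam * volume (I ×ˢ S) := by gcongr; exact Set.inter_subset_left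
    _ = _ := by rw [Measure.volume_eq_prod, Measure.prod_prod]; ring

lemma intensity_prod_ge (lam : ℝ) {I S : Set ℝ} (hI : MeasurableSet I) (hS : MeasurableSet S)
    (hpos : ∀ s ∈ S, 0 < s) :
    ENNReal.ofReal lam * (volume I * volume S) ≤ intensity lam (I ×ˢ S) := by
  rw [intensity_apply lam (hI.prod hS)]
  refine le_trans (le_of_eq ?_) le_add_self
  have hsub : (I ×ˢ S) ∩ (Set.univ ×ˢ Set.Ioi 0) = I ×ˢ S :=
    Set.inter_eq_left.2 fun c hc => ⟨Set.mem_univ _, hpos _ hc.2⟩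
  rw [hsub, Measure.volume_eq_prod, Measure.prod_prod]

/-- The mass of the unexplored customers in an interval to the right of the server is at most its
length times the density at its right end. -/
lemma intensity_unexplored_le {lam : ℝ} (hlam : 0 ≤ lam) {n : ℕ} {h : ℕ → ℝ × ℝ}
    (hh : IsAdmissible n h) {e z : ℝ} (he : (h n).1 ≤ e) (hez : e ≤ z) :
    intensity lam (unexplored n h (Set.Ioo e z)) ≤
      ENNReal.ofReal ((z - e) * (1 + density lam n h z)) := by
  -- If a point to the left of `z` is unexplored, then so are the points beyond `z` at the same
  -- time. Time `0` is treated apart: it carries the initial customers, whence the summand `1`.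
  have hsub : unexplored n h (Set.Ioo e z) ⊆ Set.Ioo e z ×ˢ (freshTimes n h z ∪ {0}) := by
    rintro ⟨y, s⟩ ⟨⟨hy, hs⟩, hnot⟩
    refine ⟨hy, ?_⟩
    rcases hs.1.eq_or_lt with h0 | h0
    · exact Or.inr h0.symm
    · refine Or.inl ⟨⟨h0, hs.2⟩, fun k hmem => hnot (hh.exploredBy_of_le hmem ?_ ?_ le_rfl)⟩
      · exact he.trans hy.1.le
      · have : (0 : ℝ) < 1 / ((k : ℝ) + 1) := by positivity
        have := hy.2
        simp only at this ⊢
        linarith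
  have hvol : volume (freshTimes n h z ∪ {0}) = volume (freshTimes n h z) := by
    refine le_antisymm ((measure_union_le _ _).trans (by simp)) (measure_mono Set.subset_union_left)
  refine (measure_mono hsub).trans ((intensity_prod_le lam measurableSet_Ioo
    ((measurableSet_freshTimes n h z).union (measurableSet_singleton 0))).trans (le_of_eq ?_))
  rw [hvol, Real.volume_Ioo, density, ENNReal.ofReal_mul (by linarith),
    ENNReal.ofReal_add zero_le_one (by positivity), ENNReal.ofReal_mul hlam,
    ENNReal.ofReal_toReal (volume_freshTimes_ne_top _ _ _), ENNReal.ofReal_one]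

/-- The mass of unexplored customers is Lipschitz, and takes all intermediate values. -/
lemma exists_intensity_unexplored_eq (lam : ℝ) (n : ℕ) (h : ℕ → ℝ × ℝ) (e : ℝ) {m ρ : ℝ}
    (hm : 0 ≤ m) (hρ : 0 ≤ ρ)
    (hle : ENNReal.ofReal m ≤ intensity lam (unexplored n h (Set.Ioo e (e + ρ)))) :
    ∃ u, 0 ≤ u ∧ u ≤ ρ ∧
      intensity lam (unexplored n h (Set.Ioo e (e + u))) = ENNReal.ofReal m := by
  -- A Lipschitz constant: the mass per unit of length is at most `1` from the initial customers
  -- plus `lam` times the elapsed time.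
  set K : ℝ := 1 + max lam 0 * max (h n).2 0 with hK
  have hbd : ∀ I : Set ℝ, MeasurableSet I → intensity lam (unexplored n h I) ≤
      volume I * ENNReal.ofReal K := by
    intro I hI
    refine (measure_mono Set.sdiff_subset).trans ((intensity_prod_le lam hI measurableSet_Icc).trans
      (le_of_eq ?_))
    rw [Real.volume_Icc, sub_zero, hK, ENNReal.ofReal_add zero_le_one (by positivity),
      ENNReal.ofReal_mul (by positivity), ENNReal.ofReal_one]
    simp [ENNReal.ofReal_max]
  have hfin : ∀ u, intensity lam (unexplored n h (Set.Ioo e (e + u))) ≠ ∞ := fun u =>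
    ne_top_of_le_ne_top (by rw [Real.volume_Ioo]; finiteness) (hbd _ measurableSet_Ioo)
  set f : ℝ → ℝ := fun u => (intensity lam (unexplored n h (Set.Ioo e (e + u)))).toReal with hf
  have hlip : ∀ u u', 0 ≤ u → u ≤ u' → f u' ≤ f u + (u' - u) * K := by
    intro u u' hu huu
    have hsub : unexplored n h (Set.Ioo e (e + u')) ⊆ unexplored n h (Set.Ioo e (e + u)) ∪
        unexplored n h (Set.Icc (e + u) (e + u')) := by
      rintro c ⟨⟨hc1, hc2⟩, hc3⟩
      rcases lt_or_ge c.1 (e + u) with h1 | h1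
      · exact Or.inl ⟨⟨⟨hc1.1, h1⟩, hc2⟩, hc3⟩
      · exact Or.inr ⟨⟨⟨h1, hc1.2.le⟩, hc2⟩, hc3⟩
    have h1 := (measure_mono hsub).trans ((measure_union_le _ _).trans
      (add_le_add le_rfl (hbd _ measurableSet_Icc)))
    rw [Real.volume_Icc, ← ENNReal.ofReal_mul (by linarith)] at h1
    have h2 := ENNReal.toReal_mono (by finiteness [hfin u]) h1
    rw [ENNReal.toReal_add (hfin u) (by finiteness), ENNReal.toReal_ofReal
      (mul_nonneg (by linarith) (by positivity))] at h2
    refine h2.trans_eq ?_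
    rw [hf]; ring
  have hmono : ∀ u u', u ≤ u' → f u ≤ f u' := fun u u' huu =>
    ENNReal.toReal_mono (hfin u') (measure_mono (Set.sdiff_subset_sdiff_left
      (Set.prod_mono (Set.Ioo_subset_Ioo_right (by linarith)) le_rfl)))
  have hcont : ContinuousOn f (Set.Icc 0 ρ) := by
    have hK0 : 0 ≤ K := by positivity
    have : LipschitzOnWith K.toNNReal f (Set.Icc 0 ρ) := by
      refine LipschitzOnWith.of_dist_le_mul fun u hu u' hu' => ?_
      rw [Real.dist_eq, Real.dist_eq, Real.coe_toNNReal _ hK0]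
      rcases le_total u u' with huu | huu
      · rw [abs_of_nonpos (by linarith [hmono u u' huu]), abs_of_nonpos (by linarith)]
        linarith [hlip u u' hu.1 huu]
      · rw [abs_of_nonneg (by linarith [hmono u' u huu]), abs_of_nonneg (by linarith)]
        linarith [hlip u' u hu'.1 huu]
    exact this.continuousOn
  have hf0 : f 0 = 0 := by simp [hf, unexplored]
  have hfρ : m ≤ f ρ := by
    have := ENNReal.toReal_mono (hfin ρ) hle
    rwa [ENNReal.toReal_ofReal hm] at this
  obtain ⟨u, hu, hfu⟩ := intermediate_value_Icc hρ hcont (show m ∈ Set.Icc (f 0) (f ρ) from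
    ⟨by rw [hf0]; exact hm, hfρ⟩)
  exact ⟨u, hu.1, hu.2, by rw [← hfu, hf, ENNReal.ofReal_toReal (hfin u)]⟩

/-! ### The frontier of a server that moves to the right -/

lemma travelTime_le_one {v : ℝ≥0∞} {x y d : ℝ} (hv : ENNReal.ofReal d ≤ v) (hy : |y - x| ≤ d) :
    travelTime v x y ≤ 1 := by
  unfold travelTime
  have h : ENNReal.ofReal |y - x| / v ≤ 1 :=
    ENNReal.div_le_of_le_mul (by rw [one_mul]; exact (ENNReal.ofReal_le_ofReal hy).trans hv)
  simpa using ENNReal.toReal_mono ENNReal.one_ne_top h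

/-- The state of a server that has been moving to the right since the step `n₀`: every position
visited is at most `e`, to the right of `e` the unexplored customers have density at least `w`, and
to the left of `e` the unexplored customers are recent. The number `i` counts the steps since the
frontier has last been pushed forward by a service, and `a` measures the time elapsed then. -/
structure Frontier (lam M ws : ℝ) (n₀ n : ℕ) (h : ℕ → ℝ × ℝ) (i : ℕ) (a w e : ℝ) : Prop where
  admissible : IsAdmissible n h
  le : n₀ + i ≤ n
  i_le : i ≤ 2
  -- The clock only moves when the frontier is pushed forward. The exponent `16` makes the zone of
  -- competitors so thin that a mishap has probability at most `1 / a ^ 6`; three in a row then cost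
  -- `1 / a ^ 18`, less than the gain of order `1 / a ^ 17`.
  clock : a ^ 16 = M ^ 16 + lam * ((h (n - i)).2 - (h n₀).2)
  M_le : M ≤ a
  ws_le : ws ≤ w
  pow_le : a ^ 16 ≤ w
  le_density : w ≤ density lam n h e
  time_le_density : M ^ 16 + lam * ((h n).2 - (h n₀).2) ≤ density lam n h e
  pos_le : ∀ j, n₀ ≤ j → j ≤ n → (h j).1 ≤ e
  -- The factor solves the recursion `g ↦ 2 * (g + 1)` with `g = 0` initially: a retry turns a gap
  -- `g * (a / w)` into at most twice the length of the step.
  gap : e - (h n).1 ≤ (2 ^ (i + 1) - 2) * (a / w)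
  -- A step lasts at most `a + 1`, and at most three steps occur per push. A push moves the frontier
  -- by at least `1 / (4 * a ^ 6 * w)` at the new density, so `12 * a ^ 6 * (distance * w)` bounds
  -- the number of steps since the frontier was at `c.1`.
  age : ∀ c ∉ exploredBy n h, (h n₀).1 - 26 * M / ws < c.1 → c.1 ≤ e →
    (h n).2 - c.2 ≤ (a + 1) * (1 + i + 12 * a ^ 6 * ((e - c.1) * w))
  elapsed : (h n).2 - (h n₀).2 ≤ (a + 1) * (1 + i + 12 * a ^ 6 * ((e - (h n₀).1) * w))

namespace Frontier
variable {lam M ws : ℝ} {n₀ n i : ℕ} {h : ℕ → ℝ × ℝ} {a w e : ℝ}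

lemma start_le (F : Frontier lam M ws n₀ n h i a w e) : n₀ ≤ n := le_trans (Nat.le_add_right _ _) F.le

lemma pos (F : Frontier lam M ws n₀ n h i a w e) : (h n).1 ≤ e := F.pos_le n F.start_le le_rfl

lemma gap_le (F : Frontier lam M ws n₀ n h i a w e) (ha : 1 ≤ a) : e - (h n).1 ≤ 6 * (a / w) := by
  have hw : 0 < w := lt_of_lt_of_le (by positivity) F.pow_le
  refine F.gap.trans (mul_le_mul_of_nonneg_right ?_ (by positivity))
  have : (2 : ℝ) ^ (i + 1) ≤ 2 ^ 3 := pow_le_pow_right₀ one_le_two (by have := F.i_le; omega)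
  linarith

/-- A short step that does not push the frontier forward by a service. -/
lemma retry (F : Frontier lam M ws n₀ n h i a w e) (hlam : 0 ≤ lam) (ha : 1 ≤ a) (hi : i ≤ 1)
    {v : ℝ≥0∞} {c : ℝ × ℝ} {τ : ℝ} (hτ : 0 ≤ τ) (hc : |c.1 - (h n).1| ≤ e - (h n).1 + a / w)
    (ht : travelTime v (h n).1 c.1 + τ ≤ a + 1) :
    ∃ e', Frontier lam M ws n₀ (n + 1) (serve v n h c τ) (i + 1) a w e' := by
  have hw : 0 < w := lt_of_lt_of_le (by positivity) F.pow_le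
  have hn := F.start_le
  have htr := travelTime_nonneg v (h n).1 c.1
  set x := (h n).1 with hx
  -- Even a step to the left explores to the right, up to the mirror image of its target, and the
  -- frontier has to move there.
  set e' := max e (x + |c.1 - x|) with he'
  have hee : e ≤ e' := le_max_left _ _
  have hc1 : c.1 ≤ x + |c.1 - x| := by linarith [le_abs_self (c.1 - x)]
  have hd := density_serve_ge hlam F.admissible (v := v) (c := c) hτ F.pos hee (le_max_right _ _)
  rw [serve_succ] at hd
  simp only at hd
  have h0 : serve v n h c τ n₀ = h n₀ := serve_of_le v h c τ hn
  have hdl : 0 ≤ lam * ((h n).2 + travelTime v x c.1 + τ - (h n).2) :=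
    mul_nonneg hlam (by linarith)
  have hpow : (2 : ℝ) ^ (i + 1 + 1) = 2 * 2 ^ (i + 1) := pow_succ' _ _
  refine ⟨e', F.admissible.serve c hτ, by have := F.le; omega, by omega, ?_, F.M_le, F.ws_le,
    F.pow_le, by linarith [F.le_density], ?_, ?_, ?_, ?_, ?_⟩
  · rw [show n + 1 - (i + 1) = n - i by omega, h0, serve_of_le v h c τ (by omega)]
    exact F.clock
  · rw [serve_succ, h0]
    have := F.time_le_density
    simp only
    nlinarith
  · intro j hj1 hj2
    rcases Nat.le_succ_iff.1 hj2 with hj | rfl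
    · rw [serve_of_le v h c τ hj]
      exact (F.pos_le j hj1 hj).trans hee
    · rw [serve_succ]
      exact hc1.trans (le_max_right _ _)
  · rw [serve_succ, hpow]
    simp only
    have hg := F.gap
    rw [← hx] at hg
    have h1 := neg_abs_le (c.1 - x)
    -- Whether the frontier stays or moves to the mirror image, it is at most two step lengths away
    -- from `c`, and a step is no longer than `e - x + a / w`.
    have h2 : e' - c.1 ≤ 2 * (e - x + a / w) := by
      rcases max_choice e (x + |c.1 - x|) with h | h
      · rw [he', h]; linarith [F.pos, div_pos (zero_lt_one.trans_le ha) hw]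
      · rw [he', h]; linarith
    calc e' - c.1 ≤ 2 * (e - x + a / w) := h2
      _ ≤ 2 * ((2 ^ (i + 1) - 2) * (a / w) + a / w) := by linarith
      _ = _ := by ring
  · intro d hd hb hde
    rw [exploredBy_serve, Set.mem_union, not_or] at hd
    rw [h0] at hb
    rw [serve_succ]
    push_cast
    have hmono : (e - d.1) * w ≤ (e' - d.1) * w := by gcongr
    have hnn : 0 ≤ (e' - d.1) * w := mul_nonneg (by linarith) hw.le
    -- An unexplored customer in the interval just explored arrived after the departure, so its age
    -- is at most the duration `a + 1` of the step. Elsewhere ages grow by at most `a + 1`.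
    by_cases hdx : |d.1 - x| ≤ |c.1 - x|
    · have : (h n).2 < d.2 := by
        by_contra! hlt
        exact hd.2 ⟨hdx, hlt⟩
      have h3 : (a + 1) * 1 ≤ (a + 1) * (1 + (i + 1) + 12 * a ^ 6 * ((e' - d.1) * w)) := by
        gcongr
        have : (0 : ℝ) ≤ i := by positivity
        have : 0 ≤ 12 * a ^ 6 * ((e' - d.1) * w) := by positivity
        linarith
      linarith
    · have hde' : d.1 ≤ e := by
        by_contra! hlt
        have h4 : d.1 ≤ x + |c.1 - x| := by
          rcases le_max_iff.1 hde with h | h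
          · linarith
          · exact h
        rw [abs_of_nonneg (by linarith [F.pos])] at hdx
        linarith
      have h5 := F.age d hd.1 hb hde'
      have h6 : (a + 1) * (1 + i + 12 * a ^ 6 * ((e - d.1) * w)) ≤
          (a + 1) * (1 + i + 12 * a ^ 6 * ((e' - d.1) * w)) := by gcongr
      linarith
  · rw [serve_succ, h0]
    push_cast
    have h5 := F.elapsed
    have h6 : (a + 1) * (1 + i + 12 * a ^ 6 * ((e - (h n₀).1) * w)) ≤
        (a + 1) * (1 + i + 12 * a ^ 6 * ((e' - (h n₀).1) * w)) := by gcongr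
    linarith

/-- A service that pushes the frontier forward. -/
lemma advance (F : Frontier lam M ws n₀ n h i a w e) (hlam : 0 ≤ lam) (ha : 1 ≤ a)
    {v : ℝ≥0∞} {c : ℝ × ℝ} {τ : ℝ} (hτ : 0 ≤ τ) (hc : e ≤ c.1)
    (hm : 1 / 4 ≤ a ^ 6 * ((c.1 - e) * density lam (n + 1) (serve v n h c τ) c.1))
    (ht : travelTime v (h n).1 c.1 + τ ≤ a + 1) :
    ∃ a' w', a ≤ a' ∧ a ^ 16 + lam * τ ≤ a' ^ 16 ∧
      Frontier lam M ws n₀ (n + 1) (serve v n h c τ) 0 a' w' c.1 := by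
  have hw : 0 < w := lt_of_lt_of_le (by positivity) F.pow_le
  have hn := F.start_le
  have htr := travelTime_nonneg v (h n).1 c.1
  have h0 : serve v n h c τ n₀ = h n₀ := serve_of_le v h c τ hn
  have hxe := F.pos
  set x := (h n).1 with hx
  set w' := density lam (n + 1) (serve v n h c τ) c.1 with hw'
  have hd := density_serve_ge hlam F.admissible (v := v) (c := c) hτ F.pos hc
    (by rw [abs_of_nonneg (by linarith)]; linarith)
  rw [serve_succ, ← hw'] at hd
  simp only at hd
  have hdl : 0 ≤ lam * ((h n).2 + travelTime v x c.1 + τ - (h n).2) :=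
    mul_nonneg hlam (by linarith)
  have hww : w ≤ w' := by linarith [F.le_density]
  have hti : (h (n - i)).2 ≤ (h n).2 := F.admissible.time_mono (Nat.sub_le _ _) le_rfl
  -- The new clock is the sixteenth root of `P`; it makes up for all the time since the last push,
  -- including retries.
  set P : ℝ := M ^ 16 + lam * ((h n).2 + travelTime v x c.1 + τ - (h n₀).2) with hP
  have haP : a ^ 16 + lam * τ ≤ P := by
    rw [F.clock, hP]
    nlinarith
  have hP0 : 0 ≤ P := le_trans (by positivity) haP
  have ha'P : (P ^ ((16 : ℕ) : ℝ)⁻¹) ^ 16 = P := Real.rpow_inv_natCast_pow hP0 (by norm_num)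
  set a' := P ^ ((16 : ℕ) : ℝ)⁻¹ with ha'
  have ha'0 : 0 ≤ a' := Real.rpow_nonneg hP0 _
  have haa : a ≤ a' := by
    refine le_of_pow_le_pow_left₀ (n := 16) (by norm_num) ha'0 ?_
    rw [ha'P]
    linarith [mul_nonneg hlam hτ]
  -- The push contributes at least `12 * (1 / 4) = 3`, which pays for the present step and at most
  -- two retries before it.
  have hkey : ∀ y ≤ e, 1 + (i : ℝ) + 12 * a ^ 6 * ((e - y) * w) + 1 ≤
      1 + 12 * a' ^ 6 * ((c.1 - y) * w') := by
    intro y hy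
    have h1 : a ^ 6 * ((e - y) * w) ≤ a' ^ 6 * ((e - y) * w') := by
      have : 0 ≤ e - y := by linarith
      gcongr
    have h2 : a ^ 6 * ((c.1 - e) * w') ≤ a' ^ 6 * ((c.1 - e) * w') := by
      have : 0 ≤ c.1 - e := by linarith
      have : 0 ≤ w' := hw.le.trans hww
      gcongr
    have h3 : (i : ℝ) ≤ 2 := by exact_mod_cast F.i_le
    nlinarith
  refine ⟨a', w', haa, by rw [ha'P]; exact haP, F.admissible.serve c hτ, by omega, by omega, ?_,
    F.M_le.trans haa, F.ws_le.trans hww, ?_, le_rfl, ?_, ?_, ?_, ?_, ?_⟩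
  · rw [ha'P, h0, Nat.sub_zero, serve_succ]
  · rw [ha'P, hP]
    have := F.time_le_density
    nlinarith
  · rw [serve_succ, h0]
    have := F.time_le_density
    simp only
    nlinarith
  · intro j hj1 hj2
    rcases Nat.le_succ_iff.1 hj2 with hj | rfl
    · rw [serve_of_le v h c τ hj]
      exact (F.pos_le j hj1 hj).trans hc
    · rw [serve_succ]
  · rw [serve_succ]
    norm_num
  · intro d hd hb hde
    rw [exploredBy_serve, Set.mem_union, not_or] at hd
    rw [h0] at hb
    rw [serve_succ]
    push_cast
    simp only [add_zero]
    have hw'0 : 0 ≤ w' := hw.le.trans hww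
    have hdc : 0 ≤ c.1 - d.1 := by linarith
    by_cases hdx : |d.1 - x| ≤ |c.1 - x|
    · have : (h n).2 < d.2 := by
        by_contra! hlt
        exact hd.2 ⟨hdx, hlt⟩
      have h3 : (a + 1) * 1 ≤ (a' + 1) * (1 + 12 * a' ^ 6 * ((c.1 - d.1) * w')) := by
        gcongr
        have : 0 ≤ 12 * a' ^ 6 * ((c.1 - d.1) * w') := by positivity
        linarith
      linarith
    · have hde' : d.1 ≤ e := by
        by_contra! hlt
        rw [abs_of_nonneg (by linarith), abs_of_nonneg (by linarith)] at hdx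
        linarith
      have h5 := F.age d hd.1 hb hde'
      have h6 : (a + 1) * (1 + (i : ℝ) + 12 * a ^ 6 * ((e - d.1) * w) + 1) ≤
          (a' + 1) * (1 + 12 * a' ^ 6 * ((c.1 - d.1) * w')) :=
        mul_le_mul (by linarith) (hkey _ hde') (by
          have : 0 ≤ e - d.1 := by linarith
          positivity) (by linarith)
      linarith
  · rw [serve_succ, h0]
    push_cast
    simp only [add_zero]
    have hse : (h n₀).1 ≤ e := F.pos_le n₀ le_rfl hn
    have h5 := F.elapsed
    have h6 : (a + 1) * (1 + (i : ℝ) + 12 * a ^ 6 * ((e - (h n₀).1) * w) + 1) ≤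
        (a' + 1) * (1 + 12 * a' ^ 6 * ((c.1 - (h n₀).1) * w')) :=
      mul_le_mul (by linarith) (hkey _ hse) (by
        have : 0 ≤ e - (h n₀).1 := by linarith
        positivity) (by linarith)
    linarith

end Frontier

/-- The paths whose distance to their maximum since step `n₀` is controlled by the elapsed time. -/
def steady (lam : ℝ) (n₀ N : ℕ) : Set (ℕ → ℝ × ℝ) :=
  {p | ∀ n ≤ N, ∀ j ≤ n, n₀ ≤ j →
    ((p j).1 - (p n).1) * √(1 + lam * ((p (n - 2)).2 - (p n₀).2)) ≤ 6}

lemma measurableSet_steady (lam : ℝ) (n₀ N : ℕ) : MeasurableSet (steady lam n₀ N) := by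
  have h1 : ∀ k, Measurable fun h : ℕ → ℝ × ℝ => (h k).1 := fun k =>
    measurable_fst.comp (measurable_pi_apply k)
  have h2 : ∀ k, Measurable fun h : ℕ → ℝ × ℝ => (h k).2 := fun k =>
    measurable_snd.comp (measurable_pi_apply k)
  have : steady lam n₀ N = ⋂ n : ℕ, ⋂ j : ℕ, {p : ℕ → ℝ × ℝ | n ≤ N → j ≤ n → n₀ ≤ j →
      ((p j).1 - (p n).1) * √(1 + lam * ((p (n - 2)).2 - (p n₀).2)) ≤ 6} := by
    ext p; simp only [steady, Set.mem_ofPred_eq, Set.mem_iInter]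
    exact forall_congr' fun n => ⟨fun h j hn => h hn j, fun h hn j => h j hn⟩
  rw [this]
  refine MeasurableSet.iInter fun n => MeasurableSet.iInter fun j => ?_
  by_cases hc : n ≤ N ∧ j ≤ n ∧ n₀ ≤ j
  · simp only [hc.1, hc.2.1, hc.2.2, forall_const]
    refine measurableSet_le (((h1 j).sub (h1 n)).mul (Measurable.sqrt ?_)) measurable_const
    exact measurable_const.add (measurable_const.mul ((h2 _).sub (h2 _)))
  · convert MeasurableSet.univ
    ext p
    simp only [Set.mem_ofPred_eq, Set.mem_univ, iff_true]
    exact fun h1 h2 h3 => absurd ⟨h1, h2, h3⟩ hc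

lemma steady_antitone (lam : ℝ) (n₀ : ℕ) : Antitone (steady lam n₀) :=
  fun _ _ h _ hp n hn => hp n (hn.trans h)

lemma steady_congr {lam : ℝ} {n₀ N : ℕ} {p q : ℕ → ℝ × ℝ} (h0 : n₀ ≤ N) (h : ∀ k ≤ N, p k = q k)
    (hp : p ∈ steady lam n₀ N) : q ∈ steady lam n₀ N := by
  intro n hn j hj hj0
  rw [← h j (hj.trans hn), ← h n hn, ← h (n - 2) (by omega), ← h n₀ h0]
  exact hp n hn j hj hj0

/-- The server is within `6 * (a / w)` of the frontier, with `w ≥ a ^ 16`, and the square root is at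
most `a ^ 8`; the product is at most `6 * a ^ 9 / a ^ 16`. The time is read two steps back because
the clock may lag by two retries. -/
lemma Frontier.mem_steady {lam M ws : ℝ} {n₀ n i : ℕ} {h : ℕ → ℝ × ℝ} {a w e : ℝ}
    (F : Frontier lam M ws n₀ n h i a w e) (hlam : 0 ≤ lam) (hM : 1 ≤ M)
    (hprev : ∀ m < n, h ∈ steady lam n₀ m) : h ∈ steady lam n₀ n := by
  intro m hm j hj hj0
  rcases hm.lt_or_eq with hlt | rfl
  · exact hprev m hlt m le_rfl j hj hj0
  have ha : 1 ≤ a := hM.trans F.M_le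
  have hw : 0 < w := lt_of_lt_of_le (by positivity) F.pow_le
  rcases le_total (h j).1 (h m).1 with hle | hle
  · exact (mul_nonpos_of_nonpos_of_nonneg (by linarith) (Real.sqrt_nonneg _)).trans (by norm_num)
  have h1 : (h j).1 - (h m).1 ≤ 6 * (a / w) := by
    linarith [F.pos_le j hj0 hj, F.gap_le ha]
  have h2 : √(1 + lam * ((h (m - 2)).2 - (h n₀).2)) ≤ a ^ 8 := by
    refine Real.sqrt_le_iff.2 ⟨by positivity, ?_⟩
    have h3 : (h (m - 2)).2 ≤ (h (m - i)).2 :=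
      F.admissible.time_mono (by have := F.i_le; omega) (Nat.sub_le _ _)
    have h4 : (1 : ℝ) ≤ M ^ 16 := one_le_pow₀ hM
    rw [← pow_mul, F.clock]
    nlinarith
  calc _ ≤ 6 * (a / w) * a ^ 8 := mul_le_mul h1 h2 (Real.sqrt_nonneg _) (by positivity)
    _ = 6 * (a ^ 9 / w) := by ring
    _ ≤ 6 * 1 := by
        gcongr
        refine (div_le_one hw).2 (le_trans ?_ F.pow_le)
        exact pow_le_pow_right₀ ha (by norm_num)
    _ = 6 := by norm_num

/-! ### One step of a server that moves to the right -/

/-- A bound for the age of the customers that compete with those beyond the frontier. -/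
def ageBound (a : ℝ) : ℝ := (a + 1) * (3 + 156 * a ^ 7)

/-- A lower bound for the decrease of the inverse clock during a unit of time. -/
def clockGain (lam a : ℝ) : ℝ := min lam 1 / (2 ^ 17 * a ^ 17)

/-- The clock `a` is so large that the errors of a step are small. -/
structure LargeClock {Ω : Type*} [MeasurableSpace Ω] (μ : Measure Ω) (T : Ω → ℕ → ℝ) (lam : ℝ)
    (v : ℝ≥0∞) (a : ℝ) : Prop where
  four_le : 4 ≤ a
  zone : 26 * (1 + lam * ageBound a) ≤ a ^ 9
  age : lam * ageBound a ≤ a ^ 16 / 2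
  travel : ENNReal.ofReal (7 / a ^ 15) ≤ v
  -- The right side is the expected decrease of `1 / a` due to services of length at least one. The
  -- left side collects what can raise the bound on the failure probability.
  loss : Real.exp (-a) + μ.real {ω | a < T ω 0} + 1 / a ^ 18 + clockGain lam a / a ^ 6 ≤
    clockGain lam a * μ.real {ω | 1 ≤ T ω 0}

section
variable {Ω : Type*} [MeasurableSpace Ω] {μ : Measure Ω} [IsProbabilityMeasure μ] {lam : ℝ}
  {η : Ω → Conf} {T : Ω → ℕ → ℝ} {v : ℝ≥0∞}

omit [MeasurableSpace Ω] in
lemma count_eq_zero_iff {E : Type*} {ξ : Ω → Set E} {B : Set E} {ω : Ω} :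
    count ξ B ω = 0 ↔ ∀ c ∈ ξ ω, c ∉ B := by
  rw [count, Set.encard_eq_zero, Set.eq_empty_iff_forall_notMem]
  simp

-- `C` is a failure: no customer just beyond the frontier, or a long service. `Z` is a mishap: a
-- recent customer behind the frontier within reach, or a customer in the first bit of unexplored
-- mass ahead. Outside `C` the step is short, and outside both it pushes the frontier substantially
-- forward.
omit [IsProbabilityMeasure μ] in
lemma Frontier.exists_step_events (hη : IsInput μ lam η T) (hlam : 0 < lam) {M ws : ℝ}
    {n₀ n i : ℕ} {h : ℕ → ℝ × ℝ} {a w e : ℝ} (F : Frontier lam M ws n₀ n h i a w e)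
    (hM : 1 ≤ M) (hws : 0 < ws) (hL : LargeClock μ T lam v a) :
    ∃ C Z : Set Ω, MeasurableSet C ∧ MeasurableSet Z ∧
      μ.real C ≤ Real.exp (-a) + μ.real {ω | a < T ω 0} ∧ μ.real Z ≤ 1 / a ^ 6 ∧
      ∀ ω ∉ C, ∀ c, IsStrictNearest (h n) ((η ω).inter (exploredBy n h)ᶜ).carrier c →
        |c.1 - (h n).1| ≤ e - (h n).1 + a / w ∧ T ω 0 ≤ a ∧
        (ω ∉ Z → e ≤ c.1 ∧ 1 / 4 ≤
          a ^ 6 * ((c.1 - e) * density lam (n + 1) (serve v n h c (T ω 0)) c.1)) := by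
  have ha : 1 ≤ a := by linarith [hL.four_le]
  have hw : 0 < w := lt_of_lt_of_le (by positivity) F.pow_le
  set x := (h n).1 with hx
  set t := (h n).2 with ht
  set r := a / w with hr
  have hr0 : 0 < r := by positivity
  have hrw : r * w = a := div_mul_cancel₀ a hw.ne'
  have hxe : x ≤ e := F.pos
  have hgap : e - x ≤ 6 * r := F.gap_le ha
  have hr15 : r ≤ 1 / a ^ 15 := by
    rw [hr, div_le_div_iff₀ hw (by positivity)]
    calc a * a ^ 15 = a ^ 16 := by ring
      _ ≤ 1 * w := by rw [one_mul]; exact F.pow_le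
  have hA0 : 0 ≤ ageBound a := by unfold ageBound; positivity
  -- Length `r` times density at least `w` gives mass at least `r * w = a`, so this set is empty
  -- with probability at most `exp (-a)`.
  set B₁ : Set (ℝ × ℝ) := Set.Ioo e (e + r) ×ˢ freshTimes n h e with hB₁
  have hB₁m : MeasurableSet B₁ := measurableSet_Ioo.prod (measurableSet_freshTimes n h e)
  have hB₁u : B₁ ⊆ unexplored n h (Set.Ioo e (e + r)) := by
    rintro ⟨y, s⟩ ⟨hy, hs⟩
    exact ⟨⟨hy, hs.1.1.le, hs.1.2⟩, F.admissible.notMem_of_freshTimes hxe hs hy.1⟩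
  have hB₁f : intensity lam B₁ ≠ ∞ := by
    refine ne_top_of_le_ne_top ?_
      (intensity_prod_le lam measurableSet_Ioo (measurableSet_freshTimes n h e))
    have := volume_freshTimes_ne_top n h e
    rw [Real.volume_Ioo]
    finiteness
  have hB₁ge : ENNReal.ofReal a ≤ intensity lam B₁ := by
    refine le_trans (le_trans (ENNReal.ofReal_le_ofReal (q := r * density lam n h e) ?_)
      (le_of_eq ?_)) (intensity_prod_ge lam measurableSet_Ioo (measurableSet_freshTimes n h e)
        fun s hs => hs.1.1)
    · rw [← hrw]
      exact mul_le_mul_of_nonneg_left F.le_density hr0.le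
    · rw [Real.volume_Ioo, density, ENNReal.ofReal_mul hr0.le, ENNReal.ofReal_mul hlam.le,
        ENNReal.ofReal_toReal (volume_freshTimes_ne_top _ _ _), add_sub_cancel_left]
      ring
  -- The allowed probability `1 / a ^ 6` of a mishap is shared equally by the competitors behind and
  -- by the customers too close ahead.
  obtain ⟨u, hu0, hur, hu⟩ := exists_intensity_unexplored_eq lam n h e (m := 1 / (2 * a ^ 6))
    (ρ := r) (by positivity) hr0.le (by
      refine (ENNReal.ofReal_le_ofReal ?_).trans (hB₁ge.trans (measure_mono hB₁u))
      refine le_trans ?_ ha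
      rw [div_le_one (by positivity)]
      linarith [one_le_pow₀ (n := 6) ha])
  -- The positions behind the frontier that are within reach. The length is `2 * (e - x) + r ≤ 13 *
  -- r`, at most `13 / a ^ 15`.
  set I₂ : Set ℝ := Set.Ioc (x - (e - x + r)) e with hI₂
  set B₂ : Set (ℝ × ℝ) := I₂ ×ˢ Set.Icc (t - ageBound a) t with hB₂
  have hB₂m : MeasurableSet B₂ := measurableSet_Ioc.prod measurableSet_Icc
  have hB₂le : intensity lam B₂ ≤ ENNReal.ofReal (1 / (2 * a ^ 6)) := by
    refine (intensity_prod_le lam measurableSet_Ioc measurableSet_Icc).trans ?_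
    rw [Real.volume_Ioc, Real.volume_Icc, ← ENNReal.ofReal_mul hlam.le, ← ENNReal.ofReal_one,
      ← ENNReal.ofReal_add zero_le_one (mul_nonneg hlam.le (by linarith)),
      ← ENNReal.ofReal_mul (by linarith)]
    refine ENNReal.ofReal_le_ofReal ?_
    have h1 : e - (x - (e - x + r)) ≤ 13 * (1 / a ^ 15) := by linarith
    have h2 : 1 + lam * (t - (t - ageBound a)) ≤ a ^ 9 / 26 := by
      rw [sub_sub_cancel]; linarith [hL.zone]
    have h3 : 0 ≤ 1 + lam * (t - (t - ageBound a)) := by rw [sub_sub_cancel]; positivity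
    calc _ ≤ 13 * (1 / a ^ 15) * (a ^ 9 / 26) := mul_le_mul h1 h2 h3 (by positivity)
      _ = _ := by field_simp; norm_num
  set B₃ := B₂ ∪ unexplored n h (Set.Ioo e (e + u)) with hB₃
  have hB₃m : MeasurableSet B₃ := hB₂m.union (measurableSet_unexplored n h measurableSet_Ioo)
  have hB₃le : intensity lam B₃ ≤ ENNReal.ofReal (1 / a ^ 6) := by
    refine (measure_union_le _ _).trans ((add_le_add hB₂le hu.le).trans (le_of_eq ?_))
    rw [← ENNReal.ofReal_add (by positivity) (by positivity)]
    congr 1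
    field_simp
    norm_num
  have hTm : Measurable fun ω => T ω 0 := hη.measurable_service_apply 0
  have hm1 := hη.poisson.measurable_count B₁ hB₁m
  have hm3 := hη.poisson.measurable_count B₃ hB₃m
  refine ⟨{ω | count (fun ω => (η ω).carrier) B₁ ω = 0} ∪ {ω | a < T ω 0},
    {ω | ((1 : ℕ) : ℕ∞) ≤ count (fun ω => (η ω).carrier) B₃ ω},
    (hm1 (measurableSet_singleton 0)).union (measurableSet_lt measurable_const hTm),
    hm3 (MeasurableSet.of_discrete (s := Set.Ici ((1 : ℕ) : ℕ∞))), ?_, ?_, ?_⟩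
  · refine (measureReal_union_le _ _).trans (add_le_add ?_ le_rfl)
    rw [measureReal_def, hη.poisson.measure_count_eq_zero hB₁m hB₁f,
      ENNReal.toReal_ofReal (Real.exp_nonneg _)]
    refine Real.exp_le_exp.2 (neg_le_neg ?_)
    have := ENNReal.toReal_mono hB₁f hB₁ge
    rwa [ENNReal.toReal_ofReal (by linarith)] at this
  · have h1 := (hη.poisson.measure_le_count_le_pow hB₃m
      (ne_top_of_le_ne_top ENNReal.ofReal_ne_top hB₃le) 1).trans_eq (pow_one _)
    refine ENNReal.toReal_le_of_le_ofReal (by positivity) (h1.trans hB₃le)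
  intro ω hωC c hc
  rw [Set.mem_union, not_or] at hωC
  have hcη : c ∈ (η ω).carrier := hc.1.1.1
  have hcR : c ∉ exploredBy n h := hc.1.1.2
  have hct : c.2 ≤ t := hc.1.2
  have hcd : |c.1 - x| < e - x + r := by
    obtain ⟨d, hdη, hdB⟩ : ∃ d ∈ (η ω).carrier, d ∈ B₁ := by
      by_contra! hcon
      exact hωC.1 (count_eq_zero_iff.2 hcon)
    have hdu := hB₁u hdB
    refine (hc.abs_le ⟨hdη, hdu.2⟩ hdu.1.2.2).trans_lt ?_
    rw [abs_of_nonneg (by linarith [hdB.1.1])]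
    linarith [hdB.1.2]
  refine ⟨hcd.le, not_lt.1 hωC.2, fun hωZ => ?_⟩
  have hcB : c ∉ B₃ := by
    have : count (fun ω => (η ω).carrier) B₃ ω = 0 := by
      by_contra hne
      exact hωZ (Order.one_le_iff_ne_zero.2 hne)
    exact count_eq_zero_iff.1 this c hcη
  have hec : e < c.1 := by
    by_contra! hce
    have hcx : x - (e - x + r) < c.1 := by linarith [neg_abs_le (c.1 - x)]
    refine hcB (Or.inl ⟨⟨hcx, hce⟩, ?_, hct⟩)
    have hi : (i : ℝ) ≤ 2 := by exact_mod_cast F.i_le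
    -- This is where the constants of `ageBound` come from: `3` bounds `1 + i`, and `156 = 12 * 13`.
    have hbound : ∀ y, y ≤ 13 * r → (a + 1) * (1 + i + 12 * a ^ 6 * (y * w)) ≤ ageBound a := by
      intro y hy
      unfold ageBound
      have h1 : y * w ≤ 13 * a := by
        rw [← hrw, ← mul_assoc]
        exact mul_le_mul_of_nonneg_right hy hw.le
      have h2 : 12 * a ^ 6 * (y * w) ≤ 12 * a ^ 6 * (13 * a) := by gcongr
      refine mul_le_mul_of_nonneg_left ?_ (by linarith)
      linarith [show 12 * a ^ 6 * (13 * a) = 156 * a ^ 7 by ring]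
    -- The bound on ages requires that `c` is not far to the left of the starting point. If the
    -- frontier has moved by `13 * r`, this is clear. Otherwise little time has passed, so `a ≤ 2 *
    -- M` and `13 * r ≤ 26 * M / ws`.
    have hb : (h n₀).1 - 26 * M / ws < c.1 := by
      rcases le_total (13 * r) (e - (h n₀).1) with h13 | h13
      · have : 0 ≤ 26 * M / ws := by positivity
        linarith
      · have h1 := F.elapsed.trans (hbound _ h13)
        have h2 : (h (n - i)).2 ≤ t := F.admissible.time_mono (Nat.sub_le _ _) le_rfl
        have h3 : a ^ 16 ≤ 2 * M ^ 16 := by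
          have h4 : lam * ((h (n - i)).2 - (h n₀).2) ≤ lam * ageBound a :=
            mul_le_mul_of_nonneg_left (by linarith) hlam.le
          linarith [F.clock, hL.age]
        have h5 : a ≤ 2 * M := by
          refine le_of_pow_le_pow_left₀ (n := 16) (by norm_num) (by linarith) (h3.trans ?_)
          rw [mul_pow]
          have : (0 : ℝ) ≤ M ^ 16 := by positivity
          nlinarith
        have h6 : r ≤ 2 * M / ws := div_le_div₀ (by linarith) h5 hws F.ws_le
        have h7 : 26 * M / ws = 13 * (2 * M / ws) := by ring
        have h8 : (h n₀).1 ≤ e := F.pos_le n₀ le_rfl F.start_le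
        linarith
    have := (F.age c hcR hb hce).trans (hbound _ (by linarith))
    linarith
  refine ⟨hec.le, ?_⟩
  set w' := density lam (n + 1) (serve v n h c (T ω 0)) c.1 with hw'
  have huc : e + u ≤ c.1 := by
    by_contra! hlt
    exact hcB (Or.inr ⟨⟨⟨hec, hlt⟩, (η ω).nonneg c hcη, hct⟩, hcR⟩)
  have hxc : x ≤ c.1 := hxe.trans hec.le
  have hd : ∀ e₁, x ≤ e₁ → e₁ ≤ c.1 → density lam n h e₁ ≤ w' := by
    intro e₁ h1 h2
    have h3 := density_serve_ge hlam.le F.admissible (v := v) (c := c) (hη.nonneg ω 0) h1 h2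
      (by rw [abs_of_nonneg (by linarith)]; linarith)
    refine le_trans (le_add_of_nonneg_right (mul_nonneg hlam.le ?_)) h3
    rw [serve_succ]
    have := travelTime_nonneg v (h n).1 c.1
    have := hη.nonneg ω 0
    simp only
    linarith
  have hw1 : 1 ≤ w' := by
    refine le_trans (one_le_pow₀ ha) (F.pow_le.trans (F.le_density.trans (hd e hxe hec.le)))
  -- The interval from `e` to `c.1` has unexplored mass at least `1 / (2 * a ^ 6)`, but at most
  -- `(c.1 - e) * 2 * w'`, since the density at `c.1` is at most `w'` and `w' ≥ 1`.
  have hmass := intensity_unexplored_le hlam.le F.admissible hxe hec.le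
  have hmono : intensity lam (unexplored n h (Set.Ioo e (e + u))) ≤
      intensity lam (unexplored n h (Set.Ioo e c.1)) :=
    measure_mono (Set.sdiff_subset_sdiff_left (Set.prod_mono (Set.Ioo_subset_Ioo_right huc) le_rfl))
  rw [hu] at hmono
  have hdn : 0 ≤ density lam n h c.1 := mul_nonneg hlam.le ENNReal.toReal_nonneg
  have h1 := (ENNReal.ofReal_le_ofReal_iff (mul_nonneg (by linarith) (by linarith))).1
    (hmono.trans hmass)
  have h2 : (c.1 - e) * (1 + density lam n h c.1) ≤ (c.1 - e) * (2 * w') :=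
    mul_le_mul_of_nonneg_left (by linarith [hd c.1 hxc le_rfl]) (by linarith)
  have h3 : a ^ 6 * (1 / (2 * a ^ 6)) ≤ a ^ 6 * ((c.1 - e) * (2 * w')) :=
    mul_le_mul_of_nonneg_left (h1.trans h2) (by positivity)
  have h4 : a ^ 6 * (1 / (2 * a ^ 6)) = 1 / 2 := by field_simp
  linarith

/-- The inverse clock decreases by at least `clockGain` in a unit of time. -/
lemma one_div_le_of_clock {lam a a' : ℝ} (hlam : 0 < lam) (ha : 1 ≤ a) (haa : a ≤ a')
    (h : a ^ 16 + lam ≤ a' ^ 16) : 1 / a' ≤ 1 / a - clockGain lam a := by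
  set l := min lam 1 with hl
  have hl0 : 0 < l := lt_min hlam one_pos
  have hl1 : l ≤ 1 := min_le_right _ _
  -- Chosen so that `(a + δ) ^ 16 ≤ a ^ 16 + l`. Then `1 / a - 1 / (a + δ)` is at least `δ / (2 * a
  -- ^ 2)`, which is `clockGain lam a`.
  set δ := l / (2 ^ 16 * a ^ 15) with hδ
  have hδ0 : 0 < δ := by positivity
  have hδ1 : δ ≤ 1 := by
    rw [hδ, div_le_one (by positivity)]
    have := one_le_pow₀ (n := 15) ha
    linarith
  have hpow : (a + δ) ^ 16 ≤ a ^ 16 + l := by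
    have hx0 : 0 ≤ δ / a := by positivity
    have hx1 : δ / a ≤ 1 := by rw [div_le_one (by linarith)]; linarith
    have h1 : (1 + δ / a) ^ 16 ≤ 1 + 2 ^ 16 * (δ / a) := by
      -- On the interval from `1` to `2` the power lies below its chord, of slope `2 ^ 16 - 1`.
      have hconv : ConvexOn ℝ (Set.Ici 0) fun x : ℝ => x ^ 16 := convexOn_pow 16
      have := hconv.2 (show (1 : ℝ) ∈ Set.Ici 0 by simp) (show (2 : ℝ) ∈ Set.Ici 0 by simp)
        (show 0 ≤ 1 - δ / a by linarith) hx0 (by ring)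
      simp only [smul_eq_mul] at this
      have e1 : (1 - δ / a) * 1 + δ / a * 2 = 1 + δ / a := by ring
      rw [e1] at this
      refine this.trans ?_
      norm_num
      linarith
    have e2 : a + δ = a * (1 + δ / a) := by field_simp
    rw [e2, mul_pow]
    have e3 : a ^ 16 + l = a ^ 16 * (1 + 2 ^ 16 * (δ / a)) := by
      rw [hδ]; field_simp
    rw [e3]
    exact mul_le_mul_of_nonneg_left h1 (by positivity)
  have hlel : l ≤ lam := min_le_left _ _
  have h2 : a + δ ≤ a' := le_of_pow_le_pow_left₀ (n := 16) (by norm_num) (by linarith)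
    (hpow.trans (by linarith))
  have h3 : 1 / a' ≤ 1 / (a + δ) := one_div_le_one_div_of_le (by linarith) h2
  refine h3.trans ?_
  have h4 : clockGain lam a = δ / (2 * a ^ 2) := by
    rw [clockGain, ← hl, hδ]; field_simp
  have h5 : 1 / a - 1 / (a + δ) = δ / (a * (a + δ)) := by field_simp; ring
  have h6 : δ / (2 * a ^ 2) ≤ δ / (a * (a + δ)) := by
    refine div_le_div_of_nonneg_left hδ0.le (by positivity) ?_
    nlinarith
  linarith

lemma clockGain_pos {lam a : ℝ} (hlam : 0 < lam) (ha : 0 < a) : 0 < clockGain lam a :=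
  div_pos (lt_min hlam one_pos) (by positivity)

lemma clockGain_le (lam : ℝ) {a : ℝ} (ha : 1 ≤ a) : clockGain lam a ≤ 1 / a := by
  unfold clockGain
  refine div_le_div₀ zero_le_one (min_le_right _ _) (by linarith) ?_
  calc a = 1 * a ^ 1 := by ring
    _ ≤ 2 ^ 17 * a ^ 17 := mul_le_mul (by norm_num) (pow_le_pow_right₀ ha (by norm_num))
        (by positivity) (by norm_num)

/-! ### The probability of staying at the frontier for ever -/

lemma isProbabilityMeasure_pathLaw (hη : IsFresh μ η T) (n : ℕ) (h : ℕ → ℝ × ℝ) :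
    IsProbabilityMeasure (pathLaw μ η T v n h) :=
  Measure.isProbabilityMeasure_map (hη.measurable_path_const v n h).aemeasurable

/-- A server at the frontier stays steady up to step `N` with high probability. -/
lemma Frontier.pathLaw_compl_le (hη : IsInput μ lam η T) (hlam : 0 < lam) {M ws : ℝ} (hM : 1 ≤ M)
    (hws : 0 < ws) (hL : ∀ a, M ≤ a → LargeClock μ T lam v a) {n₀ N : ℕ} (k : ℕ) :
    ∀ {n i : ℕ} {h : ℕ → ℝ × ℝ} {a w e : ℝ}, n + k = N → Frontier lam M ws n₀ n h i a w e →
      h ∈ steady lam n₀ n →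
      pathLaw μ η T v n h (steady lam n₀ N)ᶜ ≤ ENNReal.ofReal (1 / a + (1 / a ^ 6) ^ (3 - i)) := by
  induction k with
  | zero =>
    intro n i h a w e hn F hst
    obtain rfl : n = N := hn
    refine le_of_eq_of_le ?_ zero_le
    rw [pathLaw_apply v hη.isFresh _ _ (measurableSet_steady _ _ _).compl]
    convert measure_empty (μ := μ)
    ext ω
    simp only [Set.mem_ofPred_eq, Set.mem_compl_iff, Set.mem_empty_iff_false, iff_false, not_not]
    exact steady_congr F.start_le (fun k hk => (path_of_le v h _ _ hk).symm) hst
  | succ k ih =>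
    intro n i h a w e hn F hst
    have hLa := hL a F.M_le
    have ha : 1 ≤ a := hM.trans F.M_le
    have hw : 0 < w := lt_of_lt_of_le (by positivity) F.pow_le
    obtain ⟨C, Z, hCm, hZm, hC, hZ, hstep⟩ := F.exists_step_events hη hlam hM hws hLa
    set D := clockGain lam a with hD
    have hD0 : 0 < D := clockGain_pos hlam (by linarith)
    have hDa : D ≤ 1 / a := clockGain_le lam ha
    -- The mishap term after one more retry. For `i = 2` it equals `1`: no further retry is allowed.
    set b : ℝ := (1 / a ^ 6) ^ (2 - i) with hb
    have hb0 : 0 ≤ b := by positivity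
    set U : Set Ω := {ω | 1 ≤ T ω 0} with hU
    have hUm : MeasurableSet U :=
      measurableSet_le measurable_const (hη.measurable_service_apply 0)
    -- `g` bounds the failure probability after the step. On `C` nothing is claimed. On `Z` a retry
    -- gives `1 / a + b`, and the extra `D` offsets the term with `U`. Otherwise the frontier is
    -- pushed: the mishap term resets to at most `1 / a ^ 18`, and the inverse clock drops by `D` if
    -- the service lasts at least one unit.
    set g : Ω → ℝ := fun ω => 1 / a + 1 / a ^ 18 - U.indicator (fun _ => D) ω +
      Z.indicator (fun _ => b + D) ω + C.indicator (fun _ => (1 : ℝ)) ω with hg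
    have hind : ∀ (s : Set Ω) (x : ℝ) ω, 0 ≤ x →
        0 ≤ s.indicator (fun _ => x) ω ∧ s.indicator (fun _ => x) ω ≤ x := by
      intro s x ω hx
      exact ⟨Set.indicator_nonneg (fun _ _ => hx) _, Set.indicator_le_self' (fun _ _ => hx) _⟩
    have hg0 : ∀ ω, 0 ≤ g ω := by
      intro ω
      have h1 := hind U D ω hD0.le
      have h2 := hind Z (b + D) ω (by positivity)
      have h3 := hind C 1 ω zero_le_one
      have h4 : 0 ≤ 1 / a ^ 18 := by positivity
      simp only [hg]
      linarith
    have hint : ∀ (s : Set Ω) (x : ℝ), MeasurableSet s →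
        Integrable (s.indicator fun _ => x) μ := fun s x hs => (integrable_const x).indicator hs
    have hi1 : Integrable (fun ω => 1 / a + 1 / a ^ 18 - U.indicator (fun _ => D) ω) μ :=
      (integrable_const _).sub (hint U D hUm)
    have hi2 : Integrable (fun ω => 1 / a + 1 / a ^ 18 - U.indicator (fun _ => D) ω +
      Z.indicator (fun _ => b + D) ω) μ := hi1.add (hint Z _ hZm)
    have hgi : Integrable g μ := hi2.add (hint C 1 hCm)
    have hgint : ∫ ω, g ω ∂μ = 1 / a + 1 / a ^ 18 - μ.real U * D + μ.real Z * (b + D) + μ.real C := by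
      simp only [hg]
      rw [integral_add hi2 (hint C 1 hCm), integral_add hi1 (hint Z _ hZm),
        integral_sub (integrable_const _) (hint U D hUm), integral_indicator_const _ hUm,
        integral_indicator_const _ hZm, integral_indicator_const _ hCm]
      simp
    have hbound : ∀ᵐ ω ∂μ, pathLaw μ η T v (n + 1)
        (extend v n h ((η ω).inter (exploredBy n h)ᶜ).carrier (T ω 0)) (steady lam n₀ N)ᶜ ≤
          ENNReal.ofReal (g ω) := by
      filter_upwards [hη.isFresh.ae_nearest (F.admissible.time_nonneg le_rfl)] with ω hω
      obtain ⟨c, hc⟩ := hω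
      rw [hc.extend_eq]
      have hτ := hη.nonneg ω 0
      have hprob := isProbabilityMeasure_pathLaw (v := v) hη.isFresh (n + 1) (serve v n h c (T ω 0))
      have hone : pathLaw μ η T v (n + 1) (serve v n h c (T ω 0)) (steady lam n₀ N)ᶜ ≤ 1 :=
        prob_le_one
      have h1 := hind U D ω hD0.le
      have h2 := hind Z (b + D) ω (by positivity)
      have h3 := hind C 1 ω zero_le_one
      have h4 : 0 ≤ 1 / a ^ 18 := by positivity
      by_cases hωC : ω ∈ C
      · refine hone.trans ?_
        rw [← ENNReal.ofReal_one]
        refine ENNReal.ofReal_le_ofReal ?_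
        simp only [hg]
        rw [Set.indicator_of_mem hωC]
        linarith
      obtain ⟨hs1, hs2, hs3⟩ := hstep ω hωC c hc
      have htr : travelTime v (h n).1 c.1 + T ω 0 ≤ a + 1 := by
        have h5 : |c.1 - (h n).1| ≤ 7 / a ^ 15 := by
          have h6 := F.gap_le ha
          have h7 : a / w ≤ 1 / a ^ 15 := by
            rw [div_le_div_iff₀ hw (by positivity)]
            linarith [F.pow_le, show a * a ^ 15 = a ^ 16 by ring]
          have h8 : 7 / a ^ 15 = 7 * (1 / a ^ 15) := by ring
          linarith
        linarith [travelTime_le_one hLa.travel h5]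
      have hsteady : ∀ {i' : ℕ} {a' w' e' : ℝ},
          Frontier lam M ws n₀ (n + 1) (serve v n h c (T ω 0)) i' a' w' e' →
          pathLaw μ η T v (n + 1) (serve v n h c (T ω 0)) (steady lam n₀ N)ᶜ ≤
            ENNReal.ofReal (1 / a' + (1 / a' ^ 6) ^ (3 - i')) := by
        intro i' a' w' e' F'
        refine ih (by omega) F' (F'.mem_steady hlam.le hM fun m hm => ?_)
        exact steady_antitone lam n₀ (Nat.lt_succ_iff.1 hm)
          (steady_congr F.start_le (fun k hk => (serve_of_le v h c _ hk).symm) hst)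
      by_cases hωZ : ω ∈ Z
      · have hgZ : 1 / a + b ≤ g ω := by
          simp only [hg]
          rw [Set.indicator_of_mem hωZ]
          linarith
        rcases Nat.lt_or_ge i 2 with hi | hi
        · obtain ⟨e', F'⟩ := F.retry hlam.le ha (by omega) hτ hs1 htr
          refine (hsteady F').trans (ENNReal.ofReal_le_ofReal ?_)
          rwa [show 3 - (i + 1) = 2 - i by omega]
        · refine hone.trans ?_
          rw [← ENNReal.ofReal_one]
          refine ENNReal.ofReal_le_ofReal (le_trans ?_ hgZ)
          rw [hb, show 2 - i = 0 by omega, pow_zero]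
          have : 0 < 1 / a := by positivity
          linarith
      · obtain ⟨hs4, hs5⟩ := hs3 hωZ
        obtain ⟨a', w', haa, hclock, F'⟩ := F.advance hlam.le ha hτ hs4 hs5 htr
        refine (hsteady F').trans (ENNReal.ofReal_le_ofReal ?_)
        have h5 : (1 / a' ^ 6) ^ (3 - 0) ≤ 1 / a ^ 18 := by
          rw [Nat.sub_zero, one_div_pow, ← pow_mul]
          exact one_div_le_one_div_of_le (by positivity) (by gcongr)
        have h6 : 1 / a' ≤ 1 / a - U.indicator (fun _ => D) ω := by
          by_cases hωU : ω ∈ U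
          · rw [Set.indicator_of_mem hωU]
            refine one_div_le_of_clock hlam ha haa (le_trans ?_ hclock)
            have : 1 ≤ T ω 0 := hωU
            nlinarith
          · rw [Set.indicator_of_notMem hωU, sub_zero]
            exact one_div_le_one_div_of_le (by linarith) haa
        simp only [hg]
        linarith
    rw [pathLaw_step v hη.isFresh (F.admissible.time_nonneg le_rfl)
      (measurableSet_steady _ _ _).compl]
    refine (lintegral_mono_ae hbound).trans ?_
    rw [← ofReal_integral_eq_lintegral_ofReal hgi (ae_of_all _ hg0), hgint]
    refine ENNReal.ofReal_le_ofReal ?_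
    have hpow : (1 / a ^ 6) ^ (3 - i) = 1 / a ^ 6 * b := by
      rw [hb, ← pow_succ']
      congr 1
      have := F.i_le
      omega
    have hZb : μ.real Z * (b + D) ≤ 1 / a ^ 6 * (b + D) :=
      mul_le_mul_of_nonneg_right hZ (by positivity)
    have hloss := hLa.loss
    have e1 : 1 / a ^ 6 * (b + D) = 1 / a ^ 6 * b + D / a ^ 6 := by ring
    rw [hpow]
    linarith

/-- A server at the frontier stays steady for ever with probability at least one half. -/
lemma Frontier.half_le_pathLaw (hη : IsInput μ lam η T) (hlam : 0 < lam) {M ws : ℝ}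
    (hws : 0 < ws) (hL : ∀ a, M ≤ a → LargeClock μ T lam v a) {n₀ : ℕ} {h : ℕ → ℝ × ℝ} {w e : ℝ}
    (F : Frontier lam M ws n₀ n₀ h 0 M w e) :
    1 / 2 ≤ pathLaw μ η T v n₀ h (⋂ N, steady lam n₀ N) := by
  have hM4 : 4 ≤ M := (hL M le_rfl).four_le
  have hprob := isProbabilityMeasure_pathLaw (v := v) hη.isFresh n₀ h
  have hst : h ∈ steady lam n₀ n₀ := by
    refine F.mem_steady hlam.le (by linarith) fun m hm n hn j hj hj0 => ?_
    omega
  have hle : ∀ N, 1 / 2 ≤ pathLaw μ η T v n₀ h (steady lam n₀ N) := by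
    intro N
    rcases le_total n₀ N with hN | hN
    · have h1 := F.pathLaw_compl_le hη hlam (by linarith) hws hL (N - n₀) (N := N) (by omega) hst
      have h2 : ENNReal.ofReal (1 / M + (1 / M ^ 6) ^ (3 - 0)) ≤ 1 / 2 := by
        rw [show (1 / 2 : ℝ≥0∞) = ENNReal.ofReal (1 / 2) by
          rw [ENNReal.ofReal_div_of_pos (by norm_num)]; simp]
        refine ENNReal.ofReal_le_ofReal ?_
        have h3 : 1 / M ≤ 1 / 4 := one_div_le_one_div_of_le (by norm_num) hM4
        have h4 : (1 / M ^ 6) ^ (3 - 0) ≤ 1 / 4 := by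
          rw [Nat.sub_zero, one_div_pow, ← pow_mul]
          refine one_div_le_one_div_of_le (by norm_num) (hM4.trans ?_)
          exact le_self_pow₀ (by linarith) (by norm_num)
        linarith
      have h5 := prob_add_prob_compl (μ := pathLaw μ η T v n₀ h) (measurableSet_steady lam n₀ N)
      by_contra! hlt
      have := ENNReal.add_lt_add_of_lt_of_le (by finiteness) hlt (h1.trans h2)
      rw [h5, ENNReal.add_halves] at this
      exact lt_irrefl _ this
    · have : steady lam n₀ n₀ ⊆ steady lam n₀ N := steady_antitone lam n₀ hN
      refine le_trans ?_ (measure_mono this)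
      rw [pathLaw_apply v hη.isFresh _ _ (measurableSet_steady _ _ _)]
      have : {ω | path v n₀ h ((η ω).inter (exploredBy n₀ h)ᶜ) (T ω) ∈ steady lam n₀ n₀} =
          Set.univ := by
        ext ω
        simp only [Set.mem_ofPred_eq, Set.mem_univ, iff_true]
        exact steady_congr le_rfl (fun k hk => (path_of_le v h _ _ hk).symm) hst
      rw [this, measure_univ]
      exact ENNReal.half_le_self
  exact ge_of_tendsto' (tendsto_measure_iInter_atTop
    (fun N => (measurableSet_steady lam n₀ N).nullMeasurableSet) (steady_antitone lam n₀)
    ⟨0, measure_ne_top _ _⟩) hle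

end

/-! ### Reflection of the dynamics -/

/-- The reflected path. -/
def reflectPath (h : ℕ → ℝ × ℝ) : ℕ → ℝ × ℝ := fun k => reflectPoint (h k)

lemma measurable_reflectPath : Measurable reflectPath :=
  measurable_pi_lambda _ fun k => measurable_reflectPoint.comp (measurable_pi_apply k)

lemma explored_reflectPoint (p : ℝ × ℝ) (y : ℝ) :
    explored (reflectPoint p) (-y) = reflectPoint ⁻¹' explored p y := by
  ext c
  have h1 : |c.1 + p.1| = |-c.1 - p.1| := by rw [← abs_neg]; congr 1; ring
  have h2 : |-y + p.1| = |y - p.1| := by rw [← abs_neg]; congr 1; ring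
  simp [explored, reflectPoint, h1, h2]

lemma exploredBy_reflectPath (n : ℕ) (h : ℕ → ℝ × ℝ) :
    exploredBy n (reflectPath h) = reflectPoint ⁻¹' exploredBy n h := by
  ext c
  rw [Set.mem_preimage, mem_exploredBy, mem_exploredBy]
  refine exists_congr fun k => and_congr_right fun _ => ?_
  exact iff_of_eq (congrArg (c ∈ ·) (explored_reflectPoint (h k) (h (k + 1)).1))

lemma isStrictNearest_reflectPoint {p : ℝ × ℝ} {s : Set (ℝ × ℝ)} {c : ℝ × ℝ} :
    IsStrictNearest (reflectPoint p) (reflectPoint ⁻¹' s) (reflectPoint c) ↔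
      IsStrictNearest p s c := by
  have h1 : ∀ d : ℝ × ℝ, |(reflectPoint d).1 - (reflectPoint p).1| = |d.1 - p.1| := fun d => by
    rw [← abs_neg]; simp only [reflectPoint]; congr 1; ring
  unfold IsStrictNearest
  rw [Set.mem_preimage, reflectPoint_reflectPoint]
  refine and_congr Iff.rfl ⟨fun h d hd hdt hne => ?_, fun h d hd hdt hne => ?_⟩
  · have := h (reflectPoint d) (by simpa using hd) hdt
      fun he => hne (by simpa using congrArg reflectPoint he)
    rwa [h1, h1] at this
  · have := h (reflectPoint d) hd hdt fun he => hne (by rw [← he, reflectPoint_reflectPoint])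
    rw [h1]
    rwa [← h1 (reflectPoint d), reflectPoint_reflectPoint] at this

lemma advance_reflectPoint (v : ℝ≥0∞) (p : ℝ × ℝ) (s : Set (ℝ × ℝ)) (τ : ℝ) :
    advance v (reflectPoint p) (reflectPoint ⁻¹' s) τ = reflectPoint (advance v p s τ) := by
  by_cases h : ∃ c, IsStrictNearest p s c
  · obtain ⟨c, hc⟩ := h
    have hc' := isStrictNearest_reflectPoint.2 hc
    rw [advance, advance, if_pos ⟨_, hc'⟩, if_pos ⟨c, hc⟩, hc.nearest_eq, hc'.nearest_eq]
    have : |-c.1 + p.1| = |c.1 - p.1| := by rw [← abs_neg]; congr 1; ring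
    simp [reflectPoint, travelTime, this]
  · have h' : ¬ ∃ c, IsStrictNearest (reflectPoint p) (reflectPoint ⁻¹' s) c := by
      rintro ⟨c, hc⟩
      rw [← reflectPoint_reflectPoint c] at hc
      exact h ⟨_, isStrictNearest_reflectPoint.1 hc⟩
    rw [advance, advance, if_neg h', if_neg h]
    simp [reflectPoint]

lemma orbit_reflect (v : ℝ≥0∞) (p : ℝ × ℝ) (s : Conf) (T : ℕ → ℝ) (n : ℕ) :
    orbit v (reflectPoint p) s.reflect T n =
      (reflectPoint (orbit v p s T n).1, (orbit v p s T n).2.reflect) := by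
  induction n with
  | zero => rfl
  | succ n ih =>
    rw [orbit, ih, orbit]
    have h1 : advance v (reflectPoint (orbit v p s T n).1) (orbit v p s T n).2.reflect.carrier
        (T n) = reflectPoint (advance v (orbit v p s T n).1 (orbit v p s T n).2.carrier (T n)) :=
      advance_reflectPoint _ _ _ _
    simp only [h1]
    rw [Prod.mk.injEq]
    refine ⟨rfl, Conf.ext' ?_⟩
    have h2 := explored_reflectPoint (orbit v p s T n).1
      (advance v (orbit v p s T n).1 (orbit v p s T n).2.carrier (T n)).1
    have h3 : (reflectPoint (advance v (orbit v p s T n).1 (orbit v p s T n).2.carrier (T n))).1 =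
      -(advance v (orbit v p s T n).1 (orbit v p s T n).2.carrier (T n)).1 := rfl
    simp only [Conf.inter, Conf.reflect, h3, h2]
    rfl

lemma path_reflect (v : ℝ≥0∞) (n : ℕ) (h : ℕ → ℝ × ℝ) (s : Conf) (T : ℕ → ℝ) :
    path v n (reflectPath h) s.reflect T = reflectPath (path v n h s T) := by
  funext k
  simp only [path, reflectPath]
  split_ifs with hk
  · rfl
  · rw [orbit_reflect]

lemma IsAdmissible.reflectPath {n : ℕ} {h : ℕ → ℝ × ℝ} (hh : IsAdmissible n h) :
    IsAdmissible n (reflectPath h) := hh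

section
variable {Ω : Type*} [MeasurableSpace Ω] {μ : Measure Ω} [IsProbabilityMeasure μ] {lam : ℝ}
  {η : Ω → Conf} {T : Ω → ℕ → ℝ}

/-- The law of the path is invariant under reflection. -/
lemma pathLaw_reflectPath (hη : IsInput μ lam η T) (v : ℝ≥0∞) (n : ℕ) (h : ℕ → ℝ × ℝ) :
    pathLaw μ η T v n (reflectPath h) = (pathLaw μ η T v n h).map reflectPath := by
  set F : Conf × (ℕ → ℝ) → ℕ → ℝ × ℝ := fun a =>
    reflectPath (path v n h (a.1.inter (exploredBy n h)ᶜ) a.2) with hF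
  have hFm : Measurable F := measurable_reflectPath.comp (measurable_path v n measurable_const
    ((Conf.measurable_inter_const _ (measurableSet_exploredBy_const n h).compl).comp
      measurable_fst) measurable_snd)
  have h1 : (pathLaw μ η T v n h).map reflectPath = (μ.map fun ω => (η ω, T ω)).map F := by
    rw [pathLaw, Measure.map_map measurable_reflectPath (hη.isFresh.measurable_path_const v n h),
      Measure.map_map hFm (hη.measurable_conf.prodMk hη.measurable_service)]
    rfl
  have h2 : pathLaw μ η T v n (reflectPath h) =
      (μ.map fun ω => ((η ω).reflect, T ω)).map F := by
    rw [Measure.map_map hFm (hη.measurable_reflect.prodMk hη.measurable_service), pathLaw]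
    congr 1
    funext ω
    have h3 : (η ω).inter (exploredBy n (reflectPath h))ᶜ =
        ((η ω).reflect.inter (exploredBy n h)ᶜ).reflect := by
      apply Conf.ext'
      rw [exploredBy_reflectPath]
      ext c
      simp [Conf.inter, Conf.reflect]
    rw [h3, path_reflect]
    rfl
  rw [h1, h2, hη.map_reflect]

/-! ### Paths that move to the right -/

/-- The paths that, from some step on, are asymptotically at their maximum. -/
def rightward : Set (ℕ → ℝ × ℝ) :=
  {p | ∃ N : ℕ, ∀ m : ℕ, ∃ K : ℕ, ∀ n ≥ K, ∀ j, N ≤ j → j ≤ n →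
    (p j).1 - (p n).1 ≤ 1 / ((m : ℝ) + 1)}

lemma measurableSet_rightward : MeasurableSet rightward := by
  have h1 : ∀ k, Measurable fun h : ℕ → ℝ × ℝ => (h k).1 := fun k =>
    measurable_fst.comp (measurable_pi_apply k)
  have : rightward = ⋃ N : ℕ, ⋂ m : ℕ, ⋃ K : ℕ, ⋂ n : ℕ, ⋂ (_ : K ≤ n), ⋂ j : ℕ, ⋂ (_ : N ≤ j),
      ⋂ (_ : j ≤ n), {p : ℕ → ℝ × ℝ | (p j).1 - (p n).1 ≤ 1 / ((m : ℝ) + 1)} := by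
    ext p; simp [rightward]
  rw [this]
  exact MeasurableSet.iUnion fun N => MeasurableSet.iInter fun m => MeasurableSet.iUnion fun K =>
    MeasurableSet.iInter fun n => MeasurableSet.iInter fun _ => MeasurableSet.iInter fun j =>
    MeasurableSet.iInter fun _ => MeasurableSet.iInter fun _ =>
    measurableSet_le ((h1 j).sub (h1 n)) measurable_const

/-- When the times diverge, the square root in the definition of `steady` diverges, so the distance
to the running maximum tends to zero. -/
lemma iInter_steady_subset {lam : ℝ} (hlam : 0 < lam) {n₀ : ℕ} {p : ℕ → ℝ × ℝ}
    (hp : p ∈ ⋂ N, steady lam n₀ N) (ht : Tendsto (fun n => (p n).2) atTop atTop) :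
    p ∈ rightward := by
  refine ⟨n₀, fun m => ?_⟩
  have h1 : Tendsto (fun n => √(1 + lam * ((p (n - 2)).2 - (p n₀).2))) atTop atTop := by
    refine Real.tendsto_sqrt_atTop.comp (tendsto_atTop_add_const_left _ _ ?_)
    refine Tendsto.const_mul_atTop hlam (tendsto_atTop_add_const_right _ _ ?_)
    exact ht.comp (tendsto_sub_atTop_nat 2)
  obtain ⟨K, hK⟩ := eventually_atTop.1 (h1.eventually_ge_atTop (6 * ((m : ℝ) + 1)))
  refine ⟨K, fun n hn j hj1 hj2 => ?_⟩
  have h2 := Set.mem_iInter.1 hp n n le_rfl j hj2 hj1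
  have h3 := hK n hn
  rw [le_div_iff₀ (by positivity)]
  by_contra! hlt
  have h4 : 0 < (p j).1 - (p n).1 := by
    by_contra! hle
    have : ((p j).1 - (p n).1) * ((m : ℝ) + 1) ≤ 0 :=
      mul_nonpos_of_nonpos_of_nonneg hle (by positivity)
    linarith
  nlinarith [mul_le_mul_of_nonneg_left h3 h4.le]

omit [IsProbabilityMeasure μ] in
/-- The law of large numbers for the services. -/
lemma IsInput.ae_tendsto_average (hη : IsInput μ lam η T) :
    ∀ᵐ ω ∂μ, Tendsto (fun n : ℕ => (∑ i ∈ Finset.range n, T ω i) / n) atTop (𝓝 1) := by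
  obtain ⟨α, hα, hint⟩ := hη.exists_exp
  have hi : Integrable (fun ω => T ω 0) μ := by
    by_contra h
    have := hη.service_mean
    rw [integral_undef h] at this
    exact zero_ne_one this
  have := strong_law_ae_real (fun n ω => T ω n) hi
    (fun i j hij => hη.service_indep.indepFun hij) hη.service_identDistrib
  rwa [hη.service_mean] at this

lemma tendsto_sum_of_average {s : ℕ → ℝ}
    (h : Tendsto (fun n : ℕ => (∑ i ∈ Finset.range n, s i) / n) atTop (𝓝 1)) :
    Tendsto (fun n : ℕ => ∑ i ∈ Finset.range n, s i) atTop atTop := by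
  have h1 := h.pos_mul_atTop one_pos tendsto_natCast_atTop_atTop
  refine h1.congr' ?_
  filter_upwards [eventually_gt_atTop 0] with n hn
  exact div_mul_cancel₀ _ (by positivity)

lemma path_add_succ (v : ℝ≥0∞) (n : ℕ) (h : ℕ → ℝ × ℝ) (s : Conf) (t : ℕ → ℝ) (k : ℕ) :
    path v n h s t (n + k) = (orbit v (h n) s t k).1 := by
  rw [path]
  split_ifs with hk
  · obtain rfl : k = 0 := by omega
    rfl
  · rw [Nat.add_sub_cancel_left]

/-- A path with nonnegative times never fails to find a nearest customer. -/
lemma orbit_time_succ_ge {v : ℝ≥0∞} {p : ℝ × ℝ} {s : Conf} {t : ℕ → ℝ} {k : ℕ}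
    (h : 0 ≤ (orbit v p s t (k + 1)).1.2) :
    (orbit v p s t k).1.2 + t k ≤ (orbit v p s t (k + 1)).1.2 := by
  rw [orbit] at h ⊢
  simp only [advance] at h ⊢
  split_ifs at h ⊢ with hex
  · have := travelTime_nonneg v (orbit v p s t k).1.1
      (nearest (orbit v p s t k).1 (orbit v p s t k).2.carrier).1
    simp only
    linarith
  · norm_num at h

lemma pathLaw_ae_isAdmissible {v : ℝ≥0∞} (hη : IsFresh μ η T) {n : ℕ} {h : ℕ → ℝ × ℝ}
    (hh : IsAdmissible n h) : ∀ᵐ p ∂(pathLaw μ η T v n h), ∀ m, IsAdmissible (n + m) p :=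
  ae_all_iff.2 fun m => (pathLaw_bind v hη hh (Nat.le_add_right n m)).1

/-- Along admissible paths the times dominate the partial sums of the services, which diverge by the
law of large numbers. -/
lemma pathLaw_ae_tendsto (hη : IsInput μ lam η T) (v : ℝ≥0∞) {n : ℕ} {h : ℕ → ℝ × ℝ}
    (hh : IsAdmissible n h) :
    ∀ᵐ p ∂(pathLaw μ η T v n h), Tendsto (fun n => (p n).2) atTop atTop := by
  have hm := hη.isFresh.measurable_path_const v n h
  have h2 : ∀ k, Measurable fun h : ℕ → ℝ × ℝ => (h k).2 := fun k =>
    measurable_snd.comp (measurable_pi_apply k)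
  have h1 := ae_of_ae_map hm.aemeasurable (pathLaw_ae_isAdmissible (v := v) hη.isFresh hh)
  rw [pathLaw, ae_map_iff hm.aemeasurable (measurableSet_tendsto atTop h2)]
  filter_upwards [h1, hη.ae_tendsto_average] with ω hω havg
  set p := path v n h ((η ω).inter (exploredBy n h)ᶜ) (T ω) with hp
  have h3 : ∀ k, (p n).2 + ∑ i ∈ Finset.range k, T ω i ≤ (p (n + k)).2 := by
    intro k
    induction k with
    | zero => simp
    | succ k ih =>
      have h4 := (hω (k + 1)).time_nonneg le_rfl
      rw [Finset.sum_range_succ]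
      rw [hp, path_add_succ] at ih h4 ⊢
      have := orbit_time_succ_ge h4
      linarith
  rw [← tendsto_add_atTop_iff_nat n]
  refine tendsto_atTop_mono (fun k => ?_)
    (tendsto_atTop_add_const_left _ (p n).2 (tendsto_sum_of_average havg))
  rw [add_comm k n]
  exact h3 k

end

section
variable {Ω : Type*} [MeasurableSpace Ω] {μ : Measure Ω} [IsProbabilityMeasure μ] {lam : ℝ}
  {η : Ω → Conf} {T : Ω → ℕ → ℝ} {v : ℝ≥0∞}

/-! ### Starting to move to the right -/

lemma exists_ofReal_le {v : ℝ≥0∞} (hv : 0 < v) : ∃ d : ℝ, 0 < d ∧ d ≤ 1 ∧ ENNReal.ofReal d ≤ v := by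
  have hne : min v 1 ≠ ∞ := ne_top_of_le_ne_top ENNReal.one_ne_top (min_le_right _ _)
  refine ⟨(min v 1).toReal, ENNReal.toReal_pos (lt_min hv one_pos).ne' hne, ?_, ?_⟩
  · simpa using ENNReal.toReal_mono ENNReal.one_ne_top (min_le_right v 1)
  · rw [ENNReal.ofReal_toReal hne]
    exact min_le_left _ _

/-- All sufficiently large values of the clock are large enough. -/
lemma exists_largeClock (hη : IsInput μ lam η T) (hlam : 0 < lam) (hv : 0 < v) :
    ∃ M, ∀ a, M ≤ a → LargeClock μ T lam v a := by
  obtain ⟨d, hd0, hd1, hdv⟩ := exists_ofReal_le hv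
  obtain ⟨α, hα, hint⟩ := hη.exists_exp
  set K : ℝ := ∫ ω, Real.exp (α * T ω 0) ∂μ with hK
  set q : ℝ := μ.real {ω | 1 ≤ T ω 0} with hq
  have hTi : Integrable (fun ω => T ω 0) μ := by
    by_contra h
    have := hη.service_mean
    rw [integral_undef h] at this
    exact zero_ne_one this
  have hq0 : 0 < q := ENNReal.toReal_pos (measure_one_le_pos hTi hη.service_mean).ne'
    (measure_ne_top _ _)
  set l := min lam 1 with hl
  have hl0 : 0 < l := lt_min hlam one_pos
  have htail : ∀ a, μ.real {ω | a < T ω 0} ≤ K * Real.exp (-(α * a)) := by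
    intro a
    have h1 := mul_meas_ge_le_integral_of_nonneg (μ := μ) (f := fun ω => Real.exp (α * T ω 0))
      (ae_of_all _ fun ω => (Real.exp_pos _).le) hint (Real.exp (α * a))
    have h2 : μ.real {ω | a < T ω 0} ≤ μ.real {ω | Real.exp (α * a) ≤ Real.exp (α * T ω 0)} := by
      refine measureReal_mono fun ω hω => Real.exp_le_exp.2 ?_
      have hω' : a < T ω 0 := hω
      nlinarith
    rw [Real.exp_neg, ← div_eq_mul_inv, le_div_iff₀ (Real.exp_pos _), mul_comm]
    exact (mul_le_mul_of_nonneg_left h2 (Real.exp_pos _).le).trans h1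
  -- After multiplication by `a ^ 17` the gain is the positive constant `l / 2 ^ 17 * q`, while all
  -- the losses tend to zero. The exponential moment is needed for the tail of the service.
  have hlim : Tendsto (fun a : ℝ => a ^ 17 * Real.exp (-a) +
      K / α ^ 17 * ((α * a) ^ 17 * Real.exp (-(α * a))) + a⁻¹ + l / 2 ^ 17 * a⁻¹) atTop
      (𝓝 (0 + K / α ^ 17 * 0 + 0 + l / 2 ^ 17 * 0)) := by
    have h1 := Real.tendsto_pow_mul_exp_neg_atTop_nhds_zero 17
    have h2 := h1.comp (tendsto_id.const_mul_atTop hα)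
    have h3 : Tendsto (fun a : ℝ => a⁻¹) atTop (𝓝 0) := tendsto_inv_atTop_zero
    exact ((h1.add (h2.const_mul _)).add h3).add (h3.const_mul _)
  simp only [mul_zero, add_zero] at hlim
  have hev := hlim.eventually (gt_mem_nhds (show 0 < l / 2 ^ 17 * q by positivity))
  obtain ⟨M₀, hM₀⟩ := eventually_atTop.1 hev
  -- The three bounds serve the loss, the travel time over a distance `7 / a ^ 15`, and the zone;
  -- `8268 = 26 * 318`, with `ageBound a ≤ 318 * a ^ 8`.
  refine ⟨max M₀ (max (7 / d) (26 + 8268 * lam)), fun a ha => ?_⟩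
  have ha1 : M₀ ≤ a := (le_max_left _ _).trans ha
  have ha2 : 7 / d ≤ a := ((le_max_left _ _).trans (le_max_right _ _)).trans ha
  have ha3 : 26 + 8268 * lam ≤ a := ((le_max_right _ _).trans (le_max_right _ _)).trans ha
  have ha : 1 ≤ a := by linarith
  have hage : ageBound a ≤ 318 * a ^ 8 := by
    unfold ageBound
    have : (1 : ℝ) ≤ a ^ 7 := one_le_pow₀ ha
    calc (a + 1) * (3 + 156 * a ^ 7) ≤ (2 * a) * (159 * a ^ 7) := by
          apply mul_le_mul <;> linarith
      _ = _ := by ring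
  have h8 : (1 : ℝ) ≤ a ^ 8 := one_le_pow₀ ha
  have hage' : lam * ageBound a ≤ lam * (318 * a ^ 8) := mul_le_mul_of_nonneg_left hage hlam.le
  have h98 : (26 + 8268 * lam) * a ^ 8 ≤ a ^ 9 := by
    rw [show a ^ 9 = a * a ^ 8 by ring]
    exact mul_le_mul_of_nonneg_right ha3 (by positivity)
  refine ⟨by linarith, ?_, ?_, ?_, ?_⟩
  · linarith
  · have h16 : a ^ 9 ≤ a ^ 16 := pow_le_pow_right₀ ha (by norm_num)
    have : 0 ≤ lam * a ^ 8 := by positivity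
    linarith
  · refine le_trans (ENNReal.ofReal_le_ofReal ?_) hdv
    rw [div_le_iff₀ hd0] at ha2
    rw [div_le_iff₀ (by positivity)]
    have : a ≤ a ^ 15 := le_self_pow₀ ha (by norm_num)
    nlinarith
  · have h1 := (hM₀ a ha1).le
    have h2 := htail a
    have h17 : (0 : ℝ) < a ^ 17 := by positivity
    have h3 : clockGain lam a = l / 2 ^ 17 / a ^ 17 := by rw [clockGain, ← hl]; field_simp
    have h5 : clockGain lam a / a ^ 6 ≤ (l / 2 ^ 17 * a⁻¹) / a ^ 17 := by
      rw [h3, div_right_comm, ← div_eq_mul_inv]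
      gcongr
      exact le_self_pow₀ ha (by norm_num)
    have h6 : 1 / a ^ 18 = a⁻¹ / a ^ 17 := by field_simp
    have h7 : K * Real.exp (-(α * a)) =
        K / α ^ 17 * ((α * a) ^ 17 * Real.exp (-(α * a))) / a ^ 17 := by
      field_simp
    have h8 : Real.exp (-a) = a ^ 17 * Real.exp (-a) / a ^ 17 := by field_simp
    calc _ ≤ a ^ 17 * Real.exp (-a) / a ^ 17 +
          K / α ^ 17 * ((α * a) ^ 17 * Real.exp (-(α * a))) / a ^ 17 + a⁻¹ / a ^ 17 +
          (l / 2 ^ 17 * a⁻¹) / a ^ 17 := by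
            rw [← h8, ← h7, ← h6]; linarith
      _ = (a ^ 17 * Real.exp (-a) + K / α ^ 17 * ((α * a) ^ 17 * Real.exp (-(α * a))) + a⁻¹ +
          l / 2 ^ 17 * a⁻¹) / a ^ 17 := by ring
      _ ≤ l / 2 ^ 17 * q / a ^ 17 := by gcongr
      _ = _ := by rw [h3]; ring

lemma le_pathLaw_of_step (hη : IsFresh μ η T) {n : ℕ} {h : ℕ → ℝ × ℝ} (hh : 0 ≤ (h n).2)
    {A : Set (ℕ → ℝ × ℝ)} (hA : MeasurableSet A) {E : Set Ω} (hE : MeasurableSet E) {β : ℝ≥0∞}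
    (hs : ∀ ω ∈ E, ∀ c, IsStrictNearest (h n) ((η ω).inter (exploredBy n h)ᶜ).carrier c →
      β ≤ pathLaw μ η T v (n + 1) (serve v n h c (T ω 0)) A) :
    μ E * β ≤ pathLaw μ η T v n h A := by
  rw [pathLaw_step v hη hh hA, mul_comm, ← setLIntegral_const]
  refine le_trans (setLIntegral_mono_ae' hE ?_) (setLIntegral_le_lintegral E _)
  filter_upwards [hη.ae_nearest hh] with ω hω hωE
  obtain ⟨c, hc⟩ := hω
  rw [hc.extend_eq]
  exact hs ω hωE c hc

omit [IsProbabilityMeasure μ] in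
lemma IsInput.measurableSet_step_event (hη : IsInput μ lam η T) {B₀ B₁ : Set (ℝ × ℝ)}
    (h0 : MeasurableSet B₀) (h1 : MeasurableSet B₁) {K : Set ℝ} (hK : MeasurableSet K) :
    MeasurableSet {ω | (count (fun ω => (η ω).carrier) B₀ ω = 0 ∧
      count (fun ω => (η ω).carrier) B₁ ω ≠ 0) ∧ T ω 0 ∈ K} :=
  ((hη.poisson.measurable_count B₀ h0 (measurableSet_singleton 0)).inter
    (hη.poisson.measurable_count B₁ h1 (measurableSet_singleton 0)).compl).inter
    (hη.measurable_service_apply 0 hK)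

/-- The probability that there is no customer in `B₀`, some customer in `B₁`, and that the first
service time is in `K`. -/
lemma IsInput.measure_step_event (hη : IsInput μ lam η T) {B₀ B₁ : Set (ℝ × ℝ)}
    (h0 : MeasurableSet B₀) (h1 : MeasurableSet B₁) (hd : Disjoint B₀ B₁)
    (hf0 : intensity lam B₀ ≠ ∞) (hf1 : intensity lam B₁ ≠ ∞) {K : Set ℝ} (hK : MeasurableSet K) :
    μ {ω | (count (fun ω => (η ω).carrier) B₀ ω = 0 ∧
      count (fun ω => (η ω).carrier) B₁ ω ≠ 0) ∧ T ω 0 ∈ K} =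
      ENNReal.ofReal (Real.exp (-(intensity lam B₀).toReal)) *
        ENNReal.ofReal (1 - Real.exp (-(intensity lam B₁).toReal)) * μ {ω | T ω 0 ∈ K} := by
  have hc0 := hη.poisson.measurable_count B₀ h0
  have hc1 := hη.poisson.measurable_count B₁ h1
  have hcnt : ∀ {B}, MeasurableSet B → Measurable fun s : Conf => s.cnt B := fun {B} hB => by
    simpa using Conf.measurable_cnt (measurable_id (α := Conf)) (MeasurableSet.univ.prod hB)
  have hind := hη.indep.measure_inter_preimage_eq_mul
    {s | s.cnt B₀ = 0 ∧ s.cnt B₁ ≠ 0} {t | t 0 ∈ K}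
    ((hcnt h0 (measurableSet_singleton 0)).inter (hcnt h1 (measurableSet_singleton 0)).compl) (measurable_pi_apply 0 hK)
  refine hind.trans ?_
  congr 1
  have hi : IndepFun (count (fun ω => (η ω).carrier) B₀) (count (fun ω => (η ω).carrier) B₁) μ := by
    have := hη.poisson.iIndepFun_count (κ := Bool) (B := fun b => if b then B₁ else B₀)
      (fun b => by cases b <;> simpa) (fun b b' hbb => by
        cases b <;> cases b' <;> simp_all [disjoint_comm])
    have h2 := this.indepFun (i := false) (j := true) (by simp)
    simpa using h2
  have h2 := hi.measure_inter_preimage_eq_mul {0} {0}ᶜ (measurableSet_singleton 0)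
    (measurableSet_singleton 0).compl
  refine h2.trans ?_
  congr 1
  · exact hη.poisson.measure_count_eq_zero h0 hf0
  · rw [Set.preimage_compl, prob_compl_eq_one_sub (hc1 (measurableSet_singleton 0))]
    have : μ (count (fun ω => (η ω).carrier) B₁ ⁻¹' {0}) = _ :=
      hη.poisson.measure_count_eq_zero h1 hf1
    rw [this, ← ENNReal.ofReal_one, ENNReal.ofReal_sub _ (Real.exp_pos _).le]

lemma intensity_singleton_prod (lam y : ℝ) {S : Set ℝ} (hS : MeasurableSet S) :
    intensity lam ({y} ×ˢ S) = 0 := by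
  have := intensity_prod_le lam (measurableSet_singleton y) hS
  simpa using this

lemma intensity_unexplored_ne_top (lam : ℝ) (n : ℕ) (h : ℕ → ℝ × ℝ) {I : Set ℝ}
    (hI : MeasurableSet I) (hf : volume I ≠ ∞) : intensity lam (unexplored n h I) ≠ ∞ := by
  refine ne_top_of_le_ne_top ?_ ((measure_mono Set.sdiff_subset).trans
    (intensity_prod_le lam hI measurableSet_Icc))
  rw [Real.volume_Icc]
  finiteness

/-- If the unexplored customers close to the server are balanced, then the server starts to move to
the right for ever with a probability bounded from below. -/
lemma le_pathLaw_rightward (hη : IsInput μ lam η T) (hlam : 0 < lam) {M : ℝ}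
    (hL : ∀ a, M ≤ a → LargeClock μ T lam v a) {M₁ κ ρ : ℝ} (hM₁ : 52 * M ≤ M₁)
    (hM₁' : 4 * M ^ 16 ≤ M₁) (hκ : κ ≤ 1) (hκv : ENNReal.ofReal κ ≤ v) {n : ℕ} {h : ℕ → ℝ × ℝ}
    (hh : IsAdmissible n h) (hρ0 : 0 ≤ ρ) (hρ : ρ ≤ κ)
    (hR : intensity lam (unexplored n h (Set.Ioo (h n).1 ((h n).1 + ρ))) = ENNReal.ofReal M₁)
    (hLe : intensity lam (unexplored n h (Set.Ioo ((h n).1 - ρ) (h n).1)) ≤ ENNReal.ofReal M₁) :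
    ENNReal.ofReal (Real.exp (-(2 * M₁))) * ENNReal.ofReal (1 - Real.exp (-(M₁ / 2))) *
      μ {ω | T ω 0 ∈ Set.Iic 1} * (1 / 2) ≤ pathLaw μ η T v n h rightward := by
  have hM4 : 4 ≤ M := (hL M le_rfl).four_le
  set x := (h n).1 with hx
  -- The point `x + u` halves the mass `M₁` on the right.
  obtain ⟨u, hu0, huρ, hu⟩ := exists_intensity_unexplored_eq lam n h x (m := M₁ / 2) (ρ := ρ)
    (by linarith) hρ0 (by rw [hR]; exact ENNReal.ofReal_le_ofReal (by linarith))
  have hupos : 0 < u := by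
    rcases hu0.eq_or_lt with h0 | h0
    · rw [← h0] at hu
      simp only [add_zero, Set.Ioo_self, unexplored, Set.empty_prod, Set.empty_sdiff,
        measure_empty] at hu
      have := (ENNReal.ofReal_pos.2 (show 0 < M₁ / 2 by linarith)).ne'
      exact absurd hu.symm this
    · exact h0
  -- If `B₀` is empty and `B₁` is not, the nearest customer is to the right, beyond half of the mass
  -- and within `ρ`.
  set B₀ := unexplored n h (Set.Ioc (x - ρ) (x + u)) with hB₀
  set B₁ := unexplored n h (Set.Ioo (x + u) (x + ρ)) with hB₁
  have hB₀m : MeasurableSet B₀ := measurableSet_unexplored n h measurableSet_Ioc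
  have hB₁m : MeasurableSet B₁ := measurableSet_unexplored n h measurableSet_Ioo
  have hB₀f : intensity lam B₀ ≠ ∞ :=
    intensity_unexplored_ne_top lam n h measurableSet_Ioc (by simp)
  have hB₁f : intensity lam B₁ ≠ ∞ :=
    intensity_unexplored_ne_top lam n h measurableSet_Ioo (by simp)
  have hd : Disjoint B₀ B₁ := Set.disjoint_left.2 fun c h1 h2 =>
    absurd h1.1.1.2 (not_le.2 h2.1.1.1)
  have hline : ∀ y, intensity lam ({y} ×ˢ Set.Icc 0 (h n).2) = 0 := fun y =>
    intensity_singleton_prod lam y measurableSet_Icc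
  have hB₀le : intensity lam B₀ ≤ ENNReal.ofReal (2 * M₁) := by
    have hsub : B₀ ⊆ (unexplored n h (Set.Ioo (x - ρ) x) ∪ unexplored n h (Set.Ioo x (x + u))) ∪
        (({x} ×ˢ Set.Icc 0 (h n).2) ∪ ({x + u} ×ˢ Set.Icc 0 (h n).2)) := by
      rintro c ⟨⟨hc1, hc2⟩, hc3⟩
      rcases lt_trichotomy c.1 x with h1 | h1 | h1
      · exact Or.inl (Or.inl ⟨⟨⟨hc1.1, h1⟩, hc2⟩, hc3⟩)
      · exact Or.inr (Or.inl ⟨h1, hc2⟩)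
      · rcases hc1.2.lt_or_eq with h2 | h2
        · exact Or.inl (Or.inr ⟨⟨⟨h1, h2⟩, hc2⟩, hc3⟩)
        · exact Or.inr (Or.inr ⟨h2, hc2⟩)
    refine (measure_mono hsub).trans ((measure_union_le _ _).trans ((add_le_add
      ((measure_union_le _ _).trans (add_le_add hLe hu.le)) ((measure_union_le _ _).trans
        (add_le_add (hline x).le (hline (x + u)).le))).trans ?_))
    rw [add_zero, add_zero, ← ENNReal.ofReal_add (by linarith) (by linarith)]
    exact ENNReal.ofReal_le_ofReal (by linarith)
  have hB₁ge : ENNReal.ofReal (M₁ / 2) ≤ intensity lam B₁ := by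
    have hsub : unexplored n h (Set.Ioo x (x + ρ)) ⊆ (unexplored n h (Set.Ioo x (x + u)) ∪
        ({x + u} ×ˢ Set.Icc 0 (h n).2)) ∪ B₁ := by
      rintro c ⟨⟨hc1, hc2⟩, hc3⟩
      rcases lt_trichotomy c.1 (x + u) with h1 | h1 | h1
      · exact Or.inl (Or.inl ⟨⟨⟨hc1.1, h1⟩, hc2⟩, hc3⟩)
      · exact Or.inl (Or.inr ⟨h1, hc2⟩)
      · exact Or.inr ⟨⟨⟨h1, hc1.2⟩, hc2⟩, hc3⟩
    have h1 := (measure_mono (μ := intensity lam) hsub).trans ((measure_union_le _ _).trans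
      (add_le_add ((measure_union_le _ _).trans (add_le_add hu.le (hline _).le)) le_rfl))
    rw [hR, add_zero] at h1
    have h2 : ENNReal.ofReal M₁ = ENNReal.ofReal (M₁ / 2) + ENNReal.ofReal (M₁ / 2) := by
      rw [← ENNReal.ofReal_add (by linarith) (by linarith), add_halves]
    rw [h2] at h1
    exact (ENNReal.add_le_add_iff_left ENNReal.ofReal_ne_top).1 h1
  set ws := M₁ / (4 * u) with hws
  have hws0 : 0 < ws := div_pos (by linarith) (by linarith)
  have hwsu : ws * (4 * u) = M₁ := div_mul_cancel₀ _ (by positivity)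
  -- From `M₁ / 2 ≤ u * (1 + density)`; the summand `1` costs at most half of this, because `u ≤ 1`
  -- and `M₁` is large.
  have hdens : ws ≤ density lam n h (x + u) := by
    have h1 := intensity_unexplored_le hlam.le hh (e := x) (z := x + u) le_rfl (by linarith)
    have hdn : 0 ≤ density lam n h (x + u) := mul_nonneg hlam.le ENNReal.toReal_nonneg
    rw [hu, add_sub_cancel_left, ENNReal.ofReal_le_ofReal_iff (by positivity)] at h1
    by_contra! hlt
    have h2 : u * density lam n h (x + u) < u * ws := mul_lt_mul_of_pos_left hlt hupos
    nlinarith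
  have hpow : M ^ 16 ≤ ws := by
    rw [hws, le_div_iff₀ (by positivity)]
    have : 0 ≤ M ^ 16 := by positivity
    nlinarith
  have hstep : ∀ ω ∈ {ω | (count (fun ω => (η ω).carrier) B₀ ω = 0 ∧
      count (fun ω => (η ω).carrier) B₁ ω ≠ 0) ∧ T ω 0 ∈ Set.Iic 1}, ∀ c,
      IsStrictNearest (h n) ((η ω).inter (exploredBy n h)ᶜ).carrier c →
      1 / 2 ≤ pathLaw μ η T v (n + 1) (serve v n h c (T ω 0)) rightward := by
    rintro ω ⟨⟨hω0, hω1⟩, hωT⟩ c hc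
    have hωT : T ω 0 ≤ 1 := hωT
    have hcη : c ∈ (η ω).carrier := hc.1.1.1
    have hcR : c ∉ exploredBy n h := hc.1.1.2
    have hct : c.2 ≤ (h n).2 := hc.1.2
    have hcd : |c.1 - x| < ρ := by
      obtain ⟨d, hdη, hdB⟩ : ∃ d ∈ (η ω).carrier, d ∈ B₁ := by
        by_contra! hcon
        exact hω1 (count_eq_zero_iff.2 hcon)
      refine (hc.abs_le ⟨hdη, hdB.2⟩ hdB.1.2.2).trans_lt ?_
      rw [abs_of_nonneg (by linarith [hdB.1.1.1])]
      linarith [hdB.1.1.2]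
    have hcx : x + u < c.1 := by
      by_contra! hle
      refine count_eq_zero_iff.1 hω0 c hcη ⟨⟨⟨?_, hle⟩, (η ω).nonneg c hcη, hct⟩, hcR⟩
      linarith [neg_abs_le (c.1 - x)]
    have habs : |c.1 - x| = c.1 - x := abs_of_nonneg (by linarith)
    have htr : travelTime v x c.1 ≤ 1 := travelTime_le_one hκv (hcd.le.trans hρ)
    have hτ := hη.nonneg ω 0
    have hadm := hh.serve (v := v) c hτ
    have hd1 := density_serve_ge hlam.le hh (v := v) (c := c) (e := x + u) (e' := c.1) hτ
      (by linarith) hcx.le (by rw [← hx, habs]; linarith)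
    have hd2 : 0 ≤ lam * ((serve v n h c (T ω 0) (n + 1)).2 - (h n).2) := by
      refine mul_nonneg hlam.le ?_
      rw [serve_succ]
      have := travelTime_nonneg v (h n).1 c.1
      simp only
      linarith
    have F : Frontier lam M ws (n + 1) (n + 1) (serve v n h c (T ω 0)) 0 M
        (density lam (n + 1) (serve v n h c (T ω 0)) c.1) c.1 := by
      refine ⟨hadm, le_rfl, by norm_num, by simp, le_rfl, by linarith, by linarith, le_rfl,
        by simp only [sub_self, mul_zero, add_zero]; linarith, ?_, ?_, ?_, ?_⟩
      · intro j hj1 hj2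
        rw [le_antisymm hj2 hj1, serve_succ]
      · rw [serve_succ]; norm_num
      · intro d hd hb hde
        rw [exploredBy_serve, Set.mem_union, not_or] at hd
        rw [serve_succ] at hb ⊢
        simp only at hb ⊢
        -- This uses `52 * M ≤ M₁`. The step explores from `c.1` back to the mirror image of `c.1`,
        -- a length of at least `2 * u`, so unexplored customers in that range arrived after the
        -- departure.
        have h26 : 26 * M / ws ≤ 2 * u := by
          rw [div_le_iff₀ hws0]
          nlinarith
        have hdt : (h n).2 < d.2 := by
          by_contra! hlt
          refine hd.2 ⟨?_, hlt⟩
          rw [← hx, habs, abs_le]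
          constructor <;> linarith
        have h3 : (0 : ℝ) ≤ 12 * M ^ 6 * ((c.1 - d.1) *
            density lam (n + 1) (serve v n h c (T ω 0)) c.1) := by
          have : 0 ≤ c.1 - d.1 := by linarith
          have : 0 ≤ density lam (n + 1) (serve v n h c (T ω 0)) c.1 := by linarith
          positivity
        have h4 : (M + 1) * 1 ≤ (M + 1) * (1 + ((0 : ℕ) : ℝ) + 12 * M ^ 6 * ((c.1 - d.1) *
            density lam (n + 1) (serve v n h c (T ω 0)) c.1)) := by
          gcongr
          push_cast
          linarith
        linarith
      · rw [sub_self, serve_succ]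
        simp only [sub_self, zero_mul, mul_zero, Nat.cast_zero, add_zero, mul_one]
        linarith
    refine (F.half_le_pathLaw hη hlam hws0 hL).trans (measure_mono_ae ?_)
    filter_upwards [pathLaw_ae_tendsto hη v hadm] with p hp hpS
    exact iInter_steady_subset hlam hpS hp
  refine le_trans ?_ (le_pathLaw_of_step hη.isFresh (hh.time_nonneg le_rfl) measurableSet_rightward
    (hη.measurableSet_step_event hB₀m hB₁m measurableSet_Iic) hstep)
  rw [hη.measure_step_event hB₀m hB₁m hd hB₀f hB₁f measurableSet_Iic]
  gcongr
  · exact ENNReal.toReal_le_of_le_ofReal (by linarith) hB₀le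
  · have := ENNReal.toReal_mono hB₁f hB₁ge
    rwa [ENNReal.toReal_ofReal (by linarith)] at this

end

section
variable {Ω : Type*} [MeasurableSpace Ω] {μ : Measure Ω} [IsProbabilityMeasure μ] {lam : ℝ}
  {η : Ω → Conf} {T : Ω → ℕ → ℝ} {v : ℝ≥0∞}

/-! ### Accumulation of customers around the server -/

/-- Since the time `t₀` the server has explored only a neighbourhood of `X`, in `j` short steps,
while at least one unit of time has passed during each of them and the one before. -/
structure Localized (t₀ X κ : ℝ) (j n : ℕ) (h : ℕ → ℝ × ℝ) : Prop where
  admissible : IsAdmissible n h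
  start_nonneg : 0 ≤ t₀
  explored_le : ∀ c ∈ exploredBy n h, t₀ < c.2 → |c.1 - X| ≤ 2 * j * κ
  dist_le : |(h n).1 - X| ≤ j * κ
  recent : ∀ c ∈ exploredBy n h, c.2 ≤ (h n).2 - 1
  elapsed : t₀ + j + 1 ≤ (h n).2

namespace Localized
variable {t₀ X κ : ℝ} {j n : ℕ} {h : ℕ → ℝ × ℝ}

lemma reflectPath (L : Localized t₀ X κ j n h) :
    Localized t₀ (-X) κ j n (reflectPath h) := by
  have h1 : ∀ y, |-y + X| = |y - X| := fun y => by rw [← abs_neg]; congr 1; ring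
  refine ⟨L.admissible.reflectPath, L.start_nonneg, fun c hc hct => ?_, ?_, fun c hc => ?_, L.elapsed⟩
  · rw [exploredBy_reflectPath] at hc
    have := L.explored_le _ hc hct
    rw [reflectPoint, ← h1] at this
    simpa using this
  · have := L.dist_le
    rw [← h1] at this
    simpa [GreedyServer.reflectPath, reflectPoint] using this
  · rw [exploredBy_reflectPath] at hc
    exact L.recent (reflectPoint c) hc

lemma init (hh : IsAdmissible n h) (κ : ℝ) (v : ℝ≥0∞) (c : ℝ × ℝ) {τ : ℝ} (hτ : 1 ≤ τ) :
    Localized (h n).2 c.1 κ 0 (n + 1) (serve v n h c τ) := by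
  have htr := travelTime_nonneg v (h n).1 c.1
  have hle : ∀ d ∈ exploredBy (n + 1) (serve v n h c τ), d.2 ≤ (h n).2 := by
    intro d hd
    rw [exploredBy_serve] at hd
    rcases hd with hd | hd
    · exact hh.exploredBy_time_le hd
    · exact hd.2
  refine ⟨hh.serve c (by linarith), hh.time_nonneg le_rfl, fun d hd hdt => ?_, ?_, fun d hd => ?_, ?_⟩
  · exact absurd (hle d hd) (not_le.2 hdt)
  · rw [serve_succ]; simp
  · have := hle d hd
    rw [serve_succ]
    simp only
    linarith
  · rw [serve_succ]
    push_cast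
    linarith

/-- A step of length at most `κ` explores at most `κ` around a position within `j * κ` of `X`, and a
service of at least one unit makes everything explored at least one unit old. -/
lemma serve (L : Localized t₀ X κ j n h) (v : ℝ≥0∞) {c : ℝ × ℝ} {τ : ℝ} (hτ : 1 ≤ τ)
    (hc : |c.1 - (h n).1| ≤ κ) : Localized t₀ X κ (j + 1) (n + 1) (serve v n h c τ) := by
  have htr := travelTime_nonneg v (h n).1 c.1
  have hκ : 0 ≤ κ := (abs_nonneg _).trans hc
  have hj : (0 : ℝ) ≤ j * κ := by positivity
  refine ⟨L.admissible.serve c (by linarith), L.start_nonneg, fun d hd hdt => ?_, ?_, fun d hd => ?_, ?_⟩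
  · rw [exploredBy_serve] at hd
    push_cast
    rcases hd with hd | hd
    · linarith [L.explored_le d hd hdt]
    · linarith [abs_sub_le d.1 (h n).1 X, hd.1, L.dist_le]
  · rw [serve_succ]
    push_cast
    linarith [abs_sub_le c.1 (h n).1 X, L.dist_le]
  · rw [exploredBy_serve] at hd
    rw [serve_succ]
    simp only
    rcases hd with hd | hd
    · linarith [L.recent d hd]
    · linarith [hd.2]
  · rw [serve_succ]
    push_cast
    linarith [L.elapsed]

/-- Since `t₀` nothing has been explored farther than `2 * j * κ` from `X`, hence farther than `3 *
j * κ` from the server. This leaves at least half of the length `K`, over a time of at least `j`. -/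
lemma le_intensity (L : Localized t₀ X κ j n h) (hlam : 0 ≤ lam) {K : ℝ} (hκ : 0 ≤ κ)
    (hK : 6 * j * κ ≤ K) :
    ENNReal.ofReal (lam * (K / 2 * j)) ≤
      intensity lam (unexplored n h (Set.Ioo (h n).1 ((h n).1 + K))) := by
  set x := (h n).1 with hx
  have hj : (0 : ℝ) ≤ j * κ := by positivity
  have hK0 : 0 ≤ K := by linarith
  have hsub : Set.Ioo (x + 3 * j * κ) (x + K) ×ˢ Set.Ioc t₀ (h n).2 ⊆
      unexplored n h (Set.Ioo x (x + K)) := by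
    rintro d ⟨hd1, hd2⟩
    refine ⟨⟨⟨by linarith [hd1.1], hd1.2⟩, L.start_nonneg.trans hd2.1.le, hd2.2⟩, fun hd => ?_⟩
    have h1 := L.explored_le d hd hd2.1
    have h2 := le_abs_self (d.1 - X)
    have h3 := neg_abs_le (x - X)
    linarith [L.dist_le, hd1.1]
  refine le_trans ?_ ((intensity_prod_ge lam measurableSet_Ioo measurableSet_Ioc fun s hs =>
    L.start_nonneg.trans_lt hs.1).trans (measure_mono hsub))
  rw [Real.volume_Ioo, Real.volume_Ioc, ← ENNReal.ofReal_mul (by linarith), ← ENNReal.ofReal_mul hlam]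
  refine ENNReal.ofReal_le_ofReal (mul_le_mul_of_nonneg_left ?_ hlam)
  have := L.elapsed
  exact mul_le_mul (by linarith) (by linarith) (by positivity) (by linarith)

end Localized

/-- The paths that move to the right or to the left. -/
def oneWay : Set (ℕ → ℝ × ℝ) := rightward ∪ reflectPath ⁻¹' rightward

lemma measurableSet_oneWay : MeasurableSet oneWay :=
  measurableSet_rightward.union (measurable_reflectPath measurableSet_rightward)

lemma intensity_unexplored_reflectPath (lam : ℝ) (n : ℕ) (h : ℕ → ℝ × ℝ) (a b : ℝ) :
    intensity lam (unexplored n (reflectPath h) (Set.Ioo (-b) (-a))) =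
      intensity lam (unexplored n h (Set.Ioo a b)) := by
  rw [← intensity_preimage_reflectPoint lam (measurableSet_unexplored n h measurableSet_Ioo)]
  congr 1
  ext c
  simp only [unexplored, exploredBy_reflectPath, Set.mem_sdiff, Set.mem_prod, Set.mem_Ioo,
    Set.mem_Icc, Set.mem_preimage, reflectPoint, reflectPath]
  refine and_congr_left fun _ => and_congr_left fun _ => ?_
  constructor <;> rintro ⟨h1, h2⟩ <;> constructor <;> linarith

/-- From every history, the server moves in one direction for ever with a probability bounded from
below. -/
lemma exists_le_pathLaw_oneWay (hη : IsInput μ lam η T) (hlam : 0 < lam) (hv : 0 < v) :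
    ∃ δ : ℝ, 0 < δ ∧ ∀ n h, IsAdmissible n h → ENNReal.ofReal δ ≤ pathLaw μ η T v n h oneWay := by
  obtain ⟨M, hL⟩ := exists_largeClock hη hlam hv
  obtain ⟨κ, hκ0, hκ1, hκv⟩ := exists_ofReal_le hv
  have hM4 : 4 ≤ M := (hL M le_rfl).four_le
  have hTi : Integrable (fun ω => T ω 0) μ := by
    by_contra h
    have := hη.service_mean
    rw [integral_undef h] at this
    exact zero_ne_one this
  set M₁ : ℝ := max (52 * M) (4 * M ^ 16) with hM₁
  have hM₁0 : 0 < M₁ := lt_max_of_lt_left (by linarith)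
  -- The number of short steps, large enough for the mass `lam * (κ / 2 * m)` accumulated within `κ`
  -- to reach `M₁`.
  set m : ℕ := ⌈2 * M₁ / (lam * κ)⌉₊ with hm
  have hmge : M₁ ≤ lam * (κ / 2 * m) := by
    have := Nat.le_ceil (2 * M₁ / (lam * κ))
    rw [div_le_iff₀ (by positivity)] at this
    linarith
  have hm0 : (0 : ℝ) < m := by
    by_contra! hle
    have : lam * (κ / 2 * m) ≤ 0 := by
      have : lam * (κ / 2 * m) = lam * κ / 2 * m := by ring
      rw [this]
      exact mul_nonpos_of_nonneg_of_nonpos (by positivity) hle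
    linarith
  -- The step length is so short that `m` steps leave half of the length `κ` unexplored on either
  -- side.
  set r : ℝ := κ / (6 * m) with hr
  have hr0 : 0 < r := by positivity
  have hrm : 6 * m * r = κ := by rw [hr]; field_simp
  set β : ℝ≥0∞ := ENNReal.ofReal (Real.exp (-(2 * M₁))) * ENNReal.ofReal (1 - Real.exp (-(M₁ / 2))) *
      μ {ω | T ω 0 ∈ Set.Iic 1} * (1 / 2) with hβ
  set q : ℝ≥0∞ := ENNReal.ofReal (1 - Real.exp (-(lam * r))) * μ {ω | T ω 0 ∈ Set.Ici 1} with hq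
  have hexp : ∀ y : ℝ, 0 < y → 0 < ENNReal.ofReal (1 - Real.exp (-y)) := fun y hy =>
    ENNReal.ofReal_pos.2 (sub_pos.2 (by simpa using Real.exp_lt_exp.2 (neg_lt_zero.2 hy)))
  have hβ0 : β ≠ 0 := by
    refine mul_ne_zero (mul_ne_zero (mul_ne_zero ?_ ?_) ?_) (by simp)
    · exact (ENNReal.ofReal_pos.2 (Real.exp_pos _)).ne'
    · exact (hexp _ (by linarith)).ne'
    · exact (measure_le_one_pos hTi hη.service_mean).ne'
  have hT1 : μ {ω | T ω 0 ∈ Set.Ici 1} ≠ 0 := (measure_one_le_pos hTi hη.service_mean).ne'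
  have hq0 : q ≠ 0 := mul_ne_zero (hexp _ (by positivity)).ne' hT1
  have hbase : ∀ {t₀ X n h}, Localized t₀ X r m n h → β ≤ pathLaw μ η T v n h oneWay := by
    intro t₀ X n h L
    have hex : ∀ {X h}, Localized t₀ X r m n h → ∃ u, 0 ≤ u ∧ u ≤ κ ∧
        intensity lam (unexplored n h (Set.Ioo (h n).1 ((h n).1 + u))) = ENNReal.ofReal M₁ :=
      fun L => exists_intensity_unexplored_eq lam _ _ _ hM₁0.le hκ0.le
        ((ENNReal.ofReal_le_ofReal hmge).trans (L.le_intensity hlam.le hr0.le hrm.le))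
    have hmono : ∀ {h : ℕ → ℝ × ℝ} {a b c : ℝ}, b ≤ c → intensity lam
        (unexplored n h (Set.Ioo a b)) ≤ intensity lam (unexplored n h (Set.Ioo a c)) :=
      fun hbc => measure_mono (Set.sdiff_subset_sdiff_left
        (Set.prod_mono (Set.Ioo_subset_Ioo_right hbc) le_rfl))
    obtain ⟨ρ, hρ0, hρ, hρM⟩ := hex L
    obtain ⟨ρ', hρ'0, hρ', hρ'M⟩ := hex L.reflectPath
    have hx : ((reflectPath h) n).1 = -(h n).1 := rfl
    rw [hx] at hρ'M
    -- The server is sent to the side where the mass `M₁` is reached sooner; within the same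
    -- distance the other side then has mass at most `M₁`.
    rcases le_total ρ ρ' with hle | hle
    · refine (le_pathLaw_rightward hη hlam hL (le_max_left _ _) (le_max_right _ _) hκ1 hκv
        L.admissible hρ0 hρ hρM ?_).trans (measure_mono Set.subset_union_left)
      rw [← hρ'M, ← intensity_unexplored_reflectPath]
      refine hmono ?_
      linarith
    · have h1 := le_pathLaw_rightward hη hlam hL (le_max_left _ _) (le_max_right _ _) hκ1 hκv
        L.reflectPath.admissible hρ'0 hρ' (by rw [hx]; exact hρ'M) (by
          rw [← hρM, hx, show -(h n).1 - ρ' = -((h n).1 + ρ') by ring,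
            intensity_unexplored_reflectPath]
          exact hmono (by linarith))
      rw [pathLaw_reflectPath hη, Measure.map_apply measurable_reflectPath measurableSet_rightward]
        at h1
      exact h1.trans (measure_mono Set.subset_union_right)
  have hind : ∀ k : ℕ, ∀ {j : ℕ} {t₀ X n h}, j + k = m → Localized t₀ X r j n h →
      q ^ k * β ≤ pathLaw μ η T v n h oneWay := by
    intro k
    induction k with
    | zero =>
      intro j t₀ X n h hj L
      rw [pow_zero, one_mul]
      obtain rfl : j = m := hj
      exact hbase L
    | succ k ih =>
      intro j t₀ X n h hj L
      -- Everything explored is at least one unit old, so the arrivals of the last unit of time are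
      -- unexplored; one of them within `r` forces a short step.
      set B := Set.Ioo (h n).1 ((h n).1 + r) ×ˢ Set.Ioc ((h n).2 - 1) (h n).2 with hB
      have hBm : MeasurableSet B := measurableSet_Ioo.prod measurableSet_Ioc
      have ht1 : 0 ≤ (h n).2 - 1 := by
        have : (0 : ℝ) ≤ j := by positivity
        linarith [L.elapsed, L.start_nonneg]
      have hBf : intensity lam B ≠ ∞ := by
        refine ne_top_of_le_ne_top ?_ (intensity_prod_le lam measurableSet_Ioo measurableSet_Ioc)
        rw [Real.volume_Ioo, Real.volume_Ioc]
        finiteness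
      have hBge : ENNReal.ofReal (lam * r) ≤ intensity lam B := by
        refine le_trans (le_of_eq ?_) (intensity_prod_ge lam measurableSet_Ioo measurableSet_Ioc
          fun s hs => ht1.trans_lt hs.1)
        rw [Real.volume_Ioo, Real.volume_Ioc, ← ENNReal.ofReal_mul (by linarith),
          ← ENNReal.ofReal_mul hlam.le]
        congr 1
        ring
      have hstep := le_pathLaw_of_step (v := v) hη.isFresh (L.admissible.time_nonneg le_rfl)
        measurableSet_oneWay
        (hη.measurableSet_step_event MeasurableSet.empty hBm (measurableSet_Ici (a := (1 : ℝ))))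
        (β := q ^ k * β) (fun ω hω c hc => by
          obtain ⟨⟨-, hω1⟩, hωT⟩ := hω
          refine ih (j := j + 1) (by omega) (L.serve v hωT ?_)
          obtain ⟨d, hdη, hdB⟩ : ∃ d ∈ (η ω).carrier, d ∈ B := by
            by_contra! hcon
            exact hω1 (count_eq_zero_iff.2 hcon)
          refine (hc.abs_le ⟨hdη, fun hd => ?_⟩ hdB.2.2).trans ?_
          · linarith [L.recent d hd, hdB.2.1]
          · rw [abs_of_nonneg (by linarith [hdB.1.1])]
            linarith [hdB.1.2])
      refine le_trans ?_ hstep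
      rw [hη.measure_step_event MeasurableSet.empty hBm (Set.empty_disjoint _) (by simp) hBf
        measurableSet_Ici, pow_succ', mul_assoc, hq, measure_empty, ENNReal.toReal_zero, neg_zero,
        Real.exp_zero, ENNReal.ofReal_one, one_mul]
      gcongr
      have := ENNReal.toReal_mono hBf hBge
      rwa [ENNReal.toReal_ofReal (by positivity)] at this
  -- From an arbitrary history, a first service of length at least one starts the localization
  -- around wherever the server is then; `m` short steps and the final jump follow.
  obtain ⟨δ, hδ0, -, hδ⟩ := exists_ofReal_le (v := μ {ω | T ω 0 ∈ Set.Ici 1} * (q ^ m * β))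
    (pos_iff_ne_zero.2 (mul_ne_zero hT1 (mul_ne_zero (pow_ne_zero _ hq0) hβ0)))
  refine ⟨δ, hδ0, fun n h hh => hδ.trans ?_⟩
  exact le_pathLaw_of_step hη.isFresh (hh.time_nonneg le_rfl) measurableSet_oneWay
    (hη.measurable_service_apply 0 measurableSet_Ici)
    fun ω hω c hc => hind m (by omega) (Localized.init hh r v c hω)

lemma Conf.inter_exploredBy_zero (s : Conf) (h : ℕ → ℝ × ℝ) : s.inter (exploredBy 0 h)ᶜ = s := by
  apply Conf.ext'
  simp [Conf.inter, exploredBy]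

/-- Almost surely the server moves to the right or to the left. -/
lemma ae_oneWay (hη : IsInput μ lam η T) (hlam : 0 < lam) (hv : 0 < v) :
    ∀ᵐ ω ∂μ, path v 0 (fun _ => 0) (η ω) (T ω) ∈ oneWay := by
  obtain ⟨δ, hδ, hlow⟩ := exists_le_pathLaw_oneWay hη hlam hv
  have h1 := pathLaw_eq_one v hη.isFresh (h := fun _ => 0) le_rfl measurableSet_oneWay hδ hlow
  rw [pathLaw_apply v hη.isFresh _ _ measurableSet_oneWay.compl] at h1
  simp only [Conf.inter_exploredBy_zero] at h1
  exact h1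

/-- The two directions are equally likely. -/
lemma measure_rightward_eq (hη : IsInput μ lam η T) :
    μ {ω | path v 0 (fun _ => 0) (η ω) (T ω) ∈ rightward} =
      μ {ω | path v 0 (fun _ => 0) (η ω) (T ω) ∈ reflectPath ⁻¹' rightward} := by
  have h3 : reflectPath (fun _ => 0) = fun _ => 0 := by
    funext k
    simp [reflectPath, reflectPoint]
  have h1 := congrArg (fun ν => ν rightward) (pathLaw_reflectPath hη v 0 fun _ => 0)
  rw [h3, Measure.map_apply measurable_reflectPath measurableSet_rightward,
    pathLaw_apply v hη.isFresh _ _ measurableSet_rightward,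
    pathLaw_apply v hη.isFresh _ _ (measurable_reflectPath measurableSet_rightward)] at h1
  simpa only [Conf.inter_exploredBy_zero] using h1

end

/-! ### Runs of the greedy server -/

/-- The path `p` of a greedy server that starts at `0` at time `0` and serves the customers
`c 0, c 1, …` of `C`, each of them strictly nearest when chosen. -/
structure IsRun (v : ℝ≥0∞) (C : Set (ℝ × ℝ)) (τ : ℕ → ℝ) (p c : ℕ → ℝ × ℝ) : Prop where
  start : p 0 = 0
  nearest : ∀ n, IsStrictNearest (p n) (C \ exploredBy n p) (c n)
  step : ∀ n, p (n + 1) = ((c n).1, (p n).2 + travelTime v (p n).1 (c n).1 + τ n)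
  service_nonneg : ∀ n, 0 ≤ τ n
  arrival_nonneg : ∀ d ∈ C, 0 ≤ d.2

namespace IsRun
variable {v : ℝ≥0∞} {C : Set (ℝ × ℝ)} {τ : ℕ → ℝ} {p c : ℕ → ℝ × ℝ}

lemma pos_succ (R : IsRun v C τ p c) (n : ℕ) : (p (n + 1)).1 = (c n).1 := by rw [R.step]

lemma time_succ (R : IsRun v C τ p c) (n : ℕ) :
    (p (n + 1)).2 = (p n).2 + travelTime v (p n).1 (p (n + 1)).1 + τ n := by rw [R.step]

lemma time_le_succ (R : IsRun v C τ p c) (n : ℕ) : (p n).2 ≤ (p (n + 1)).2 := by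
  rw [R.time_succ]
  linarith [travelTime_nonneg v (p n).1 (p (n + 1)).1, R.service_nonneg n]

lemma time_mono (R : IsRun v C τ p c) : Monotone fun n => (p n).2 :=
  monotone_nat_of_le_succ R.time_le_succ

lemma time_eq_sum (R : IsRun v C τ p c) (n : ℕ) : (p n).2 = ∑ k ∈ Finset.range n, τ k +
    ∑ k ∈ Finset.range n, travelTime v (p k).1 (p (k + 1)).1 := by
  induction n with
  | zero => simp [R.start]
  | succ n ih => rw [R.time_succ, ih, Finset.sum_range_succ, Finset.sum_range_succ]; ring

lemma mem (R : IsRun v C τ p c) (n : ℕ) : c n ∈ C := (R.nearest n).1.1.1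

lemma arrival_le (R : IsRun v C τ p c) (n : ℕ) : (c n).2 ≤ (p n).2 := (R.nearest n).1.2

lemma mem_explored (R : IsRun v C τ p c) (n : ℕ) : c n ∈ explored (p n) (p (n + 1)).1 := by
  rw [R.pos_succ]
  exact ⟨le_rfl, R.arrival_le n⟩

lemma injective (R : IsRun v C τ p c) : Function.Injective c := by
  have h : ∀ m n, m < n → c m ≠ c n := fun m n hmn he => by
    refine (R.nearest n).1.1.2 ?_
    rw [← he]
    exact mem_exploredBy.2 ⟨m, hmn, R.mem_explored m⟩
  intro m n he
  by_contra hne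
  rcases lt_or_gt_of_ne hne with hlt | hlt
  · exact h m n hlt he
  · exact h n m hlt he.symm

/-- The explored customers are those that have been served. -/
lemma inter_exploredBy (R : IsRun v C τ p c) (n : ℕ) :
    C ∩ exploredBy n p = c '' Set.Iio n := by
  induction n with
  | zero => simp [exploredBy]
  | succ n ih =>
    have h1 : exploredBy (n + 1) p = exploredBy n p ∪ explored (p n) (p (n + 1)).1 := by
      ext d
      rw [Set.mem_union, mem_exploredBy, mem_exploredBy]
      constructor
      · rintro ⟨k, hk, hd⟩
        rcases Nat.lt_succ_iff_lt_or_eq.1 hk with hk' | rfl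
        · exact Or.inl ⟨k, hk', hd⟩
        · exact Or.inr hd
      · rintro (⟨k, hk, hd⟩ | hd)
        · exact ⟨k, by omega, hd⟩
        · exact ⟨n, by omega, hd⟩
    have h2 : Set.Iio (n + 1) = insert n (Set.Iio n) := by
      ext k; simp only [Set.mem_Iio, Set.mem_insert_iff]; omega
    rw [h2, Set.image_insert_eq, ← ih, h1]
    ext d
    constructor
    · rintro ⟨hd, hd' | hd'⟩
      · exact Or.inr ⟨hd, hd'⟩
      -- A customer explored by this step for the first time is as near as the chosen one, hence
      -- equal to it.
      · by_cases hn : d ∈ exploredBy n p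
        · exact Or.inr ⟨hd, hn⟩
        · left
          by_contra hne
          have := (R.nearest n).2 d ⟨hd, hn⟩ hd'.2 hne
          rw [← R.pos_succ] at this
          exact absurd hd'.1 (not_le.2 this)
    · rintro (rfl | ⟨hd, hd'⟩)
      · exact ⟨R.mem n, Or.inr (R.mem_explored n)⟩
      · exact ⟨hd, Or.inl hd'⟩

/-- The run describes the states of the greedy server. -/
lemma state_eq (R : IsRun v C τ p c) (n : ℕ) :
    state C v τ n = ⟨(p n).1, (p n).2, c '' Set.Iio n⟩ := by
  induction n with
  | zero => simp [state, R.start]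
  | succ n ih =>
    -- Served is the same as explored, so the waiting customers of the model are the unexplored ones
    -- that have arrived.
    have hw : waiting C (state C v τ n) = {d | d ∈ C \ exploredBy n p ∧ d.2 ≤ (p n).2} := by
      rw [ih, ← R.inter_exploredBy n]
      ext d
      simp only [waiting, Set.mem_ofPred_eq, Set.mem_inter_iff, Set.mem_sdiff]
      tauto
    have hnear : IsNearest C (state C v τ n) (c n) := by
      refine ⟨by rw [hw]; exact (R.nearest n).1, fun d hd => ?_⟩
      rw [hw] at hd
      rw [ih]
      exact (R.nearest n).abs_le hd.1 hd.2
    have hnext : nextCustomer C (state C v τ n) = c n := by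
      have hex : ∃ d, IsNearest C (state C v τ n) d := ⟨_, hnear⟩
      rw [nextCustomer, dif_pos hex]
      by_contra hne
      have h1 := hex.choose_spec
      have h2 := h1.1
      rw [hw] at h2
      have h3 := (R.nearest n).2 _ h2.1 h2.2 hne
      have h4 := h1.2 (c n) hnear.1
      have hpos : (state C v τ n).pos = (p n).1 := by rw [ih]
      rw [hpos] at h4
      exact absurd h4 (not_le.2 h3)
    have h2 : Set.Iio (n + 1) = insert n (Set.Iio n) := by
      ext k; simp only [Set.mem_Iio, Set.mem_insert_iff]; omega
    rw [state, GreedyServer.step, hnext, ih, R.step, h2, Set.image_insert_eq]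

/-- The customers served in a given region during given steps have arrived before. -/
lemma sub_le_encard (R : IsRun v C τ p c) {m n : ℕ} {I : Set ℝ}
    (hI : ∀ k, m < k → k ≤ n → (p k).1 ∈ I) :
    ((n - m : ℕ) : ℕ∞) ≤ (C ∩ I ×ˢ Set.Icc 0 (p n).2).encard := by
  have h1 : c '' Set.Ico m n ⊆ C ∩ I ×ˢ Set.Icc 0 (p n).2 := by
    rintro _ ⟨k, hk, rfl⟩
    refine ⟨R.mem k, ?_, R.arrival_nonneg _ (R.mem k), (R.arrival_le k).trans (R.time_mono hk.2.le)⟩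
    rw [← R.pos_succ]
    exact hI (k + 1) (by have := hk.1; omega) hk.2
  refine le_trans (le_of_eq ?_) (Set.encard_le_encard h1)
  rw [R.injective.encard_image, ← Finset.coe_Ico, Set.encard_coe_eq_coe_finsetCard, Nat.card_Ico]

/-- The customers that have arrived in a region before the server crosses it are served when it
has crossed. -/
lemma encard_le (R : IsRun v C τ p c) {m n l : ℕ} {a b : ℝ} (hmn : m ≤ n) (ha : (p m).1 < a)
    (hb : b ≤ (p n).1) (hl : ∀ k ≤ l, (p k).1 < a) :
    (C ∩ Set.Ico a b ×ˢ Set.Icc 0 (p m).2).encard ≤ ((n - l : ℕ) : ℕ∞) := by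
  have h1 : C ∩ Set.Ico a b ×ˢ Set.Icc 0 (p m).2 ⊆ c '' Set.Ico l n := by
    rintro d ⟨hd, hdI, hdt⟩
    -- The step that crosses `d` explores it, so `d` is served before step `n`. It is not among the
    -- first `l` services, which took place to the left of `a`.
    obtain ⟨i, hi1, hi2, hi3, hi4⟩ := exists_last_step (P := fun i => (p i).1 ≤ d.1) hmn
      (ha.le.trans hdI.1) (not_le.2 (hdI.2.trans_le hb))
    rw [not_le] at hi4
    have hmem : d ∈ C ∩ exploredBy n p := by
      refine ⟨hd, mem_exploredBy.2 ⟨i, hi2, ?_, hdt.2.trans (R.time_mono hi1)⟩⟩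
      rw [abs_of_nonneg (by linarith), abs_of_nonneg (by linarith)]
      linarith
    rw [R.inter_exploredBy] at hmem
    obtain ⟨k, hk, rfl⟩ := hmem
    refine ⟨k, ⟨?_, hk⟩, rfl⟩
    by_contra! hlt
    have := hl (k + 1) hlt
    rw [R.pos_succ] at this
    exact absurd hdI.1 (not_le.2 this)
  refine (Set.encard_le_encard h1).trans (le_of_eq ?_)
  rw [R.injective.encard_image, ← Finset.coe_Ico, Set.encard_coe_eq_coe_finsetCard, Nat.card_Ico]

end IsRun

/-! ### The random dynamics is a run -/

section
variable {Ω : Type*} [MeasurableSpace Ω] {μ : Measure Ω} [IsProbabilityMeasure μ] {lam : ℝ}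
  {η : Ω → Conf} {T : Ω → ℕ → ℝ} {v : ℝ≥0∞}

lemma orbit_conf (v : ℝ≥0∞) (s : Conf) (t : ℕ → ℝ) (n : ℕ) :
    (orbit v 0 s t n).2.carrier = s.carrier \ exploredBy n (path v 0 (fun _ => 0) s t) := by
  have hp : ∀ k, path v 0 (fun _ => 0) s t k = (orbit v 0 s t k).1 := fun k => by
    have := path_add_succ v 0 (fun _ => 0) s t k
    rwa [zero_add] at this
  induction n with
  | zero => simp [orbit, exploredBy]
  | succ n ih =>
    have h1 : (orbit v 0 s t (n + 1)).2.carrier = (orbit v 0 s t n).2.carrier ∩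
        (explored (orbit v 0 s t n).1 (orbit v 0 s t (n + 1)).1.1)ᶜ := rfl
    rw [h1, ih]
    ext d
    simp only [Set.mem_inter_iff, Set.mem_sdiff, Set.mem_compl_iff, mem_exploredBy]
    constructor
    · rintro ⟨⟨h1, h2⟩, h3⟩
      refine ⟨h1, ?_⟩
      rintro ⟨k, hk, hd⟩
      rcases Nat.lt_succ_iff_lt_or_eq.1 hk with hk' | rfl
      · exact h2 ⟨k, hk', hd⟩
      · rw [hp, hp] at hd
        exact h3 hd
    · rintro ⟨h1, h2⟩
      refine ⟨⟨h1, ?_⟩, fun hd => h2 ⟨n, by omega, by rw [hp, hp]; exact hd⟩⟩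
      rintro ⟨k, hk, hd⟩
      exact h2 ⟨k, by omega, hd⟩

/-- Almost surely the dynamics is a run of the greedy server. -/
lemma ae_isRun (hη : IsInput μ lam η T) (v : ℝ≥0∞) : ∀ᵐ ω ∂μ, ∃ c,
    IsRun v (η ω).carrier (T ω) (path v 0 (fun _ => 0) (η ω) (T ω)) c := by
  have h1 := ae_of_ae_map (hη.isFresh.measurable_path_const v 0 fun _ => 0).aemeasurable
    (pathLaw_ae_isAdmissible (v := v) hη.isFresh (n := 0) (h := fun _ => 0)
      ⟨le_rfl, fun k hk => le_rfl⟩)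
  simp only [Conf.inter_exploredBy_zero] at h1
  filter_upwards [h1] with ω hω
  set p := path v 0 (fun _ => 0) (η ω) (T ω) with hp
  have hpo : ∀ k, p k = (orbit v 0 (η ω) (T ω) k).1 := fun k => by
    have := path_add_succ v 0 (fun _ => 0) (η ω) (T ω) k
    rwa [zero_add] at this
  have hex : ∀ n, ∃ c, IsStrictNearest (p n) ((η ω).carrier \ exploredBy n p) c := by
    intro n
    by_contra hne
    -- Without a nearest customer the next time would be the default `-1`, contrary to
    -- admissibility.
    have h3 := (hω (n + 1)).time_nonneg (j := n + 1) (by omega)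
    rw [hpo, orbit] at h3
    simp only [advance] at h3
    rw [if_neg] at h3
    · norm_num at h3
    · rw [← hpo, orbit_conf]
      exact hne
  choose c hc using hex
  refine ⟨c, by rw [hpo]; rfl, hc, fun n => ?_, hη.nonneg ω, (η ω).nonneg⟩
  have h4 : IsStrictNearest (orbit v 0 (η ω) (T ω) n).1 (orbit v 0 (η ω) (T ω) n).2.carrier
      (c n) := by
    rw [← hpo, orbit_conf]
    exact hc n
  rw [hpo (n + 1), orbit]
  simp only [advance]
  rw [if_pos ⟨_, h4⟩, h4.nearest_eq, ← hpo]

end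

section
variable {Ω : Type*} [MeasurableSpace Ω] {μ : Measure Ω} {lam : ℝ}
  {η : Ω → Conf} {T : Ω → ℕ → ℝ}

/-! ### Uniform laws of large numbers for the customers -/

/-- Events of exponentially small probabilities, indexed by polynomially many integers, almost
surely do not occur from some point on. -/
lemma ae_eventually_notMem_of_exp {E : ℕ → ℤ → Set Ω} {K c : ℝ} (hc : 0 < c)
    (hE : ∀ (s : ℕ) j, μ (E s j) ≤ ENNReal.ofReal (K * Real.exp (-c * s))) :
    ∀ᵐ ω ∂μ, ∀ᶠ s : ℕ in atTop, ∀ j : ℤ, |j| ≤ (s : ℤ) ^ 2 → ω ∉ E s j := by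
  set F : ℕ → Set Ω := fun s => ⋃ j ∈ Finset.Icc (-((s : ℤ) ^ 2)) ((s : ℤ) ^ 2), E s j with hF
  have hb : ∀ s : ℕ, μ (F s) ≤ ENNReal.ofReal ((2 * s ^ 2 + 1) * (|K| * Real.exp (-c * s))) := by
    intro s
    refine (measure_biUnion_finset_le _ _).trans ((Finset.sum_le_sum fun j _ =>
      (hE s j).trans (ENNReal.ofReal_le_ofReal (q := |K| * Real.exp (-c * s)) ?_)).trans ?_)
    · exact mul_le_mul_of_nonneg_right (le_abs_self _) (Real.exp_nonneg _)
    · rw [Finset.sum_const, nsmul_eq_mul, ENNReal.ofReal_mul (p := 2 * (s : ℝ) ^ 2 + 1) (by positivity)]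
      refine mul_le_mul' (le_of_eq ?_) le_rfl
      rw [Int.card_Icc]
      have : ((s : ℤ) ^ 2 + 1 - -((s : ℤ) ^ 2)).toNat = 2 * s ^ 2 + 1 := by
        have : (s : ℤ) ^ 2 + 1 - -((s : ℤ) ^ 2) = ((2 * s ^ 2 + 1 : ℕ) : ℤ) := by push_cast; ring
        rw [this, Int.toNat_natCast]
      rw [this, ← ENNReal.ofReal_natCast]
      push_cast
      rfl
  -- Polynomially many exponentially small probabilities are summable, and the Borel–Cantelli lemma
  -- applies.
  have hs : Summable fun s : ℕ => (2 * (s : ℝ) ^ 2 + 1) * (|K| * Real.exp (-c * s)) := by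
    have h1 := (Real.summable_pow_mul_exp_neg_nat_mul 2 hc).mul_left (2 * |K|)
    have h2 := (Real.summable_pow_mul_exp_neg_nat_mul 0 hc).mul_left |K|
    refine (h1.add h2).congr fun s => ?_
    ring
  have hne : ∑' s, μ (F s) ≠ ∞ :=
    ne_top_of_le_ne_top hs.tsum_ofReal_ne_top (ENNReal.tsum_le_tsum hb)
  filter_upwards [ae_eventually_notMem hne] with ω hω
  filter_upwards [hω] with s hs j hj hmem
  refine hs (Set.mem_biUnion (x := j) ?_ hmem)
  rw [Finset.mem_coe, Finset.mem_Icc]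
  exact abs_le.1 hj

lemma intensity_Ico_prod_Icc (hlam : 0 ≤ lam) (a : ℝ) {l t : ℝ} (hl : 0 ≤ l) (ht : 0 ≤ t) :
    intensity lam (Set.Ico a (a + l) ×ˢ Set.Icc 0 t) ≠ ∞ ∧
    lam * l * t ≤ (intensity lam (Set.Ico a (a + l) ×ˢ Set.Icc 0 t)).toReal ∧
    (intensity lam (Set.Ico a (a + l) ×ˢ Set.Icc 0 t)).toReal ≤ lam * l * t + l := by
  have h1 : intensity lam (Set.Ico a (a + l) ×ˢ Set.Icc 0 t) ≤ ENNReal.ofReal (lam * l * t + l) := by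
    refine (intensity_prod_le lam measurableSet_Ico measurableSet_Icc).trans (le_of_eq ?_)
    rw [Real.volume_Ico, Real.volume_Icc, ← ENNReal.ofReal_mul hlam, ← ENNReal.ofReal_one,
      ← ENNReal.ofReal_add zero_le_one (by rw [sub_zero]; positivity),
      ← ENNReal.ofReal_mul (by linarith)]
    congr 1
    ring
  have hne := ne_top_of_le_ne_top ENNReal.ofReal_ne_top h1
  have h2 : ENNReal.ofReal (lam * l * t) ≤ intensity lam (Set.Ico a (a + l) ×ˢ Set.Icc 0 t) := by
    refine le_trans (le_of_eq ?_) ((intensity_prod_ge lam (measurableSet_Ico (a := a) (b := a + l))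
      (measurableSet_Ioc (a := (0 : ℝ)) (b := t)) fun s hs => hs.1).trans (measure_mono
        (Set.prod_mono le_rfl Set.Ioc_subset_Icc_self)))
    rw [Real.volume_Ico, Real.volume_Ioc, ← ENNReal.ofReal_mul (by linarith),
      ← ENNReal.ofReal_mul hlam]
    congr 1
    ring
  refine ⟨hne, ?_, ENNReal.toReal_le_of_le_ofReal (by positivity) h1⟩
  have := ENNReal.toReal_mono hne h2
  rwa [ENNReal.toReal_ofReal (by positivity)] at this

/-- The law of large numbers for the numbers of customers in the translates of an interval, uniform
in polynomially many translates. -/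
lemma ae_eventually_encard (hη : IsInput μ lam η T) (hlam : 0 < lam) (d o : ℝ) {l ε : ℝ}
    (hl : 0 < l) (hε : 0 < ε) (hεl : ε ≤ lam * l) :
    ∀ᵐ ω ∂μ, ∀ᶠ s : ℕ in atTop, ∀ j : ℤ, |j| ≤ (s : ℤ) ^ 2 →
      ∃ k : ℕ, ((η ω).carrier ∩ Set.Ico (j * d + o) (j * d + o + l) ×ˢ Set.Icc 0 (s : ℝ)).encard = k ∧
        (lam * l - ε) * s ≤ k ∧ k ≤ (lam * l + ε) * s := by
  -- The Chernoff parameter: the quadratic term `lam * l * θ ^ 2 * s` then uses up at most half of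
  -- the linear gain `θ * ε * s`.
  set θ : ℝ := min 1 (ε / (2 * (lam * l))) with hθ
  have hθ0 : 0 < θ := lt_min one_pos (by positivity)
  have hθ1 : θ ≤ 1 := min_le_left _ _
  have hθε : lam * l * θ ≤ ε / 2 := by
    have : θ ≤ ε / (2 * (lam * l)) := min_le_right _ _
    rw [le_div_iff₀ (by positivity)] at this
    linarith
  have he1 : Real.exp θ - 1 ≤ θ + θ ^ 2 := by
    have := (abs_le.1 (Real.abs_exp_sub_one_sub_id_le (x := θ) (by rwa [abs_of_pos hθ0]))).2
    linarith
  have he1' : 0 ≤ Real.exp θ - 1 := by linarith [Real.add_one_le_exp θ]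
  have he2 : Real.exp (-θ) - 1 ≤ -θ + θ ^ 2 := by
    have := (abs_le.1 (Real.abs_exp_sub_one_sub_id_le (x := -θ) (by rwa [abs_neg, abs_of_pos hθ0]))).2
    linarith [neg_sq θ]
  have he2' : Real.exp (-θ) - 1 ≤ 0 := by
    have := Real.exp_le_exp.2 (show -θ ≤ 0 by linarith)
    rw [Real.exp_zero] at this
    linarith
  set B : ℕ → ℤ → Set (ℝ × ℝ) := fun s j =>
    Set.Ico (j * d + o) (j * d + o + l) ×ˢ Set.Icc 0 (s : ℝ) with hB
  have hBm : ∀ s j, MeasurableSet (B s j) := fun s j => measurableSet_Ico.prod measurableSet_Icc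
  have hmass := fun (s : ℕ) (j : ℤ) =>
    intensity_Ico_prod_Icc hlam.le (j * d + o) hl.le (Nat.cast_nonneg (α := ℝ) s)
  have hc : 0 < θ * ε / 2 := by positivity
  have hup : ∀ (s : ℕ) j, μ {ω | ((⌈(lam * l + ε) * s⌉₊ : ℕ) : ℕ∞) ≤
      count (fun ω => (η ω).carrier) (B s j) ω} ≤
      ENNReal.ofReal (Real.exp (2 * l) * Real.exp (-(θ * ε / 2) * s)) := by
    intro s j
    refine (hη.poisson.measure_le_count_le_exp (hBm s j) (hmass s j).1 hθ0.le _).trans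
      (ENNReal.ofReal_le_ofReal ?_)
    rw [← Real.exp_add, Real.exp_le_exp]
    have h1 := Nat.le_ceil ((lam * l + ε) * s)
    have h2 := mul_le_mul (hmass s j).2.2 he1 he1' (by positivity)
    have h3 := mul_le_mul_of_nonneg_left h1 hθ0.le
    have h4 : lam * l * θ * (θ * s) ≤ ε / 2 * (θ * s) :=
      mul_le_mul_of_nonneg_right hθε (by positivity)
    have h5 : l * (θ + θ ^ 2) ≤ l * 2 := mul_le_mul_of_nonneg_left (by nlinarith) hl.le
    simp only [hB]
    nlinarith
  have hlow : ∀ (s : ℕ) j, μ {ω | count (fun ω => (η ω).carrier) (B s j) ω ≤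
      ((⌊(lam * l - ε) * s⌋₊ : ℕ) : ℕ∞)} ≤
      ENNReal.ofReal (1 * Real.exp (-(θ * ε / 2) * s)) := by
    intro s j
    refine (hη.poisson.measure_count_le_le_exp (hBm s j) (hmass s j).1 hθ0.le _).trans
      (ENNReal.ofReal_le_ofReal ?_)
    rw [one_mul, Real.exp_le_exp]
    have h1 := Nat.floor_le (show 0 ≤ (lam * l - ε) * s from
      mul_nonneg (by linarith) (Nat.cast_nonneg _))
    have h2 := mul_le_mul_of_nonpos_right (hmass s j).2.1 he2'
    have h3 := mul_le_mul_of_nonneg_left h1 hθ0.le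
    have h4 : lam * l * θ * (θ * s) ≤ ε / 2 * (θ * s) :=
      mul_le_mul_of_nonneg_right hθε (by positivity)
    have h5 : lam * l * s * (Real.exp (-θ) - 1) ≤ lam * l * s * (-θ + θ ^ 2) :=
      mul_le_mul_of_nonneg_left he2 (by positivity)
    simp only [hB]
    nlinarith
  filter_upwards [ae_eventually_notMem_of_exp hc hup, ae_eventually_notMem_of_exp hc hlow]
    with ω h1 h2
  filter_upwards [h1, h2] with s hs1 hs2 j hj
  have h3 := hs1 j hj
  have h4 := hs2 j hj
  simp only [not_le, count] at h3 h4
  obtain ⟨k, hk⟩ := ENat.ne_top_iff_exists.1 h3.ne_top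
  refine ⟨k, hk.symm, ?_, ?_⟩
  · rw [← hk, Nat.cast_lt] at h4
    exact (Nat.lt_of_floor_lt h4).le
  · rw [← hk, Nat.cast_lt] at h3
    exact (Nat.lt_ceil.1 h3).le

/-- There are eventually many initial customers in long intervals. -/
lemma ae_eventually_initial (hη : IsInput μ lam η T) :
    ∀ᵐ ω ∂μ, ∀ᶠ s : ℕ in atTop, ((s / 2 : ℕ) : ℕ∞) <
      ((η ω).carrier ∩ Set.Ico 1 ((s : ℝ) + 1) ×ˢ Set.Icc 0 0).encard := by
  set B : ℕ → Set (ℝ × ℝ) := fun s => Set.Ico 1 ((s : ℝ) + 1) ×ˢ Set.Icc 0 0 with hB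
  have hBm : ∀ s, MeasurableSet (B s) := fun s => measurableSet_Ico.prod measurableSet_Icc
  have hf : ∀ s, intensity lam (B s) ≠ ∞ := fun s => by
    refine ne_top_of_le_ne_top ?_ (intensity_prod_le lam measurableSet_Ico measurableSet_Icc)
    rw [Real.volume_Ico, Real.volume_Icc]
    finiteness
  have hge : ∀ s : ℕ, (s : ℝ) ≤ (intensity lam (B s)).toReal := by
    intro s
    refine (ENNReal.ofReal_le_iff_le_toReal (hf s)).1 ?_
    rw [intensity_apply lam (hBm s)]
    refine le_trans (le_of_eq ?_) (le_self_add)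
    have : {x : ℝ | (x, (0 : ℝ)) ∈ B s} = Set.Ico 1 ((s : ℝ) + 1) := by
      ext x; simp [hB]
    rw [this, Real.volume_Ico, add_sub_cancel_right]
  -- With Chernoff parameter `1` the exponent is at most `s * (exp (-1) - 1) + s / 2`, which is
  -- negative.
  have he : Real.exp (-1) < 1 / 2 := by
    rw [Real.exp_neg, ← one_div]
    exact one_div_lt_one_div_of_lt (by norm_num) (by linarith [Real.add_one_lt_exp (x := 1) one_ne_zero])
  have hb : ∀ (s : ℕ) (_ : ℤ), μ {ω | count (fun ω => (η ω).carrier) (B s) ω ≤ ((s / 2 : ℕ) : ℕ∞)} ≤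
      ENNReal.ofReal (1 * Real.exp (-(1 / 2 - Real.exp (-1)) * s)) := by
    intro s _
    refine (hη.poisson.measure_count_le_le_exp (hBm s) (hf s) zero_le_one _).trans
      (ENNReal.ofReal_le_ofReal ?_)
    rw [one_mul, one_mul, Real.exp_le_exp]
    have h1 : ((s / 2 : ℕ) : ℝ) ≤ s / 2 := Nat.cast_div_le
    have h2 := mul_le_mul_of_nonpos_right (hge s) (show Real.exp (-1) - 1 ≤ 0 by linarith)
    linarith
  filter_upwards [ae_eventually_notMem_of_exp (by linarith) hb] with ω h1
  filter_upwards [h1] with s hs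
  have := hs 0 (by positivity)
  simpa only [Set.mem_ofPred_eq, not_le, count] using this

end

/-! ### The speed of a server that moves to the right -/

/-- A run that moves to the right, among customers and services that obey the laws of large
numbers. -/
structure IsTypical (lam : ℝ) (v : ℝ≥0∞) (C : Set (ℝ × ℝ)) (τ : ℕ → ℝ) (p c : ℕ → ℝ × ℝ) :
    Prop extends IsRun v C τ p c where
  right : p ∈ rightward
  average : Tendsto (fun n : ℕ => (∑ i ∈ Finset.range n, τ i) / n) atTop (𝓝 1)
  initial : ∀ᶠ s : ℕ in atTop, ((s / 2 : ℕ) : ℕ∞) <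
    (C ∩ Set.Ico 1 ((s : ℝ) + 1) ×ˢ Set.Icc 0 0).encard
  cell : ∀ q : ℕ, 1 ≤ lam * q → ∀ᶠ s : ℕ in atTop, ∀ j : ℤ, |j| ≤ (s : ℤ) ^ 2 →
    ∃ k : ℕ, (C ∩ Set.Ico (j / q : ℝ) ((j + 1) / q) ×ˢ Set.Icc 0 (s : ℝ)).encard = k ∧
      (lam / q - 1 / q ^ 2) * s ≤ k
  window : ∀ q : ℕ, 1 ≤ lam * q → ∀ᶠ s : ℕ in atTop, ∀ j : ℤ, |j| ≤ (s : ℤ) ^ 2 →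
    ∃ k : ℕ, (C ∩ Set.Ico (j / q - 1 / q ^ 2 : ℝ) ((j + 1) / q) ×ˢ Set.Icc 0 (s : ℝ)).encard = k ∧
      k ≤ (lam * (1 / q + 1 / q ^ 2) + 1 / q ^ 2) * s

namespace IsTypical
variable {lam : ℝ} {v : ℝ≥0∞} {C : Set (ℝ × ℝ)} {τ : ℕ → ℝ} {p c : ℕ → ℝ × ℝ}

lemma eventually_le_time (H : IsTypical lam v C τ p c) {a : ℝ} (ha : a < 1) :
    ∀ᶠ n : ℕ in atTop, a * n ≤ (p n).2 := by
  filter_upwards [H.average.eventually (lt_mem_nhds ha), eventually_gt_atTop 0] with n hn hn0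
  have hn0' : (0 : ℝ) < n := by exact_mod_cast hn0
  rw [lt_div_iff₀ hn0'] at hn
  rw [H.time_eq_sum]
  have := Finset.sum_nonneg fun k (_ : k ∈ Finset.range n) =>
    travelTime_nonneg v (p k).1 (p (k + 1)).1
  linarith

/-- The server advances at most linearly. -/
lemma exists_pos_le (H : IsTypical lam v C τ p c) : ∃ A, 0 ≤ A ∧ ∀ n, (p n).1 ≤ 2 * n + A := by
  obtain ⟨s₀, hs₀⟩ := eventually_atTop.1 H.initial
  refine ⟨s₀ + 4, by positivity, fun n => ?_⟩
  by_contra! hlt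
  set s := ⌊(p n).1⌋₊ - 1 with hs
  have hx : (0 : ℝ) ≤ (p n).1 := le_trans (by positivity) hlt.le
  have hfl : s₀ + 4 ≤ ⌊(p n).1⌋₊ := by
    refine Nat.le_floor ?_
    push_cast
    have : (0 : ℝ) ≤ n := by positivity
    linarith
  have hs1 : ((s : ℝ) + 1) = (⌊(p n).1⌋₊ : ℝ) := by
    rw [hs]; push_cast [Nat.cast_sub (show 1 ≤ ⌊(p n).1⌋₊ by omega)]; ring
  -- A server beyond `s + 1` has served all the initial customers between `1` and `s + 1`, more than
  -- `s / 2` of them, so `s ≤ 2 * n`.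
  have h1 := hs₀ s (by omega)
  have h2 := H.encard_le (m := 0) (n := n) (l := 0) (a := 1) (b := (s : ℝ) + 1) (Nat.zero_le n)
    (by rw [H.start]; simp) (by rw [hs1]; exact Nat.floor_le hx)
    (fun k hk => by rw [Nat.le_zero.1 hk, H.start]; simp)
  rw [H.start] at h2
  have h3 := h1.trans_le h2
  rw [Nat.cast_lt] at h3
  have h4 : s ≤ 2 * n := by omega
  have h5 : (s : ℝ) ≤ 2 * n := by exact_mod_cast h4
  have h6 := Nat.lt_floor_add_one (p n).1
  have h7 : (0 : ℝ) ≤ s₀ := by positivity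
  linarith

/-- Reaching the `j`-th cell takes an exponential number of steps. -/
lemma exists_pow_le (H : IsTypical lam v C τ p c) {q : ℕ} (hq : 3 ≤ q) (hlq : 1 < lam * q) :
    ∃ c₀ > 0, ∃ J : ℕ, ∀ j ≥ J, ∀ n, (j : ℝ) / q ≤ (p n).1 →
      c₀ * (1 + (lam / q - 1 / q ^ 2) * (1 - 2 / q)) ^ j ≤ n := by
  have hq0 : (0 : ℝ) < q := by positivity
  have hq3 : (3 : ℝ) ≤ q := by exact_mod_cast hq
  set κ : ℝ := lam / q - 1 / q ^ 2 with hκ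
  have hκ0 : 0 < κ := by
    rw [hκ, show lam / q - 1 / (q : ℝ) ^ 2 = (lam * q - 1) / q ^ 2 by field_simp]
    exact div_pos (by linarith) (by positivity)
  have h2q : 0 < 1 - 2 / (q : ℝ) := by
    rw [sub_pos, div_lt_one hq0]; linarith
  set θ : ℝ := κ * (1 - 2 / q) with hθ
  have hθ0 : 0 < θ := mul_pos hκ0 h2q
  obtain ⟨A, hA0, hA⟩ := H.exists_pos_le
  have h1q : 1 - 1 / (q : ℝ) < 1 := by
    have : 0 < 1 / (q : ℝ) := by positivity
    linarith
  have hhalf : 1 / 2 ≤ 1 - 1 / (q : ℝ) := by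
    have : 1 / (q : ℝ) ≤ 1 / 2 := one_div_le_one_div_of_le (by norm_num) (by linarith)
    linarith
  obtain ⟨s₀, hs₀⟩ := eventually_atTop.1 (H.cell q hlq.le)
  obtain ⟨m₁, hm₁⟩ := eventually_atTop.1 (H.eventually_le_time h1q)
  -- A threshold for the number of steps beyond which all bounded errors are absorbed. By the linear
  -- bound on the position, reaching a cell of index at least `J` takes at least `D` steps.
  set D : ℝ := 2 * s₀ + 4 + 2 * (4 * q + q * (6 + A)) + (1 + 2 * κ + κ) * q / κ + m₁ + 2 with hD
  set J : ℕ := ⌈q * (2 * D + A)⌉₊ + 1 with hJ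
  -- Let `m` be the first step at which cell `j` is reached. The customers waiting in it, about `lam
  -- / q * m`, are all served before the next cell is reached.
  have hstep : ∀ j : ℕ, J ≤ j → ∀ n, ((j + 1 : ℕ) : ℝ) / q ≤ (p n).1 → ∃ m, (j : ℝ) / q ≤ (p m).1 ∧
      (1 + θ) * m ≤ n := by
    intro j hj n hn
    have hjn : (j : ℝ) / q ≤ (p n).1 := by
      refine le_trans ?_ hn
      gcongr
      simp
    have hex : ∃ m, (j : ℝ) / q ≤ (p m).1 := ⟨n, hjn⟩
    classical
    set m := Nat.find hex with hm
    have hmn : m ≤ n := Nat.find_min' hex hjn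
    have hmx : (j : ℝ) / q ≤ (p m).1 := Nat.find_spec hex
    have hmlt : ∀ k < m, (p k).1 < j / q := fun k hk => not_le.1 (Nat.find_min hex hk)
    have hJj : q * (2 * D + A) ≤ j := by
      refine (Nat.le_ceil _).trans ?_
      have : ⌈q * (2 * D + A)⌉₊ ≤ j := by omega
      exact_mod_cast this
    have hj2 : (j : ℝ) / q ≤ 2 * m + A := hmx.trans (hA m)
    have hmD : D ≤ m := by
      have : 2 * D + A ≤ j / q := by rw [le_div_iff₀ hq0]; linarith
      linarith
    have hpos1 : 0 ≤ q * (6 + A) := by positivity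
    have hpos2 : 0 ≤ (1 + 2 * κ + κ) * q / κ := by positivity
    have hs00 : (0 : ℝ) ≤ s₀ := by positivity
    have hm10 : (0 : ℝ) ≤ m₁ := by positivity
    have hm1 : m₁ + 1 ≤ m := by
      have : ((m₁ + 1 : ℕ) : ℝ) ≤ m := by push_cast; linarith
      exact_mod_cast this
    -- Customers are counted at the last step before the cell is reached, when none of the cell has
    -- been visited.
    obtain ⟨m', hm'⟩ : ∃ m', m = m' + 1 := ⟨m - 1, by omega⟩
    have hmr : (m : ℝ) = m' + 1 := by rw [hm']; push_cast; ring
    have ht := hm₁ m' (by omega)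
    set s := ⌊(p m').2⌋₊ with hs
    have ht0 : 0 ≤ (p m').2 := le_trans (mul_nonneg (by linarith) (by positivity)) ht
    have hs1 : (p m').2 < s + 1 := Nat.lt_floor_add_one _
    have hs2 : (s : ℝ) ≤ (p m').2 := Nat.floor_le ht0
    have hsm : (m' : ℝ) / 2 - 1 ≤ s := by
      have : 1 / 2 * (m' : ℝ) ≤ (1 - 1 / q) * m' := mul_le_mul_of_nonneg_right hhalf (by positivity)
      linarith
    have hss : s₀ ≤ s := by
      have : (s₀ : ℝ) ≤ s := by linarith
      exact_mod_cast this
    have hjs : |(j : ℤ)| ≤ (s : ℤ) ^ 2 := by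
      rw [abs_of_nonneg (by positivity)]
      have h1 : (j : ℝ) ≤ q * (2 * m + A) := by rwa [div_le_iff₀ hq0, mul_comm] at hj2
      have h2 : 4 * q + q * (6 + A) ≤ (m' : ℝ) / 2 - 1 := by linarith
      have h3 : (4 * q + q * (6 + A)) * (s : ℝ) ≤ s * s :=
        mul_le_mul_of_nonneg_right (h2.trans hsm) (by positivity)
      have h4 : 1 ≤ (s : ℝ) := by linarith
      have h5 : q * (6 + A) * 1 ≤ q * (6 + A) * s := mul_le_mul_of_nonneg_left h4 hpos1
      have h6 : q * (2 * m + A) ≤ q * (4 * s + (6 + A)) := by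
        refine mul_le_mul_of_nonneg_left ?_ hq0.le
        linarith
      have h7 : (j : ℝ) ≤ (s : ℝ) ^ 2 := by nlinarith
      exact_mod_cast h7
    obtain ⟨k, hk, hks⟩ := hs₀ s hss j hjs
    have hcount := H.encard_le (m := m') (n := n) (l := m') (a := j / q) (b := ((j : ℝ) + 1) / q)
      (by omega) (hmlt m' (by omega)) (by push_cast at hn; exact hn) (fun k hk => hmlt k (by omega))
    have hkn : k ≤ n - m' := by
      have h1 : ((k : ℕ) : ℕ∞) ≤ ((n - m' : ℕ) : ℕ∞) := by
        rw [← hk]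
        refine (Set.encard_le_encard (Set.inter_subset_inter_right _ (Set.prod_mono ?_
          (Set.Icc_subset_Icc_right hs2)))).trans hcount
        push_cast
        exact le_rfl
      exact_mod_cast h1
    have hkn' : (k : ℝ) + m' ≤ n := by
      have : k + m' ≤ n := by omega
      exact_mod_cast this
    refine ⟨m, hmx, ?_⟩
    -- Lowering the factor `1 - 1 / q` to the `1 - 2 / q` of `θ` frees `κ / q * m`, which absorbs
    -- the constants.
    have h8 : κ * ((1 - 1 / q) * m' - 1) ≤ κ * s := mul_le_mul_of_nonneg_left (by linarith) hκ0.le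
    have h9 : 1 + 2 * κ + κ ≤ κ / q * m := by
      have : (1 + 2 * κ + κ) * q / κ ≤ m := by linarith
      rw [div_le_iff₀ hκ0] at this
      rw [div_mul_eq_mul_div, le_div_iff₀ hq0]
      linarith
    have h10 : κ * ((1 - 1 / q) * m' - 1) = θ * m + κ / q * m - κ * (1 - 1 / q) - κ := by
      rw [hθ, hmr]; ring
    have h11 : κ * (1 - 1 / q) ≤ κ * 1 := mul_le_mul_of_nonneg_left h1q.le hκ0.le
    linarith
  refine ⟨((1 + θ) ^ J)⁻¹, by positivity, J, fun j hj => ?_⟩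
  induction j, hj using Nat.le_induction with
  | base =>
    intro n hn
    rw [inv_mul_cancel₀ (by positivity)]
    have : n ≠ 0 := by
      rintro rfl
      rw [H.start] at hn
      have : (0 : ℝ) < J / q := by positivity
      simp only [Prod.fst_zero] at hn
      linarith
    exact_mod_cast Nat.one_le_iff_ne_zero.2 this
  | succ j hj ih =>
    intro n hn
    obtain ⟨m, hm, hmn⟩ := hstep j hj n hn
    refine le_trans ?_ hmn
    refine le_trans (le_of_eq ?_)
      (mul_le_mul_of_nonneg_left (ih m hm) (show 0 ≤ 1 + θ by linarith))
    rw [pow_succ (1 + θ) j]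
    ring

end IsTypical

/-- The logarithmic growth of the number of services per unit of length, from crossing cells of
length `1 / q`, approaches `lam` as the cells shrink. -/
lemma tendsto_growth (lam : ℝ) : Tendsto (fun q : ℕ => (q : ℝ) *
    Real.log (1 + (lam / q - 1 / (q : ℝ) ^ 2) * (1 - 2 / q))) atTop (𝓝 lam) := by
  refine Real.tendsto_nat_mul_log_one_add_of_tendsto ?_
  have h1 : Tendsto (fun q : ℕ => ((q : ℝ))⁻¹) atTop (𝓝 0) := tendsto_inv_atTop_nhds_zero_nat
  have h2 : Tendsto (fun q : ℕ => (lam - (q : ℝ)⁻¹) * (1 - 2 * (q : ℝ)⁻¹)) atTop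
      (𝓝 ((lam - 0) * (1 - 2 * 0))) :=
    (tendsto_const_nhds.sub h1).mul (tendsto_const_nhds.sub (h1.const_mul 2))
  rw [sub_zero, mul_zero, sub_zero, mul_one] at h2
  refine h2.congr' ?_
  filter_upwards [eventually_gt_atTop 0] with q hq
  have : (0 : ℝ) < q := by exact_mod_cast hq
  field_simp

lemma tendsto_growth' (lam : ℝ) : Tendsto (fun q : ℕ => -((q : ℝ) *
    Real.log (1 - (lam * (1 / q + 1 / (q : ℝ) ^ 2) + 1 / q ^ 2) * (1 + 1 / q)))) atTop (𝓝 lam) := by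
  have h1 : Tendsto (fun q : ℕ => ((q : ℝ))⁻¹) atTop (𝓝 0) := tendsto_inv_atTop_nhds_zero_nat
  have h2 : Tendsto (fun q : ℕ => -((lam * (1 + (q : ℝ)⁻¹) + (q : ℝ)⁻¹) * (1 + (q : ℝ)⁻¹))) atTop
      (𝓝 (-((lam * (1 + 0) + 0) * (1 + 0)))) :=
    ((((tendsto_const_nhds.add h1).const_mul lam).add h1).mul (tendsto_const_nhds.add h1)).neg
  simp only [add_zero, mul_one] at h2
  have h3 : Tendsto (fun q : ℕ => (q : ℝ) *
      -((lam * (1 / q + 1 / (q : ℝ) ^ 2) + 1 / q ^ 2) * (1 + 1 / q))) atTop (𝓝 (-lam)) := by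
    refine h2.congr' ?_
    filter_upwards [eventually_gt_atTop 0] with q hq
    have : (0 : ℝ) < q := by exact_mod_cast hq
    field_simp
  have h4 := (Real.tendsto_nat_mul_log_one_add_of_tendsto h3).neg
  rw [neg_neg] at h4
  exact h4

lemma tendsto_log_nat : Tendsto (fun n : ℕ => Real.log n) atTop atTop :=
  Real.tendsto_log_atTop.comp tendsto_natCast_atTop_atTop

lemma travelTime_eq {v : ℝ≥0∞} (x y : ℝ) :
    travelTime v x y = |y - x| * (v⁻¹).toReal := by
  rw [travelTime, div_eq_mul_inv, ENNReal.toReal_mul, ENNReal.toReal_ofReal (abs_nonneg _)]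

namespace IsTypical
variable {lam : ℝ} {v : ℝ≥0∞} {C : Set (ℝ × ℝ)} {τ : ℕ → ℝ} {p c : ℕ → ℝ × ℝ}

/-- This inverts the exponential lower bound of `exists_pow_le`, with cells so fine that the rate
exceeds `1 / b'`. The slack between `b'` and `b` absorbs the constants. -/
lemma eventually_pos_le_log (H : IsTypical lam v C τ p c) (hlam : 0 < lam) {b : ℝ}
    (hb : lam⁻¹ < b) : ∀ᶠ n : ℕ in atTop, (p n).1 ≤ b * Real.log n := by
  obtain ⟨b', hb1, hb2⟩ := exists_between hb
  have hb'0 : 0 < b' := (inv_pos.2 hlam).trans hb1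
  have h1 : ∀ᶠ q : ℕ in atTop, b'⁻¹ < (q : ℝ) *
      Real.log (1 + (lam / q - 1 / (q : ℝ) ^ 2) * (1 - 2 / q)) :=
    (tendsto_growth lam).eventually (lt_mem_nhds (inv_lt_of_inv_lt₀ hlam hb1))
  have h2 : ∀ᶠ q : ℕ in atTop, 1 < lam * q :=
    (tendsto_natCast_atTop_atTop.const_mul_atTop hlam).eventually_gt_atTop 1
  obtain ⟨q, hq1, hq2, hq3⟩ := (h1.and (h2.and (eventually_ge_atTop 3))).exists
  have hq0 : (0 : ℝ) < q := by positivity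
  obtain ⟨c₀, hc₀, J, hJ⟩ := H.exists_pow_le hq3 hq2
  set ρ : ℝ := 1 + (lam / q - 1 / (q : ℝ) ^ 2) * (1 - 2 / q) with hρ
  set L := Real.log ρ with hL
  have hqL : 0 < q * L := (inv_pos.2 hb'0).trans hq1
  have hL0 : 0 < L := pos_of_mul_pos_right hqL hq0.le
  have hρ0 : 0 < ρ := by
    have hq3' : (3 : ℝ) ≤ q := by exact_mod_cast hq3
    have e1 : 0 < lam / q - 1 / (q : ℝ) ^ 2 := by
      rw [show lam / q - 1 / (q : ℝ) ^ 2 = (lam * q - 1) / q ^ 2 by field_simp]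
      exact div_pos (by linarith) (by positivity)
    have e2 : 0 < 1 - 2 / (q : ℝ) := by rw [sub_pos, div_lt_one hq0]; linarith
    have := mul_pos e1 e2
    linarith
  have hbd : ∀ n : ℕ, (J : ℝ) / q ≤ (p n).1 → 0 < n →
      (p n).1 ≤ 1 / q + b' * (Real.log n - Real.log c₀) ∨ (p n).1 ≤ 1 / q := by
    intro n hn hn0
    have hx0 : 0 ≤ (p n).1 * q := mul_nonneg (le_trans (by positivity) hn) hq0.le
    set j := ⌊(p n).1 * q⌋₊ with hj
    have hjJ : J ≤ j := Nat.le_floor (by rwa [div_le_iff₀ hq0] at hn)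
    have hjx : (j : ℝ) / q ≤ (p n).1 := by
      rw [div_le_iff₀ hq0]; exact Nat.floor_le hx0
    have hjx' : (p n).1 * q < j + 1 := Nat.lt_floor_add_one _
    have h3 := hJ j hjJ n hjx
    have h4 := Real.log_le_log (by positivity) h3
    rw [Real.log_mul hc₀.ne' (by positivity), Real.log_pow, ← hL] at h4
    rcases le_or_gt ((p n).1) (1 / q) with h5 | h5
    · exact Or.inr h5
    · left
      have h6 : ((p n).1 * q - 1) * L ≤ Real.log n - Real.log c₀ := by
        have := mul_le_mul_of_nonneg_right hjx'.le hL0.le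
        linarith
      have h7 : b' * (((p n).1 * q - 1) * L) ≤ b' * (Real.log n - Real.log c₀) :=
        mul_le_mul_of_nonneg_left h6 hb'0.le
      have h8 : 1 ≤ b' * (q * L) := by
        have := mul_le_mul_of_nonneg_left hq1.le hb'0.le
        rwa [mul_inv_cancel₀ hb'0.ne'] at this
      have h9 : 0 ≤ (p n).1 - 1 / q := by linarith
      have h10 : ((p n).1 - 1 / q) * 1 ≤ ((p n).1 - 1 / q) * (b' * (q * L)) :=
        mul_le_mul_of_nonneg_left h8 h9
      have h11 : ((p n).1 - 1 / q) * (b' * (q * L)) = b' * (((p n).1 * q - 1) * L) := by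
        field_simp
      linarith
  have hlog := tendsto_log_nat
  filter_upwards [eventually_gt_atTop 0, hlog.eventually_ge_atTop ((J / q : ℝ) / b),
    hlog.eventually_ge_atTop ((1 / q - b' * Real.log c₀) / (b - b')),
    hlog.eventually_ge_atTop ((1 / q : ℝ) / b)] with n hn h4 h5 h6
  have hb0 : 0 < b := hb'0.trans hb2
  rw [div_le_iff₀ hb0] at h4 h6
  rw [div_le_iff₀ (by linarith)] at h5
  rcases le_or_gt (J / q : ℝ) (p n).1 with h7 | h7
  · rcases hbd n h7 hn with h8 | h8
    · linarith
    · linarith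
  · linarith

lemma eventually_pos_le_mul (H : IsTypical lam v C τ p c) (hlam : 0 < lam) {ε : ℝ} (hε : 0 < ε) :
    ∀ᶠ n : ℕ in atTop, (p n).1 ≤ ε * n := by
  have hb : lam⁻¹ < 2 * lam⁻¹ := by linarith [inv_pos.2 hlam]
  have h1 := (Real.isLittleO_log_id_atTop.comp_tendsto tendsto_natCast_atTop_atTop).bound
    (show 0 < ε / (2 * lam⁻¹) by positivity)
  filter_upwards [H.eventually_pos_le_log hlam hb, h1, tendsto_log_nat.eventually_ge_atTop 0]
    with n h2 h3 h4
  simp only [Function.comp_apply, id_eq, Real.norm_eq_abs] at h3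
  rw [abs_of_nonneg h4, abs_of_nonneg (by positivity : (0 : ℝ) ≤ n), div_mul_eq_mul_div,
    le_div_iff₀ (by positivity)] at h3
  linarith

lemma exists_sub_le (H : IsTypical lam v C τ p c) {ε : ℝ} (hε : 0 < ε) :
    ∃ K, ∀ j n, K ≤ j → j ≤ n → (p j).1 - (p n).1 ≤ ε := by
  obtain ⟨N, hN⟩ := H.right
  obtain ⟨m, hm⟩ := exists_nat_one_div_lt hε
  obtain ⟨K, hK⟩ := hN m
  exact ⟨max N K, fun j n hj hn => (hK n ((le_max_right _ _).trans (hj.trans hn)) j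
    ((le_max_left _ _).trans hj) hn).trans hm.le⟩

/-- The distance travelled is the net displacement, which is `o(n)`, plus twice the steps back,
which are eventually at most `ε` each. So travel takes a negligible fraction of the time. -/
lemma eventually_time_le (H : IsTypical lam v C τ p c) (hlam : 0 < lam) {a : ℝ} (ha : 1 < a) :
    ∀ᶠ n : ℕ in atTop, (p n).2 ≤ a * n := by
  set w := (v⁻¹).toReal with hw
  have hw0 : 0 ≤ w := ENNReal.toReal_nonneg
  set ε := (a - 1) / (8 * (w + 1)) with hε
  have hε0 : 0 < ε := div_pos (by linarith) (by linarith)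
  obtain ⟨K, hK⟩ := H.exists_sub_le hε0
  set D : ℝ := ∑ k ∈ Finset.range K, |(p (k + 1)).1 - (p k).1| + |(p K).1| with hD
  -- Beyond step `K`, the absolute value of an increment exceeds the increment by at most `2 * ε`,
  -- and the increments telescope.
  have hTV : ∀ n, K ≤ n → ∑ k ∈ Finset.range n, |(p (k + 1)).1 - (p k).1| ≤
      D + (p n).1 + 2 * ε * n := by
    intro n hn
    induction n, hn using Nat.le_induction with
    | base =>
      have h1 := neg_abs_le (p K).1
      have : 0 ≤ 2 * ε * K := by positivity
      linarith
    | succ n hn ih =>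
      rw [Finset.sum_range_succ]
      have h1 := hK n (n + 1) hn (Nat.le_succ n)
      have h2 : |(p (n + 1)).1 - (p n).1| ≤ (p (n + 1)).1 - (p n).1 + 2 * ε := by
        rw [abs_le]
        constructor <;> linarith
      push_cast
      linarith
  have h2 : ∀ᶠ n : ℕ in atTop, (w * D) / ((a - 1) / 4) ≤ n :=
    tendsto_natCast_atTop_atTop.eventually_ge_atTop _
  have ha' : 1 < 1 + (a - 1) / 4 := by linarith
  filter_upwards [H.average.eventually (gt_mem_nhds ha'), eventually_gt_atTop 0, eventually_ge_atTop K,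
    h2, H.eventually_pos_le_mul hlam hε0] with n h3 h4 h5 h6 h7
  have hn0 : (0 : ℝ) < n := by exact_mod_cast h4
  rw [div_lt_iff₀ hn0] at h3
  rw [div_le_iff₀ (by linarith)] at h6
  rw [H.time_eq_sum]
  simp_rw [travelTime_eq]
  rw [← Finset.sum_mul, ← hw]
  have h8 := mul_le_mul_of_nonneg_right (hTV n h5) hw0
  have h9 : (D + (p n).1 + 2 * ε * n) * w ≤ (D + ε * n + 2 * ε * n) * w :=
    mul_le_mul_of_nonneg_right (by linarith) hw0
  have h10 : ε * w ≤ (a - 1) / 8 := by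
    rw [hε, div_mul_eq_mul_div, div_le_div_iff₀ (by linarith) (by norm_num)]
    nlinarith
  have h11 := mul_le_mul_of_nonneg_right h10 hn0.le
  nlinarith

/-- In a cell the server cannot stay for long. -/
lemma exists_window (H : IsTypical lam v C τ p c) (hlam : 0 < lam) {q : ℕ} (hq : 0 < q)
    (hlq : 1 ≤ lam * q) :
    ∃ N : ℕ, ∀ n : ℕ, N ≤ n → ∀ j : ℤ, |j| ≤ (n : ℤ) → ∀ m : ℕ, N ≤ m → m ≤ n →
      (j : ℝ) / q ≤ (p m).1 → (∀ k : ℕ, m ≤ k → k ≤ n → (p k).1 < ((j : ℝ) + 1) / q) →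
      (n : ℝ) - m ≤ (lam * (1 / q + 1 / (q : ℝ) ^ 2) + 1 / q ^ 2) * (1 + 1 / q) * n := by
  have hq0 : (0 : ℝ) < q := by exact_mod_cast hq
  obtain ⟨K, hK⟩ := H.exists_sub_le (show (0 : ℝ) < 1 / q ^ 2 by positivity)
  obtain ⟨s₀, hs₀⟩ := eventually_atTop.1 (H.window q hlq)
  have ha : 1 < 1 + 1 / (2 * (q : ℝ)) := by
    have : 0 < 1 / (2 * (q : ℝ)) := by positivity
    linarith
  obtain ⟨n₁, hn₁⟩ := eventually_atTop.1 ((H.eventually_time_le hlam ha).and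
    (H.eventually_le_time (show (1 / 2 : ℝ) < 1 by norm_num)))
  refine ⟨K + n₁ + 2 * s₀ + 2 * q + 4, fun n hn j hj m hm hmn hjm hlt => ?_⟩
  obtain ⟨ht1, ht2⟩ := hn₁ n (by omega)
  set s := ⌈(p n).2⌉₊ with hs
  have hnr : (2 * s₀ + 2 * q + 4 : ℝ) ≤ n := by
    have : 2 * s₀ + 2 * q + 4 ≤ n := by omega
    exact_mod_cast this
  have ht0 : 0 ≤ (p n).2 := le_trans (by positivity) ht2
  have hs1 : (p n).2 ≤ s := Nat.le_ceil _
  have hs2 : (s : ℝ) < (p n).2 + 1 := Nat.ceil_lt_add_one ht0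
  have hss : s₀ ≤ s := by
    have : (s₀ : ℝ) ≤ s := by linarith
    exact_mod_cast this
  have hjs : |j| ≤ (s : ℤ) ^ 2 := by
    refine hj.trans ?_
    have : (n : ℝ) ≤ (s : ℝ) ^ 2 := by nlinarith
    exact_mod_cast this
  obtain ⟨k, hk, hks⟩ := hs₀ s hss j hjs
  -- The window extends by `1 / q ^ 2` to the left of the cell to allow for steps back.
  have hsub : ∀ k, m < k → k ≤ n →
      (p k).1 ∈ Set.Ico (j / q - 1 / q ^ 2 : ℝ) ((j + 1) / q) := by
    intro k hk1 hk2
    refine ⟨?_, hlt k hk1.le hk2⟩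
    have := hK m k (by omega) hk1.le
    linarith
  have hle : n - m ≤ k := by
    have h1 := H.sub_le_encard hsub
    have h2 : ((n - m : ℕ) : ℕ∞) ≤ (k : ℕ∞) := by
      rw [← hk]
      exact h1.trans (Set.encard_le_encard (Set.inter_subset_inter_right _ (Set.prod_mono le_rfl
        (Set.Icc_subset_Icc_right hs1))))
    exact_mod_cast h2
  have hle' : (n : ℝ) - m ≤ k := by
    have : n ≤ k + m := by omega
    have : (n : ℝ) ≤ k + m := by exact_mod_cast this
    linarith
  refine hle'.trans (hks.trans ?_)
  rw [mul_assoc]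
  refine mul_le_mul_of_nonneg_left ?_ (by positivity)
  have h3 : 1 ≤ 1 / (2 * (q : ℝ)) * n := by
    rw [div_mul_eq_mul_div, one_mul, le_div_iff₀ (by positivity)]
    linarith
  have h4 : (1 + 1 / (q : ℝ)) * n = (1 + 1 / (2 * (q : ℝ))) * n + 1 / (2 * (q : ℝ)) * n := by
    field_simp
    ring
  linarith

end IsTypical

/-! ### The lower bound for the speed, and the limits along the decision times -/

namespace IsTypical
variable {lam : ℝ} {v : ℝ≥0∞} {C : Set (ℝ × ℝ)} {τ : ℕ → ℝ} {p c : ℕ → ℝ × ℝ}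

/-- The server reaches every cell at most exponentially late. -/
lemma exists_le_pow (H : IsTypical lam v C τ p c) (hlam : 0 < lam) {q : ℕ} (hq : 0 < q)
    (hlq : 1 ≤ lam * q) {θ : ℝ}
    (hθ : θ = (lam * (1 / q + 1 / (q : ℝ) ^ 2) + 1 / q ^ 2) * (1 + 1 / q)) (hθ1 : θ < 1) (K : ℕ) :
    ∃ c₀ > 0, ∀ j : ℕ, ∃ n ≥ K, (n : ℝ) ≤ c₀ * ((1 - θ)⁻¹) ^ j ∧ (j : ℝ) / q ≤ (p n).1 := by
  have hq0 : (0 : ℝ) < q := by exact_mod_cast hq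
  have hθ0 : 0 < θ := by rw [hθ]; positivity
  have hθ2 : 0 < 1 - θ := by linarith
  obtain ⟨N, hN⟩ := H.exists_window hlam hq hlq
  obtain ⟨n₂, hn₂⟩ := eventually_atTop.1 (H.eventually_pos_le_mul hlam
    (show (0 : ℝ) < 1 / q by positivity))
  -- Staying below the next cell until step `n` would give `n - m ≤ θ * n`.
  have hreach : ∀ m n : ℕ, N ≤ m → m ≤ n → ∀ j : ℤ, |j| ≤ (n : ℤ) → (j : ℝ) / q ≤ (p m).1 →
      (m : ℝ) < (1 - θ) * n → ∃ k, m ≤ k ∧ k ≤ n ∧ ((j : ℝ) + 1) / q ≤ (p k).1 := by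
    intro m n hm hmn j hj hjm hlt
    by_contra! hne
    have := hN n (hm.trans hmn) j hj m hm hmn hjm hne
    rw [← hθ] at this
    linarith
  set M := max (max N n₂) K with hM
  -- At step `M` the server may be to the left of the origin; it climbs to it cell by cell, each in
  -- finitely many steps.
  obtain ⟨m₀, hm₀, hx₀⟩ : ∃ m₀ ≥ M, 0 ≤ (p m₀).1 := by
    have hind : ∀ i : ℕ, ∃ k ≥ M, ((⌊(p M).1 * q⌋ + i : ℤ) : ℝ) / q ≤ (p k).1 := by
      intro i
      induction i with
      | zero =>
        refine ⟨M, le_rfl, ?_⟩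
        rw [div_le_iff₀ hq0]
        simpa using Int.floor_le _
      | succ i ih =>
        obtain ⟨m, hm, hx⟩ := ih
        obtain ⟨n, hn⟩ := exists_nat_gt ((m : ℝ) / (1 - θ))
        rw [div_lt_iff₀ hθ2] at hn
        set j : ℤ := ⌊(p M).1 * q⌋ + i with hj
        obtain ⟨k, hk, -, hkx⟩ := hreach m (n + m + j.natAbs)
          (((le_max_left _ _).trans (le_max_left _ _)).trans hm) (by omega) j
          (by push_cast; rw [Int.abs_eq_natAbs]; omega) hx (by
            push_cast
            have : 0 ≤ (1 - θ) * ((m : ℝ) + j.natAbs) := by positivity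
            linarith)
        refine ⟨k, hm.trans hk, ?_⟩
        have : (⌊(p M).1 * q⌋ + (i + 1 : ℕ) : ℤ) = j + 1 := by rw [hj]; push_cast; ring
        rw [this]
        push_cast
        exact hkx
    obtain ⟨k, hk, hkx⟩ := hind (⌊(p M).1 * q⌋).natAbs
    refine ⟨k, hk, le_trans (div_nonneg ?_ hq0.le) hkx⟩
    have : 0 ≤ ⌊(p M).1 * q⌋ + ((⌊(p M).1 * q⌋).natAbs : ℤ) := by omega
    exact_mod_cast this
  set ρ := (1 - θ)⁻¹ with hρ
  have hρ1 : 1 < ρ := (one_lt_inv₀ hθ2).2 (by linarith)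
  have hρθ : (1 - θ) * ρ = 1 := mul_inv_cancel₀ hθ2.ne'
  -- The shift with `ρ * a = a + 1`; it turns the recursion `k ≤ ρ * m + 1` into the geometric one
  -- `k + a ≤ ρ * (m + a)`.
  set a := 1 / (ρ - 1) with ha
  have ha0 : 0 < a := one_div_pos.2 (by linarith)
  have haρ : ρ * a = a + 1 := by
    have : (ρ - 1) * a = 1 := mul_one_div_cancel (by linarith)
    linarith
  have hgrow : ∀ j : ℕ, ∃ n ≥ M, (n : ℝ) + a ≤ (m₀ + a) * ρ ^ j ∧ (j : ℝ) / q ≤ (p n).1 := by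
    intro j
    induction j with
    | zero => exact ⟨m₀, hm₀, by simp, by simpa using hx₀⟩
    | succ j ih =>
      obtain ⟨m, hm, hmle, hx⟩ := ih
      -- Since the position is at most `m / q`, the index of the cell stays in the range where the
      -- counts are controlled.
      have hjm : (j : ℝ) ≤ m := by
        have h1 := hx.trans (hn₂ m (((le_max_right _ _).trans (le_max_left _ _)).trans hm))
        rwa [one_div_mul_eq_div, div_le_div_iff_of_pos_right hq0] at h1
      have hjm' : j ≤ m := by exact_mod_cast hjm
      have hfl : ρ * m < (⌊ρ * m⌋₊ : ℝ) + 1 := Nat.lt_floor_add_one _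
      have hmn : m ≤ ⌊ρ * m⌋₊ + 1 := by
        have : (m : ℝ) ≤ ((⌊ρ * m⌋₊ + 1 : ℕ) : ℝ) := by
          push_cast
          nlinarith [(Nat.cast_nonneg m : (0 : ℝ) ≤ m)]
        exact_mod_cast this
      obtain ⟨k, hk, hkn, hkx⟩ := hreach m (⌊ρ * m⌋₊ + 1)
        (((le_max_left _ _).trans (le_max_left _ _)).trans hm) hmn j
        (by rw [abs_of_nonneg (by positivity)]; exact_mod_cast hjm'.trans hmn)
        hx (by
          push_cast
          have := mul_lt_mul_of_pos_left hfl hθ2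
          rwa [← mul_assoc, hρθ, one_mul] at this)
      refine ⟨k, hm.trans hk, ?_, by push_cast at hkx ⊢; exact hkx⟩
      have h1 : (k : ℝ) ≤ ρ * m + 1 := by
        have h2 : (k : ℝ) ≤ ((⌊ρ * m⌋₊ + 1 : ℕ) : ℝ) := by exact_mod_cast hkn
        have h3 : (⌊ρ * m⌋₊ : ℝ) ≤ ρ * m := Nat.floor_le (by positivity)
        push_cast at h2
        linarith
      have h4 := mul_le_mul_of_nonneg_left hmle (show 0 ≤ ρ by linarith)
      rw [pow_succ]
      linarith
  refine ⟨m₀ + a, by positivity, fun j => ?_⟩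
  obtain ⟨n, hn, hnle, hx⟩ := hgrow j
  exact ⟨n, (le_max_right _ _).trans hn, by linarith, hx⟩

/-- The cell of index about `(log n - log c₀) / L` has been reached at some step up to `n`, and
since then the server has fallen back by at most one. -/
lemma eventually_log_le_pos (H : IsTypical lam v C τ p c) (hlam : 0 < lam) {b : ℝ}
    (hb : b < lam⁻¹) : ∀ᶠ n : ℕ in atTop, b * Real.log n ≤ (p n).1 := by
  obtain ⟨b', hb1, hb2⟩ := exists_between (max_lt hb (inv_pos.2 hlam))
  have hbb : b < b' := (le_max_left _ _).trans_lt hb1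
  have hb'0 : 0 < b' := (le_max_right _ _).trans_lt hb1
  have h1 : ∀ᶠ q : ℕ in atTop, -((q : ℝ) *
      Real.log (1 - (lam * (1 / q + 1 / (q : ℝ) ^ 2) + 1 / q ^ 2) * (1 + 1 / q))) < b'⁻¹ :=
    (tendsto_growth' lam).eventually (gt_mem_nhds (lt_inv_of_lt_inv₀ hb'0 hb2))
  have h2 : ∀ᶠ q : ℕ in atTop, 1 ≤ lam * q :=
    (tendsto_natCast_atTop_atTop.const_mul_atTop hlam).eventually_ge_atTop 1
  have h3 : ∀ᶠ q : ℕ in atTop,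
      (lam * (1 / q + 1 / (q : ℝ) ^ 2) + 1 / q ^ 2) * (1 + 1 / q) < 1 := by
    have e1 : Tendsto (fun q : ℕ => 1 / (q : ℝ)) atTop (𝓝 0) := tendsto_one_div_atTop_nhds_zero_nat
    have e2 : Tendsto (fun q : ℕ => 1 / (q : ℝ) ^ 2) atTop (𝓝 0) := by
      simpa [div_pow] using e1.pow 2
    have e3 := (((e1.add e2).const_mul lam).add e2).mul (e1.const_add 1)
    simp only [add_zero, mul_zero, zero_mul] at e3
    exact e3.eventually (gt_mem_nhds one_pos)
  obtain ⟨q, hq1, hq2, hq3, hq4⟩ := (h1.and (h2.and (h3.and (eventually_gt_atTop 0)))).exists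
  have hq0 : (0 : ℝ) < q := by exact_mod_cast hq4
  obtain ⟨K, hK⟩ := H.exists_sub_le one_pos
  obtain ⟨c₀, hc₀, hreach⟩ := H.exists_le_pow hlam hq4 hq2 rfl hq3 K
  set θ := (lam * (1 / q + 1 / (q : ℝ) ^ 2) + 1 / q ^ 2) * (1 + 1 / q) with hθ
  have hθ0 : 0 < θ := by positivity
  set L := Real.log (1 - θ)⁻¹ with hL
  have hL0 : 0 < L := Real.log_pos ((one_lt_inv₀ (by linarith)).2 (by linarith))
  have hqL : q * L < b'⁻¹ := by rw [hL, Real.log_inv]; linarith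
  filter_upwards [eventually_gt_atTop 0, tendsto_log_nat.eventually_ge_atTop (Real.log c₀),
    tendsto_log_nat.eventually_ge_atTop ((b' * Real.log c₀ + 1 / q + 1) / (b' - b)),
    tendsto_natCast_atTop_atTop.eventually_ge_atTop c₀] with n hn h4 h5 h6
  have hn0 : (0 : ℝ) < n := by exact_mod_cast hn
  rw [div_le_iff₀ (by linarith)] at h5
  have hquot : 0 ≤ (Real.log n - Real.log c₀) / L := div_nonneg (by linarith) hL0.le
  set j := ⌊(Real.log n - Real.log c₀) / L⌋₊ with hj
  have hj1 : (j : ℝ) ≤ (Real.log n - Real.log c₀) / L := Nat.floor_le hquot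
  have hj2 : (Real.log n - Real.log c₀) / L < j + 1 := Nat.lt_floor_add_one _
  obtain ⟨k, hkK, hk, hkx⟩ := hreach j
  have hkn : (k : ℝ) ≤ n := by
    refine hk.trans ?_
    have hpos : 0 < c₀ * (1 - θ)⁻¹ ^ j := mul_pos hc₀ (pow_pos (inv_pos.2 (by linarith)) _)
    rw [← Real.log_le_log_iff hpos hn0, Real.log_mul hc₀.ne' (by
      exact (pow_pos (inv_pos.2 (by linarith)) _).ne'), Real.log_pow, ← hL]
    rw [le_div_iff₀ hL0] at hj1
    linarith
  have h7 := hK k n hkK (by exact_mod_cast hkn)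
  have h8 : (Real.log n - Real.log c₀) / L / q ≤ (j + 1) / q := by gcongr
  have h9 : b' * (Real.log n - Real.log c₀) ≤ (Real.log n - Real.log c₀) / L / q := by
    rw [div_div, le_div_iff₀ (by positivity)]
    have e1 : b' * (q * L) ≤ 1 := by
      have := mul_le_mul_of_nonneg_left hqL.le hb'0.le
      rwa [mul_inv_cancel₀ hb'0.ne'] at this
    have := mul_le_mul_of_nonneg_right e1 (show 0 ≤ Real.log n - Real.log c₀ by linarith)
    linarith
  rw [add_div] at h8
  linarith

lemma tendsto_pos (H : IsTypical lam v C τ p c) (hlam : 0 < lam) :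
    Tendsto (fun n : ℕ => (p n).1 / Real.log n) atTop (𝓝 lam⁻¹) := by
  refine tendsto_order.2 ⟨fun a ha => ?_, fun a ha => ?_⟩
  · obtain ⟨b, hb1, hb2⟩ := exists_between ha
    filter_upwards [H.eventually_log_le_pos hlam hb2, tendsto_log_nat.eventually_gt_atTop 0]
      with n h1 h2
    exact hb1.trans_le ((le_div_iff₀ h2).2 h1)
  · obtain ⟨b, hb1, hb2⟩ := exists_between ha
    filter_upwards [H.eventually_pos_le_log hlam hb1, tendsto_log_nat.eventually_gt_atTop 0]
      with n h1 h2
    exact ((div_le_iff₀ h2).2 h1).trans_lt hb2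

lemma tendsto_time (H : IsTypical lam v C τ p c) (hlam : 0 < lam) :
    Tendsto (fun n : ℕ => (p n).2 / n) atTop (𝓝 1) := by
  refine tendsto_order.2 ⟨fun a ha => ?_, fun a ha => ?_⟩
  · obtain ⟨b, hb1, hb2⟩ := exists_between ha
    filter_upwards [H.eventually_le_time hb2, eventually_gt_atTop 0] with n h1 h2
    exact hb1.trans_le ((le_div_iff₀ (by exact_mod_cast h2)).2 h1)
  · obtain ⟨b, hb1, hb2⟩ := exists_between ha
    filter_upwards [H.eventually_time_le hlam hb1, eventually_gt_atTop 0] with n h1 h2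
    exact ((div_le_iff₀ (by exact_mod_cast h2)).2 h1).trans_lt hb2

end IsTypical

/-! ### The motion in continuous time -/

lemma abs_travelPos_sub_le (v : ℝ≥0∞) (x y : ℝ) {r : ℝ} (hr : 0 ≤ r) :
    |travelPos v x y r - x| ≤ |y - x| := by
  rw [travelPos]
  split_ifs with h
  · exact le_rfl
  · push Not at h
    have h1 : 0 < travelTime v x y := hr.trans_lt h
    rw [add_sub_cancel_left, abs_mul, abs_of_nonneg (div_nonneg hr h1.le)]
    exact mul_le_of_le_one_left (abs_nonneg _) ((div_le_one h1).2 h.le)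

namespace IsRun
variable {v : ℝ≥0∞} {C : Set (ℝ × ℝ)} {τ : ℕ → ℝ} {p c : ℕ → ℝ × ℝ}

lemma time_lt_succ_numServed (R : IsRun v C τ p c) (hp : Tendsto (fun n => (p n).2) atTop atTop)
    (t : ℝ) : t < (p (numServed C v τ t + 1)).2 := by
  have hne : {n : ℕ | t < (state C v τ (n + 1)).time}.Nonempty := by
    obtain ⟨n, hn⟩ := ((hp.comp (tendsto_add_atTop_nat 1)).eventually_gt_atTop t).exists
    exact ⟨n, by rw [Set.mem_ofPred_eq, R.state_eq]; exact hn⟩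
  have := Nat.sInf_mem hne
  rw [Set.mem_ofPred_eq, R.state_eq] at this
  exact this

lemma time_numServed_le (R : IsRun v C τ p c) {t : ℝ} (ht : 0 ≤ t) :
    (p (numServed C v τ t)).2 ≤ t := by
  rcases Nat.eq_zero_or_pos (numServed C v τ t) with h | h
  · rw [h, R.start]; exact ht
  · have h1 : numServed C v τ t - 1 ∉ {n : ℕ | t < (state C v τ (n + 1)).time} :=
      Nat.notMem_of_lt_sInf (by change _ < numServed C v τ t; omega)
    rw [Set.mem_ofPred_eq, R.state_eq, not_lt, Nat.sub_add_cancel h] at h1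
    exact h1

lemma tendsto_numServed (R : IsRun v C τ p c) (hp : Tendsto (fun n => (p n).2) atTop atTop) :
    Tendsto (numServed C v τ) atTop atTop := by
  refine tendsto_atTop.2 fun M => ?_
  filter_upwards [eventually_ge_atTop (p M).2] with t ht
  by_contra! hlt
  have h1 := R.time_lt_succ_numServed hp t
  have h2 := R.time_mono (show numServed C v τ t + 1 ≤ M by omega)
  exact absurd (h1.trans_le h2) (not_lt.2 ht)

/-- The asymptotic behaviour at the decision times determines that of the motion. -/
lemma tendsto_position (R : IsRun v C τ p c) {ℓ : ℝ}
    (ht : Tendsto (fun n : ℕ => (p n).2 / n) atTop (𝓝 1))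
    (hx : Tendsto (fun n : ℕ => (p n).1 / Real.log n) atTop (𝓝 ℓ)) :
    Tendsto (fun t => position C v τ t / Real.log t) atTop (𝓝 ℓ) := by
  have hp : Tendsto (fun n => (p n).2) atTop atTop := by
    refine (ht.pos_mul_atTop one_pos tendsto_natCast_atTop_atTop).congr' ?_
    filter_upwards [eventually_gt_atTop 0] with n hn
    have : (0 : ℝ) < n := by exact_mod_cast hn
    field_simp
  have hlogsucc : Tendsto (fun n : ℕ => Real.log ((n + 1 : ℕ) : ℝ) / Real.log n) atTop (𝓝 1) := by
    have h1 := (Real.tendsto_log_nat_add_one_sub_log.div_atTop tendsto_log_nat).const_add 1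
    rw [add_zero] at h1
    refine h1.congr' ?_
    filter_upwards [tendsto_log_nat.eventually_gt_atTop 0] with n hn
    push_cast
    field_simp
    ring
  have hsucc : Tendsto (fun n : ℕ => ((n + 1 : ℕ) : ℝ) / n) atTop (𝓝 1) := by
    have h1 := (tendsto_one_div_atTop_nhds_zero_nat (𝕜 := ℝ)).const_add 1
    rw [add_zero] at h1
    refine h1.congr' ?_
    filter_upwards [eventually_gt_atTop 0] with n hn
    have : (0 : ℝ) < n := by exact_mod_cast hn
    push_cast
    field_simp
  have ht' : Tendsto (fun n : ℕ => (p (n + 1)).2 / n) atTop (𝓝 1) := by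
    have h1 := (ht.comp (tendsto_add_atTop_nat 1)).mul hsucc
    rw [one_mul] at h1
    refine h1.congr fun n => ?_
    have : ((n + 1 : ℕ) : ℝ) ≠ 0 := by positivity
    simp only [Function.comp_apply]
    field_simp
  have hx' : Tendsto (fun n : ℕ => (p (n + 1)).1 / Real.log n) atTop (𝓝 ℓ) := by
    have h1 := (hx.comp (tendsto_add_atTop_nat 1)).mul hlogsucc
    rw [mul_one] at h1
    refine h1.congr' ?_
    filter_upwards [tendsto_log_nat.eventually_gt_atTop 0,
      (tendsto_log_nat.comp (tendsto_add_atTop_nat 1)).eventually_gt_atTop 0] with n h2 h3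
    simp only [Function.comp_apply] at h3 ⊢
    field_simp
  have hN := R.tendsto_numServed hp
  set N := numServed C v τ with hNdef
  have hlogN : Tendsto (fun t => Real.log (N t)) atTop atTop := tendsto_log_nat.comp hN
  -- The time `t` lies between two successive decision times, both asymptotic to `N t`.
  have htN : Tendsto (fun t : ℝ => t / N t) atTop (𝓝 1) := by
    refine tendsto_of_tendsto_of_tendsto_of_le_of_le' (ht.comp hN) (ht'.comp hN) ?_ ?_
    · filter_upwards [eventually_ge_atTop 0] with t h0
      exact div_le_div_of_nonneg_right (R.time_numServed_le h0) (Nat.cast_nonneg _)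
    · exact Eventually.of_forall fun t =>
        div_le_div_of_nonneg_right (R.time_lt_succ_numServed hp t).le (Nat.cast_nonneg _)
  have hlog : Tendsto (fun t : ℝ => Real.log t / Real.log (N t)) atTop (𝓝 1) := by
    have h1 := ((htN.log one_ne_zero).div_atTop hlogN).const_add 1
    rw [add_zero] at h1
    refine h1.congr' ?_
    filter_upwards [eventually_gt_atTop 0, hlogN.eventually_gt_atTop 0,
      hN.eventually_gt_atTop 0] with t h2 h3 h4
    have : (N t : ℝ) ≠ 0 := by exact_mod_cast h4.ne'
    rw [Real.log_div h2.ne' this]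
    field_simp
    ring
  have hpos : Tendsto (fun t : ℝ => position C v τ t / Real.log (N t)) atTop (𝓝 ℓ) := by
    -- Between decisions the server is no farther from the last position than the next one is, and
    -- this jump is `o(log (N t))`, since both ends have the same limit.
    have h0 : Tendsto (fun t : ℝ => (position C v τ t - (p (N t)).1) / Real.log (N t)) atTop
        (𝓝 0) := by
      have h1 := ((hx'.sub hx).comp hN).norm
      rw [sub_self, norm_zero] at h1
      refine squeeze_zero_norm' ?_ h1
      filter_upwards [eventually_ge_atTop 0] with t h2
      simp only [Function.comp_apply]
      rw [← sub_div, norm_div, norm_div]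
      refine div_le_div_of_nonneg_right ?_ (norm_nonneg _)
      rw [position, R.state_eq, R.state_eq]
      exact abs_travelPos_sub_le v _ _ (sub_nonneg.2 (R.time_numServed_le h2))
    have h1 := (hx.comp hN).add h0
    rw [add_zero] at h1
    refine h1.congr fun t => ?_
    simp only [Function.comp_apply]
    rw [← add_div]
    ring
  have h1 := hpos.div hlog one_ne_zero
  rw [div_one] at h1
  refine h1.congr' ?_
  filter_upwards [hlogN.eventually_gt_atTop 0] with t h2
  simp only [Pi.div_apply]
  rw [div_div_div_cancel_right₀ h2.ne']

end IsRun

/-! ### Almost sure limits and the probabilities of the two directions -/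

section
variable {Ω : Type*} [MeasurableSpace Ω] {μ : Measure Ω} [IsProbabilityMeasure μ] {lam : ℝ}
  {η : Ω → Conf} {T : Ω → ℕ → ℝ} {v : ℝ≥0∞}

lemma ae_isTypical (hη : IsInput μ lam η T) (hlam : 0 < lam) (v : ℝ≥0∞) :
    ∀ᵐ ω ∂μ, path v 0 (fun _ => 0) (η ω) (T ω) ∈ rightward →
      ∃ c, IsTypical lam v (η ω).carrier (T ω) (path v 0 (fun _ => 0) (η ω) (T ω)) c := by
  have hεl : ∀ q : ℕ, 1 ≤ lam * q → 0 < (q : ℝ) ∧ 1 / (q : ℝ) ^ 2 ≤ lam * (1 / q) := by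
    intro q hq
    have hq0 : (0 : ℝ) < q := by
      by_contra! hle
      nlinarith
    refine ⟨hq0, ?_⟩
    rw [mul_one_div, div_le_div_iff₀ (by positivity) hq0]
    nlinarith
  have hcell : ∀ᵐ ω ∂μ, ∀ q : ℕ, 1 ≤ lam * q → ∀ᶠ s : ℕ in atTop, ∀ j : ℤ, |j| ≤ (s : ℤ) ^ 2 →
      ∃ k : ℕ, ((η ω).carrier ∩ Set.Ico (j / q : ℝ) ((j + 1) / q) ×ˢ Set.Icc 0 (s : ℝ)).encard = k ∧
        (lam / q - 1 / q ^ 2) * s ≤ k := by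
    refine ae_all_iff.2 fun q => ?_
    by_cases hq : 1 ≤ lam * q
    · obtain ⟨hq0, hle⟩ := hεl q hq
      filter_upwards [ae_eventually_encard hη hlam (1 / q) 0 (l := 1 / q) (by positivity)
        (show (0 : ℝ) < 1 / q ^ 2 by positivity) hle] with ω h1 _
      filter_upwards [h1] with s h2 j hj
      obtain ⟨k, hk, h3, -⟩ := h2 j hj
      refine ⟨k, ?_, by rwa [mul_one_div] at h3⟩
      rw [← hk]
      congr 5 <;> ring
    · exact Eventually.of_forall fun ω h => absurd h hq
  have hwindow : ∀ᵐ ω ∂μ, ∀ q : ℕ, 1 ≤ lam * q → ∀ᶠ s : ℕ in atTop, ∀ j : ℤ, |j| ≤ (s : ℤ) ^ 2 →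
      ∃ k : ℕ, ((η ω).carrier ∩ Set.Ico (j / q - 1 / q ^ 2 : ℝ) ((j + 1) / q) ×ˢ
        Set.Icc 0 (s : ℝ)).encard = k ∧ k ≤ (lam * (1 / q + 1 / q ^ 2) + 1 / q ^ 2) * s := by
    refine ae_all_iff.2 fun q => ?_
    by_cases hq : 1 ≤ lam * q
    · obtain ⟨hq0, hle⟩ := hεl q hq
      have h0 : (0 : ℝ) < 1 / q ^ 2 := by positivity
      filter_upwards [ae_eventually_encard hη hlam (1 / q) (-(1 / q ^ 2)) (l := 1 / q + 1 / q ^ 2)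
        (by positivity) h0 (hle.trans (mul_le_mul_of_nonneg_left (by linarith) hlam.le))]
        with ω h1 _
      filter_upwards [h1] with s h2 j hj
      obtain ⟨k, hk, -, h3⟩ := h2 j hj
      refine ⟨k, ?_, h3⟩
      rw [← hk]
      congr 5 <;> ring
    · exact Eventually.of_forall fun ω h => absurd h hq
  filter_upwards [ae_isRun hη v, hη.ae_tendsto_average, ae_eventually_initial hη, hcell, hwindow]
    with ω ⟨c, R⟩ h1 h2 h3 h4 h5
  exact ⟨c, R, h5, h1, h2, h3, h4⟩

/-- The speed of the server in either direction. -/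
lemma ae_tendsto_position (hη : IsInput μ lam η T) (hlam : 0 < lam) (v : ℝ≥0∞) :
    ∀ᵐ ω ∂μ,
      (path v 0 (fun _ => 0) (η ω) (T ω) ∈ rightward →
        Tendsto (fun t => position (η ω).carrier v (T ω) t / Real.log t) atTop (𝓝 lam⁻¹)) ∧
      (path v 0 (fun _ => 0) (η ω) (T ω) ∈ reflectPath ⁻¹' rightward →
        Tendsto (fun t => position (η ω).carrier v (T ω) t / Real.log t) atTop (𝓝 (-lam⁻¹))) := by
  filter_upwards [ae_isTypical hη hlam v, ae_isTypical hη.reflect hlam v, ae_isRun hη v]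
    with ω h1 h2 ⟨c, R⟩
  refine ⟨fun h => ?_, fun h => ?_⟩
  · obtain ⟨c', H⟩ := h1 h
    exact R.tendsto_position (H.tendsto_time hlam) (H.tendsto_pos hlam)
  · have hz : reflectPath (fun _ => 0) = fun _ => 0 := by
      funext k
      simp [reflectPath, reflectPoint]
    -- A path to the left is the mirror image of a path to the right in the reflected input, which
    -- has the same properties.
    have hr := path_reflect v 0 (fun _ => 0) (η ω) (T ω)
    rw [hz] at hr
    rw [hr] at h2
    obtain ⟨c', H⟩ := h2 h
    refine R.tendsto_position (H.tendsto_time hlam) ?_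
    refine (H.tendsto_pos hlam).neg.congr fun n => ?_
    simp [reflectPath, reflectPoint, neg_div]

/-- The two directions cover almost everything, are equally likely by reflection, and overlap in a
null set because their limits differ. -/
lemma measure_rightward_eq_half (hη : IsInput μ lam η T) (hlam : 0 < lam) (hv : 0 < v) :
    μ {ω | path v 0 (fun _ => 0) (η ω) (T ω) ∈ rightward} = 1 / 2 := by
  set A := {ω | path v 0 (fun _ => 0) (η ω) (T ω) ∈ rightward} with hA
  set B := {ω | path v 0 (fun _ => 0) (η ω) (T ω) ∈ reflectPath ⁻¹' rightward} with hB
  have hAm : MeasurableSet A := by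
    have := hη.isFresh.measurable_path_const v 0 (fun _ => 0) measurableSet_rightward
    simp only [Conf.inter_exploredBy_zero] at this
    exact this
  have h1 : μ (A ∪ B) = 1 := by
    rw [← measure_univ (μ := μ)]
    refine measure_congr (eventuallyEq_univ.2 ?_)
    exact ae_oneWay hη hlam hv
  have h2 : μ (A ∩ B) = 0 := by
    refine measure_eq_zero_iff_ae_notMem.2 ?_
    filter_upwards [ae_tendsto_position hη hlam v] with ω hω hmem
    have := tendsto_nhds_unique (hω.1 hmem.1) (hω.2 hmem.2)
    linarith [inv_pos.2 hlam]
  have h3 := measure_union_add_inter' hAm B (μ := μ)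
  rw [h1, h2, add_zero, ← measure_rightward_eq hη, ← two_mul] at h3
  rw [one_div]
  exact ENNReal.eq_inv_of_mul_eq_one_left (by rw [mul_comm]; exact h3.symm)

end

end GreedyServer

end

/-! ### The theorem -/

theorem theorem1 {Ω : Type*} [MeasurableSpace Ω] (μ : Measure Ω) [IsProbabilityMeasure μ]
    (v : ℝ≥0∞) (hv : 0 < v) (lam : ℝ) (hlam : 0 < lam)
    (ξ₀ : Ω → Set ℝ) (ξ : Ω → Set (ℝ × ℝ)) (T : ℕ → Ω → ℝ)
    (hmodel : GreedyServer.IsGreedyModel μ lam ξ₀ ξ T)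
    (hexp : ∃ α : ℝ, 0 < α ∧ Integrable (fun ω => Real.exp (α * T 0 ω)) μ) :
    GreedyServer.IsTransient μ (GreedyServer.S v ξ₀ ξ T) ∧
    (∀ᵐ ω ∂μ,
      Tendsto (fun t : ℝ => GreedyServer.S v ξ₀ ξ T t ω / (lam⁻¹ * Real.log t)) atTop (𝓝 1) ∨
      Tendsto (fun t : ℝ => GreedyServer.S v ξ₀ ξ T t ω / (lam⁻¹ * Real.log t)) atTop (𝓝 (-1))) ∧
    μ {ω | Tendsto (fun t : ℝ => GreedyServer.S v ξ₀ ξ T t ω / (lam⁻¹ * Real.log t))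
      atTop (𝓝 1)} = 1 / 2 ∧
    μ {ω | Tendsto (fun t : ℝ => GreedyServer.S v ξ₀ ξ T t ω / (lam⁻¹ * Real.log t))
      atTop (𝓝 (-1))} = 1 / 2 := by
  obtain ⟨η, T', hη, hηT⟩ := hmodel.exists_isInput hexp
  set A := {ω | GreedyServer.path v 0 (fun _ => 0) (η ω) (T' ω) ∈ GreedyServer.rightward} with hA
  set B := {ω | GreedyServer.path v 0 (fun _ => 0) (η ω) (T' ω) ∈
    GreedyServer.reflectPath ⁻¹' GreedyServer.rightward} with hB
  have hhalf : μ A = 1 / 2 := GreedyServer.measure_rightward_eq_half hη hlam hv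
  have hdir : ∀ᵐ ω ∂μ,
      (ω ∈ A → Tendsto (fun t : ℝ => GreedyServer.S v ξ₀ ξ T t ω / (lam⁻¹ * Real.log t))
        atTop (𝓝 1)) ∧
      (ω ∈ B → Tendsto (fun t : ℝ => GreedyServer.S v ξ₀ ξ T t ω / (lam⁻¹ * Real.log t))
        atTop (𝓝 (-1))) ∧ (ω ∈ A ∨ ω ∈ B) := by
    have hS : ∀ (f : ℝ → ℝ) (ℓ : ℝ), Tendsto (fun t => f t / Real.log t) atTop (𝓝 (ℓ * lam⁻¹)) →
        Tendsto (fun t => f t / (lam⁻¹ * Real.log t)) atTop (𝓝 ℓ) := by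
      intro f ℓ hf
      have h1 := hf.div_const lam⁻¹
      rw [mul_div_cancel_right₀ _ (inv_ne_zero hlam.ne')] at h1
      refine h1.congr fun t => ?_
      rw [div_div, mul_comm]
    filter_upwards [GreedyServer.ae_tendsto_position hη hlam v, GreedyServer.ae_oneWay hη hlam hv,
      hηT] with ω ⟨h1, h2⟩ h3 ⟨h4, h5⟩
    rw [h4, h5] at h1 h2
    have h6 : (fun t => GreedyServer.S v ξ₀ ξ T t ω) =
      GreedyServer.position (GreedyServer.customers (ξ₀ ω) (ξ ω)) v fun n => T n ω := rfl
    refine ⟨fun h => hS (fun t => GreedyServer.S v ξ₀ ξ T t ω) 1 ?_,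
      fun h => hS (fun t => GreedyServer.S v ξ₀ ξ T t ω) (-1) ?_, h3⟩
    · rw [one_mul]
      refine h1 ?_
      have : ω ∈ A := h
      rwa [hA, Set.mem_ofPred_eq, h5] at this
    · rw [neg_one_mul]
      refine h2 ?_
      have : ω ∈ B := h
      rwa [hB, Set.mem_ofPred_eq, h5] at this
  have hlim : ∀ᵐ ω ∂μ,
      Tendsto (fun t : ℝ => GreedyServer.S v ξ₀ ξ T t ω / (lam⁻¹ * Real.log t)) atTop (𝓝 1) ∨
      Tendsto (fun t : ℝ => GreedyServer.S v ξ₀ ξ T t ω / (lam⁻¹ * Real.log t)) atTop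
        (𝓝 (-1)) := by
    filter_upwards [hdir] with ω ⟨h1, h2, h3⟩
    exact h3.imp h1 h2
  have hlog : Tendsto (fun t : ℝ => lam⁻¹ * Real.log t) atTop atTop :=
    Real.tendsto_log_atTop.const_mul_atTop (inv_pos.2 hlam)
  refine ⟨?_, hlim, ?_, ?_⟩
  · filter_upwards [hlim] with ω hω
    have hcancel : (fun t : ℝ => GreedyServer.S v ξ₀ ξ T t ω / (lam⁻¹ * Real.log t) *
        (lam⁻¹ * Real.log t)) =ᶠ[atTop] fun t => GreedyServer.S v ξ₀ ξ T t ω := by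
      filter_upwards [hlog.eventually_gt_atTop 0] with t ht
      exact div_mul_cancel₀ _ ht.ne'
    rcases hω with h | h
    · exact ((h.pos_mul_atTop one_pos hlog).congr' hcancel).mono_right IsOrderBornology.atTop_le_cobounded
    · exact ((h.neg_mul_atTop (by norm_num) hlog).congr' hcancel).mono_right IsOrderBornology.atBot_le_cobounded
  · rw [← hhalf]
    refine measure_congr ?_
    filter_upwards [hdir] with ω ⟨h1, h2, h3⟩
    -- Up to a null set the limit is `1` exactly when the path moves to the right, since the other
    -- direction has a different limit.
    refine propext ⟨fun h => h3.resolve_right fun hBω => ?_, fun h => h1 h⟩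
    have := tendsto_nhds_unique h (h2 hBω)
    norm_num at this
  · rw [← hhalf, hA, GreedyServer.measure_rightward_eq hη]
    refine measure_congr ?_
    filter_upwards [hdir] with ω ⟨h1, h2, h3⟩
    refine propext ⟨fun h => h3.resolve_left fun hAω => ?_, fun h => h2 h⟩
    have := tendsto_nhds_unique h (h1 hAω)
    norm_num at this
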